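/- **Code.** Let $k_1,k_2\ge 2$ be even, $n_1=k_1+2$, $n_2=k_2+2$. The concatenated iceberg code $\mathcal I_{k_2}\circ\mathcal I_{k_1}$ lives on data qubits $(x,y)$, $0\le x<n_1$ (columns), $0\le y<n_2$ (rows); its code space is the joint $+1$-eigenspace of the products of all $X$, and of all $Z$, along every row and along every pair of columns. **QEC cycle.** The first half extracts the $X$ stabilizers. (i) An $n_1$-qubit block $b$ is prepared in the logical state $|\bar +\rangle^{\otimes k_1}$ of $\mathcal I_{k_1}$ by the Hadamard conjugate of the two-branch circuit ($b_0$ in $|+\rangle$, other qubits in $|0\rangle$, CX gates along the tree $0\to1\to3\to\cdots$, $0\to2\to4\to\cdots$, then measurement of $Z_{n_1-2}Z_{n_1-1}$ with one ancilla), repeated until the check succeeds. (ii) Flags $f_0,\dots,f_{n_1-1}$ are set to $|0\rangle$; transversal CX from $b$ to $f$; for each row $y$, transversal CX onto the row, from $b$ if $y$ is even and from $f$ if $y$ is odd; transversal CX from $b$ to $f$; $b$ is measured in the $X$ basis and $f$ in the $Z$ basis. (iii) For each row a Bell pair (ancilla in $|+\rangle$, flag in $|0\rangle$, CX) interacts by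 CX with the qubits of the row, the ancilla with even and the flag with odd columns; after a final CX the ancilla is measured in the $X$ and the flag in the $Z$ basis. The second half is the Hadamard conjugate of the first (CX gates reversed, $X$ and $Z$ exchanged) and extracts the $Z$ stabilizers. **Faults.** A fault is a nontrivial Pauli error after an initialisation, a (one- or two-qubit) Pauli error after a CX gate, or a Pauli error before a measurement, anywhere in the cycle (rejected preparation attempts included). **Decoder.** $Z$ and $X$ errors are decoded separately, each as follows. Let $V,H$ be the sets of columns and rows flagged for hook errors of this type ($Z$ errors: flags of the second half of the previous cycle; $X$ errors: flags of the first half of the current cycle). Let $\mathcal X$ be the set of columns with nontrivial syndrome (determined up to complement by the measurement of $b$; the smaller set is taken, and if both have $n_1/2$ elements the one not containing column $0$) and $\mathcal Y$ the set of rows with nontrivial syndrome. Two bits are passed on from cycle to cycle: $P$ (previous cycle had a detected internal failure; initially false) and $A$ (an input error is allowed; initially true). "Correct $C$ as input": halt if $A$ is false, otherwise correct $C$ and set $P=A=\text{false}$. "Correct $C$ as internal": halt if $P$ is true, otherwise correct $C$ and set $P=\text{true}$, $A=\text{false}$. "Correct $C$ as hook" means as input for $Z$ errors and as internal for $X$ errors.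 - $V=H=\emptyset$: if $\mathcal X=\mathcal Y=\emptyset$, do nothing and set $P=\text{false}$, $A=\text{true}$; if $\mathcal X=\emptyset$ and $\mathcal Y$ contains all rows, correct the full column $0$ as hook; if $|\mathcal X|=|\mathcal Y|=1$, correct $\mathcal X\times\mathcal Y$, as input if $A$ is true and as internal otherwise; if $|\mathcal X|+|\mathcal Y|=1$, halt if $P$ is true, otherwise correct nothing and set $P=A=\text{true}$; halt in all other cases. - $V=\{x\}$, $H=\emptyset$: halt unless $\mathcal X=\{x\}$ (if $|\mathcal Y|$ is odd) or $\mathcal X=\emptyset$ (if $|\mathcal Y|$ is even); otherwise correct $\{x\}\times\mathcal Y$ as hook. - $V=\emptyset$, $H=\{y\}$: halt unless $\mathcal Y=\{y\}$ (if $|\mathcal X|$ is odd) or $\mathcal Y=\emptyset$ (if $|\mathcal X|$ is even); otherwise correct $\mathcal X\times\{y\}$ as hook. - Halt in all other cases. The computation halts as soon as one of the two decoders halts; otherwise the corrections are applied at the end of the cycle. **Generalized weight at most one.** A Pauli error is of generalized weight at most one if its $X$ part and its $Z$ part each are: a string on at most one qubit; or a string of errors within one column (or within one row) whose coordinate is known,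 being the only one flagged in the information passed on to the next cycle; or the string on all the qubits of one column. (At the end of a cycle flags are passed on for $Z$ errors only, so for the $X$ part no coordinate counts as known.) **Proposition.** Let a state $|\bar\psi\rangle$ in the code space of $\mathcal I_{k_2}\circ\mathcal I_{k_1}$ be input to $m$ rounds of the QEC cycle. Suppose that every ExRec, i.e. every pair of consecutive cycles, contains at most one fault (if $m=1$: the single cycle contains at most one fault). Then the computation does not halt, and the output error has generalized weight at most one. That is, for every pattern of faults, reset branches and measurement outcomes of non-zero probability, the computation does not halt, and there is a Pauli operator $E$ on the data qubits of generalized weight at most one, depending on the pattern but not on $|\bar\psi\rangle$, such that the data qubits end in the state $E|\bar\psi\rangle$ (up to a scalar), unentangled with the ancillas. -/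

import Mathlib

namespace ConcatIceberg

noncomputable section

/-! ## Pure states, Pauli operators and noisy circuits -/

/-- (Not necessarily normalised) pure states of a register of qubits labelled by `Q`: the amplitude
of every computational basis state. -/
abbrev QState (Q : Type) : Type := (Q → ZMod 2) → ℂ

/-- `(-1) ^ b`. -/
def sgn (b : ZMod 2) : ℂ := (-1) ^ b.val

/-- The Pauli operator `Z^z X^x` (phases are irrelevant here). -/
structure Pauli (Q : Type) where
  x : Q → ZMod 2
  z : Q → ZMod 2

/-- Action of a Pauli operator on a state. -/
def Pauli.apply {Q : Type} [Fintype Q] (P : Pauli Q) (ψ : QState Q) : QState Q :=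
  fun s => sgn (∑ q, P.z q * s q) * ψ (s + P.x)

/-- A single-qubit Pauli operator `Z^z X^x`, given as the pair `(x, z)`. -/
abbrev Pauli1 : Type := ZMod 2 × ZMod 2

/-- The single-qubit Pauli operator `P` acting on the qubit `q`. -/
def pauliOn {Q : Type} [DecidableEq Q] (q : Q) (P : Pauli1) : Pauli Q :=
  ⟨Pi.single q P.1, Pi.single q P.2⟩

/-- The elementary operations of a circuit: (re)initialisation in `|0⟩` or `|+⟩`, controlled-X,
and measurement of `Z` or `X`. -/
inductive Op (Q : Type) where
  | prepZ (q : Q)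
  | prepX (q : Q)
  | cx (control target : Q)
  | measZ (q : Q)
  | measX (q : Q)

/-- Conjugation of an operation by Hadamard gates on all qubits. -/
def Op.dual {Q : Type} : Op Q → Op Q
  | .prepZ q => .prepX q
  | .prepX q => .prepZ q
  | .cx c t => .cx t c
  | .measZ q => .measX q
  | .measX q => .measZ q

/-- The faultless action of an operation, as the Kraus operator selected by the classical data.
A reset of `q` to `|0⟩` (to `|+⟩`) has the Kraus operators `|0⟩⟨b|` (`|+⟩⟨b|`), where `b = r q`;
a measurement of `q` with outcome `m q` (`0` for the eigenvalue `+1`, `1` for `-1`) projects onto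
the corresponding eigenspace. -/
def Op.ideal {Q : Type} [DecidableEq Q] (r m : Q → ZMod 2) : Op Q → QState Q → QState Q
  | .prepZ q, ψ => fun s => if s q = 0 then ψ (Function.update s q (r q)) else 0
  | .prepX q, ψ => fun s => ((1 / Real.sqrt 2 : ℝ) : ℂ) * ψ (Function.update s q (r q))
  | .cx c t, ψ => fun s => ψ (Function.update s t (s t + s c))
  | .measZ q, ψ => fun s => if s q = m q then ψ s else 0
  | .measX q, ψ => fun s => (1 / 2 : ℂ) * (ψ s + sgn (m q) * ψ (s + Pi.single q 1))

/-- What goes wrong at one location of a circuit: a Pauli operator on the control and one on the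
target of a controlled-X, or (first component) a Pauli operator on the qubit that is initialised or
measured. `0` means that there is no fault. -/
abbrev Fault : Type := Pauli1 × Pauli1

/-- The noisy operation: the Pauli operator acts after an initialisation or a controlled-X, and
before a measurement. A Pauli fault on an idle data or ancilla qubit is the same as a fault at an
adjacent location of that qubit. -/
def Op.noisy {Q : Type} [Fintype Q] [DecidableEq Q] (r m : Q → ZMod 2) (o : Op Q) (f : Fault)
    (ψ : QState Q) : QState Q :=
  match o with
  | .prepZ q => (pauliOn q f.1).apply ((Op.prepZ q).ideal r m ψ)
  | .prepX q => (pauliOn q f.1).apply ((Op.prepX q).ideal r m ψ)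
  | .cx c t => (pauliOn c f.1).apply ((pauliOn t f.2).apply ((Op.cx c t).ideal r m ψ))
  | .measZ q => (Op.measZ q).ideal r m ((pauliOn q f.1).apply ψ)
  | .measX q => (Op.measX q).ideal r m ((pauliOn q f.1).apply ψ)

/-- The circuit `C` with a (possibly trivial) fault at each of its locations. -/
structure Noisy {Q : Type} (C : List (Op Q)) where
  ops : List (Op Q × Fault)
  ops_eq : ops.map Prod.fst = C

/-- The number of faults. -/
def Noisy.faults {Q : Type} {C : List (Op Q)} (N : Noisy C) : ℕ :=
  N.ops.countP (fun p => decide (p.2 ≠ 0))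

/-- The noisy circuit, run with reset data `r` and measurement outcomes `m` (in the circuits below,
every qubit is initialised at most once and measured at most once). -/
def Noisy.run {Q : Type} [Fintype Q] [DecidableEq Q] {C : List (Op Q)} (N : Noisy C)
    (r m : Q → ZMod 2) (ψ : QState Q) : QState Q :=
  N.ops.foldl (fun φ p => p.1.noisy r m p.2 φ) ψ

/-- Product of a state of the register `A` and a state of the register `B`. -/
def QState.prod {A B : Type} (ψ : QState A) (χ : QState B) : QState (A ⊕ B) :=
  fun s => ψ (fun a => s (Sum.inl a)) * χ (fun b => s (Sum.inr b))

/-- A Pauli operator on the register `A`, acting on `A` and `B` jointly. -/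
def Pauli.onLeft {A : Type} (B : Type) (P : Pauli A) : Pauli (A ⊕ B) :=
  ⟨Sum.elim P.x 0, Sum.elim P.z 0⟩

/-! ## The code -/

/-- Data qubits of the concatenated iceberg code: the qubit `(i, j)` lies in column `i` and in row
`j`, with `n₁ = k₁ + 2` columns and `n₂ = k₂ + 2` rows. -/
abbrev Data (k₁ k₂ : ℕ) : Type := Fin (k₁ + 2) × Fin (k₂ + 2)

/-- Indicator vector of row `j`. -/
def rowVec (k₁ k₂ : ℕ) (j : Fin (k₂ + 2)) : Data k₁ k₂ → ZMod 2 :=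
  fun p => if p.2 = j then 1 else 0

/-- Indicator vector of column `i`. -/
def colVec (k₁ k₂ : ℕ) (i : Fin (k₁ + 2)) : Data k₁ k₂ → ZMod 2 :=
  fun p => if p.1 = i then 1 else 0

/-- The code space: the states fixed by the products of all `X` and of all `Z` along every row and
along every pair of columns. -/
def codeSpace (k₁ k₂ : ℕ) : Set (QState (Data k₁ k₂)) :=
  {ψ | (∀ j, (⟨rowVec k₁ k₂ j, 0⟩ : Pauli _).apply ψ = ψ ∧
          (⟨0, rowVec k₁ k₂ j⟩ : Pauli _).apply ψ = ψ) ∧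
       (∀ i i', (⟨colVec k₁ k₂ i + colVec k₁ k₂ i', 0⟩ : Pauli _).apply ψ = ψ ∧
          (⟨0, colVec k₁ k₂ i + colVec k₁ k₂ i'⟩ : Pauli _).apply ψ = ψ)}

/-! ## The circuit of a QEC cycle -/

/-- Ancilla qubits: the encoded iceberg block `blk` and its unencoded flags `flg`, used for the
column-pair stabilizers; the Bell pairs `low j`, `lowFlg j`, used for the row stabilizers; and the
qubit `chk`, used to verify the preparation of the encoded block. -/
inductive Anc (k₁ k₂ : ℕ) where
  | blk (i : Fin (k₁ + 2))
  | flg (i : Fin (k₁ + 2))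
  | low (j : Fin (k₂ + 2))
  | lowFlg (j : Fin (k₂ + 2))
  | chk
  deriving DecidableEq, Fintype

/-- All qubits. -/
abbrev Qubit (k₁ k₂ : ℕ) : Type := Data k₁ k₂ ⊕ Anc k₁ k₂

/-- The two halves of a cycle: `Half.X` extracts the `X` stabilizers, `Half.Z` the `Z` ones. -/
inductive Half where
  | X
  | Z

variable {k₁ k₂ : ℕ}

/-- Data qubit. -/
def dq (i : Fin (k₁ + 2)) (j : Fin (k₂ + 2)) : Qubit k₁ k₂ := Sum.inl (i, j)

/-- Ancilla qubit. -/
def aq (a : Anc k₁ k₂) : Qubit k₁ k₂ := Sum.inr a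

/-- The parent of node `i ≥ 1` in the tree with two branches `0 → 1 → 3 → 5 → ⋯` and
`0 → 2 → 4 → ⋯`. -/
def parent (i : Fin (k₁ + 2)) : Fin (k₁ + 2) := ⟨i.val - 2, by omega⟩

/-- Two-branch preparation of the logical all-zero state of the block `blk` (a GHZ state): CX gates
along the tree, followed by the measurement, with the qubit `chk`, of the product of the `Z`
operators of the two terminal nodes. -/
def zeroPrep (k₁ k₂ : ℕ) : List (Op (Qubit k₁ k₂)) :=
  [.prepX (aq (.blk 0))]
  ++ (List.finRange (k₁ + 2)).tail.map (fun i => .prepZ (aq (.blk i)))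
  ++ (List.finRange (k₁ + 2)).tail.map (fun i => .cx (aq (.blk (parent i))) (aq (.blk i)))
  ++ [.prepZ (aq .chk),
      .cx (aq (.blk ⟨k₁, by omega⟩)) (aq .chk),
      .cx (aq (.blk (Fin.last (k₁ + 1)))) (aq .chk),
      .measZ (aq .chk)]

/-- Extraction of the column-pair `X` stabilizers with the block `blk`, prepared beforehand in the
logical all-plus state: flags in `|0⟩`, transversal CX onto the flags, transversal CX onto the rows
of data qubits (alternately from the block and from the flags), transversal CX onto the flags,
measurement of the block in the `X` basis and of the flags in the `Z` basis. -/
def highExtraction (k₁ k₂ : ℕ) : List (Op (Qubit k₁ k₂)) :=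
  (List.finRange (k₁ + 2)).map (fun i => .prepZ (aq (.flg i)))
  ++ (List.finRange (k₁ + 2)).map (fun i => .cx (aq (.blk i)) (aq (.flg i)))
  ++ (List.finRange (k₂ + 2)).flatMap (fun j => (List.finRange (k₁ + 2)).map (fun i =>
      .cx (aq (if Even j.val then .blk i else .flg i)) (dq i j)))
  ++ (List.finRange (k₁ + 2)).map (fun i => .cx (aq (.blk i)) (aq (.flg i)))
  ++ (List.finRange (k₁ + 2)).map (fun i => .measX (aq (.blk i)))
  ++ (List.finRange (k₁ + 2)).map (fun i => .measZ (aq (.flg i)))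

/-- Bell-pair extraction of the `X` stabilizer of row `j`. -/
def lowExtraction (k₁ k₂ : ℕ) (j : Fin (k₂ + 2)) : List (Op (Qubit k₁ k₂)) :=
  [.prepX (aq (.low j)), .prepZ (aq (.lowFlg j)), .cx (aq (.low j)) (aq (.lowFlg j))]
  ++ (List.finRange (k₁ + 2)).map (fun i =>
      .cx (aq (if Even i.val then .low j else .lowFlg j)) (dq i j))
  ++ [.cx (aq (.low j)) (aq (.lowFlg j)), .measX (aq (.low j)), .measZ (aq (.lowFlg j))]

/-- Extraction of all `X` stabilizers, after the preparation of the block. -/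
def xExtraction (k₁ k₂ : ℕ) : List (Op (Qubit k₁ k₂)) :=
  highExtraction k₁ k₂ ++ (List.finRange (k₂ + 2)).flatMap (lowExtraction k₁ k₂)

/-- Preparation of the encoded block in each half: logical all-plus state for the `X` stabilizers,
logical all-zero state for the `Z` stabilizers. -/
def prepCircuit (k₁ k₂ : ℕ) : Half → List (Op (Qubit k₁ k₂))
  | .X => (zeroPrep k₁ k₂).map Op.dual
  | .Z => zeroPrep k₁ k₂

/-- The circuit of each half after the preparation of the block; the two halves are exchanged by
Hadamard conjugation. -/
def mainCircuit (k₁ k₂ : ℕ) : Half → List (Op (Qubit k₁ k₂))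
  | .X => xExtraction k₁ k₂
  | .Z => (xExtraction k₁ k₂).map Op.dual

/-! ## Histories of noisy QEC cycles -/

/-- One attempt to prepare the encoded block. -/
structure Attempt (k₁ k₂ : ℕ) (h : Half) where
  noisy : Noisy (prepCircuit k₁ k₂ h)
  reset : Qubit k₁ k₂ → ZMod 2

/-- The attempt, when the verification qubit gives the outcome `v`. -/
def Attempt.run {h : Half} (A : Attempt k₁ k₂ h) (v : ZMod 2) (Ψ : QState (Qubit k₁ k₂)) :
    QState (Qubit k₁ k₂) :=
  A.noisy.run A.reset (fun _ => v) Ψ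

/-- History of one half of a cycle: all faults, reset branches and measurement outcomes. The block
is prepared by repeat-until-success: the attempts in `rejected` have failed the verification
(outcome `1`), the attempt `accepted` has passed it (outcome `0`). -/
structure HalfRun (k₁ k₂ : ℕ) (h : Half) where
  rejected : List (Attempt k₁ k₂ h)
  accepted : Attempt k₁ k₂ h
  main : Noisy (mainCircuit k₁ k₂ h)
  reset : Qubit k₁ k₂ → ZMod 2
  meas : Qubit k₁ k₂ → ZMod 2

/-- The number of faults in one half of a cycle, those in rejected attempts included. -/
def HalfRun.faults {h : Half} (H : HalfRun k₁ k₂ h) : ℕ :=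
  (H.rejected.map (fun A => A.noisy.faults)).sum + H.accepted.noisy.faults + H.main.faults

/-- Unnormalised state after one half of a cycle; it vanishes iff the history has probability
zero. -/
def HalfRun.run {h : Half} (H : HalfRun k₁ k₂ h) (Ψ : QState (Qubit k₁ k₂)) :
    QState (Qubit k₁ k₂) :=
  H.main.run H.reset H.meas (H.accepted.run 0 (H.rejected.foldl (fun Φ A => A.run 1 Φ) Ψ))

/-- History of a QEC cycle. -/
structure CycleRun (k₁ k₂ : ℕ) where
  first : HalfRun k₁ k₂ Half.X
  second : HalfRun k₁ k₂ Half.Z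

/-- The number of faults in a QEC cycle. -/
def CycleRun.faults (c : CycleRun k₁ k₂) : ℕ := c.first.faults + c.second.faults

/-! ## The decoder -/

/-- Columns with a nontrivial syndrome, from the transversal measurement of the encoded block. In
the absence of faults only the sums of two outcomes are determined, that is, the outcomes up to a
common complement; of the two complementary sets the smaller one is taken. -/
def HalfRun.highSyndrome {h : Half} (H : HalfRun k₁ k₂ h) : Finset (Fin (k₁ + 2)) :=
  let S := Finset.univ.filter fun i =>
    H.meas (aq (.blk i)) ≠ H.meas (aq (.blk 0))
  if 2 * S.card ≤ k₁ + 2 then S else Sᶜ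

/-- Rows with a nontrivial syndrome. -/
def HalfRun.lowSyndrome {h : Half} (H : HalfRun k₁ k₂ h) : Finset (Fin (k₂ + 2)) :=
  Finset.univ.filter fun j => H.meas (aq (.low j)) = 1

/-- Columns with a nontrivial flag. -/
def HalfRun.highFlags {h : Half} (H : HalfRun k₁ k₂ h) : Finset (Fin (k₁ + 2)) :=
  Finset.univ.filter fun i => H.meas (aq (.flg i)) = 1

/-- Rows with a nontrivial flag. -/
def HalfRun.lowFlags {h : Half} (H : HalfRun k₁ k₂ h) : Finset (Fin (k₂ + 2)) :=
  Finset.univ.filter fun j => H.meas (aq (.lowFlg j)) = 1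

/-- What the decoder for one type of error passes on to the next cycle. -/
structure Status where
  /-- the syndromes have revealed an internal fault of the cycle just finished -/
  prevFailure : Bool
  /-- the next cycle may have an error at its input -/
  inputErrorAllowed : Bool

/-- Where hook errors come from: `Z` hook errors are created in the second half of the previous
cycle, and are input errors of the current cycle; `X` hook errors are created in the first half of
the current cycle, and are internal. -/
inductive HookOrigin where
  | input
  | internal

/-- Correct by `C` and attribute the error to the input of the cycle; halt if an input error is
excluded. -/
def asInput {α : Type} (st : Status) (C : Finset α) : Option (Finset α × Status) :=
  if st.inputErrorAllowed then some (C, ⟨false, false⟩) else none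

/-- Correct by `C` and attribute the error to an internal fault of the cycle; halt if there has been
an internal fault in the previous cycle already. The last argument says whether an uncorrected error
may remain. -/
def asInternal {α : Type} (st : Status) (C : Finset α) (remains : Bool) :
    Option (Finset α × Status) :=
  if st.prevFailure then none else some (C, ⟨true, remains⟩)

/-- Correction of a string of errors in one column or in one row. -/
def asHook {α : Type} (o : HookOrigin) (st : Status) (C : Finset α) : Option (Finset α × Status) :=
  match o with
  | .input => asInput st C
  | .internal => asInternal st C false

/-- The decoder for one type of error (`none` means: halt). Arguments: the columns `vx` and the rows
`hy` flagged for hook errors, and the columns `xs` and rows `ys` with a nontrivial syndrome. -/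
def decode (o : HookOrigin) (st : Status) (vx : Finset (Fin (k₁ + 2))) (hy : Finset (Fin (k₂ + 2)))
    (xs : Finset (Fin (k₁ + 2))) (ys : Finset (Fin (k₂ + 2))) :
    Option (Finset (Data k₁ k₂) × Status) :=
  if vx = ∅ ∧ hy = ∅ then
    -- no hook error is flagged
    if xs = ∅ ∧ ys = ∅ then some (∅, ⟨false, true⟩)
    else if xs = ∅ ∧ ys = Finset.univ then
      -- a full column; all of them are equivalent
      asHook o st ({0} ×ˢ Finset.univ)
    else if xs.card = 1 ∧ ys.card = 1 then
      -- a single error with both coordinates known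
      if st.inputErrorAllowed then asInput st (xs ×ˢ ys) else asInternal st (xs ×ˢ ys) false
    else if xs.card + ys.card = 1 then
      -- one of the two coordinates is missing: pass a possible error through to the next cycle
      asInternal st ∅ true
    else none
  else if vx.card = 1 ∧ hy = ∅ then
    -- a vertical hook error; halt if there is another error in addition
    if xs = (if Odd ys.card then vx else ∅) then asHook o st (vx ×ˢ ys) else none
  else if vx = ∅ ∧ hy.card = 1 then
    -- a horizontal hook error; halt if there is another error in addition
    if ys = (if Odd xs.card then hy else ∅) then asHook o st (xs ×ˢ hy) else none
  else none

/-- The classical information passed from one cycle to the next: the status of both decoders, and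
the columns and rows flagged in the second half of the cycle for `Z` hook errors. -/
structure Memory (k₁ k₂ : ℕ) where
  zStatus : Status
  xStatus : Status
  zHighFlags : Finset (Fin (k₁ + 2))
  zLowFlags : Finset (Fin (k₂ + 2))

/-- The memory before the first cycle. -/
def Memory.init (k₁ k₂ : ℕ) : Memory k₁ k₂ := ⟨⟨false, true⟩, ⟨false, true⟩, ∅, ∅⟩

/-- Indicator vector of a set of data qubits. -/
def setVec (C : Finset (Data k₁ k₂)) : Data k₁ k₂ → ZMod 2 := fun p => if p ∈ C then 1 else 0

/-- Decoding of a cycle: the correction to be applied and the new memory, or `none` if the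
computation halts. `Z` errors are decoded from the `X` syndromes of the first half and the flags of
the second half of the previous cycle, `X` errors from the `Z` syndromes of the second half and the
flags of the first half of the same cycle. -/
def decodeCycle (μ : Memory k₁ k₂) (c : CycleRun k₁ k₂) :
    Option (Pauli (Data k₁ k₂) × Memory k₁ k₂) :=
  match decode .input μ.zStatus μ.zHighFlags μ.zLowFlags c.first.highSyndrome c.first.lowSyndrome,
    decode .internal μ.xStatus c.first.highFlags c.first.lowFlags c.second.highSyndrome
      c.second.lowSyndrome with
  | some (Cz, sz), some (Cx, sx) =>
      some (⟨setVec Cx, setVec Cz⟩, ⟨sz, sx, c.second.highFlags, c.second.lowFlags⟩)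
  | _, _ => none

/-! ## The computation -/

/-- Quantum state and classical memory; the memory is `none` once the computation has halted. -/
structure Config (k₁ k₂ : ℕ) where
  state : QState (Qubit k₁ k₂)
  memory : Option (Memory k₁ k₂)

/-- One QEC cycle. -/
def CycleRun.step (cfg : Config k₁ k₂) (c : CycleRun k₁ k₂) : Config k₁ k₂ :=
  match cfg.memory with
  | none => cfg
  | some μ =>
    let Ψ := c.second.run (c.first.run cfg.state)
    match decodeCycle μ c with
    | none => ⟨Ψ, none⟩
    | some (P, μ') => ⟨(P.onLeft (Anc k₁ k₂)).apply Ψ, some μ'⟩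

/-- The result of the rounds of QEC with the given history, for the state `ψ` of the data qubits
and an arbitrary state `χ` of the ancilla qubits at the start. -/
def execute (runs : List (CycleRun k₁ k₂)) (ψ : QState (Data k₁ k₂)) (χ : QState (Anc k₁ k₂)) :
    Config k₁ k₂ :=
  runs.foldl CycleRun.step ⟨ψ.prod χ, some (Memory.init k₁ k₂)⟩

/-- All ExRecs (pairs of consecutive cycles) are good to distance 3: they contain at most one fault.
If there is just one cycle, it counts as a (truncated) ExRec. -/
def ExRecsGood (runs : List (CycleRun k₁ k₂)) : Prop :=
  runs.IsChain (fun c d => c.faults + d.faults ≤ 1) ∧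
    (runs.length = 1 → ∀ c ∈ runs, c.faults ≤ 1)

/-- Error strings of one type (`X` or `Z`) of generalized weight at most one, when the columns in
`cols` and the rows in `rows` are flagged: at most one qubit; or a vertical (horizontal) string
whose column (row) is known, being the only flagged one; or a full column. -/
def GenWeightLEOne (cols : Finset (Fin (k₁ + 2))) (rows : Finset (Fin (k₂ + 2)))
    (e : Data k₁ k₂ → ZMod 2) : Prop :=
  (∃ q, ∀ p, p ≠ q → e p = 0) ∨
  (∃ x, cols = {x} ∧ rows = ∅ ∧ ∀ p, p.1 ≠ x → e p = 0) ∨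
  (∃ y, cols = ∅ ∧ rows = {y} ∧ ∀ p, p.2 ≠ y → e p = 0) ∨
  (∃ x, e = colVec k₁ k₂ x)

end

end ConcatIceberg

/-! All operations are Clifford and all faults are Pauli operators, so errors can be carried along
as a Pauli frame. By `foldl_noisy_apply`, a noisy circuit on a corrupted state is, up to a scalar,
the same list of operations without faults, followed by the final frame; the errors only shift reset
branches and measurement outcomes. The `X` and `Z` parts of the frame propagate separately and
linearly over `ZMod 2`, and Hadamard conjugation exchanges them. Hence the study of `X` strings in
one circuit and in its dual covers both error types and both halves of a cycle.

On code states the faultless half cycle acts on the ancillas only (`krun_main`): with clean flags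
and a correctly prepared block, its gates do no more than multiply by stabilizers. The flag and row
outcomes are then deterministic, and the block outcomes are so up to a common flip. A history of
nonzero probability must therefore show exactly the outcomes dictated by the frame
(`HalfRun.run_prod`), and what remains is linear algebra modulo 2.

At most one fault in half `h` has two effects. For errors of type `h`, which the half transmits from
ancillas to data, `faultOut_gadget` gives a single-qubit error, a complete string, or a string whose
flag is raised; a complete row is a stabilizer, so complete columns are the only unflagged strings
that matter (`HalfRun.hook_errors`). For errors of the other type, which the half detects,
`faultOut_gadget_dual` and `faultOut_zeroPrep` show that at most one column outcome (up to the
common flip), one row outcome and one data qubit are affected, and that both outcomes are flipped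
only if the data qubit is in error (`HalfRun.detected_errors`).

The decoder undoes hook errors (`decode_hook`) and single errors (`decode_single_error`) up to
stabilizers, and `decode_internal_fault` shows that a fault in the detection itself is either
corrected or leaves at most one data error together with permission to correct it in the next cycle.
This yields two invariants, `Clean` and `AlmostClean`. By `CycleRun.output` a cycle with at most one
fault leads from `Clean` to `AlmostClean`, and a faultless one from either to `Clean`. Two
consecutive cycles share at most one fault, so a faulty cycle is always followed by a faultless one,
and induction on the cycles applies (`foldl_step_eq`). The error of generalized weight at most one
is read off from `AlmostClean` after multiplication by stabilizers. -/

namespace ConcatIceberg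

variable {Q : Type}

/-! ### Arithmetic modulo 2 and signs. -/

theorem zmod_two_cases (a : ZMod 2) : a = 0 ∨ a = 1 := by
  revert a; decide

theorem zmod_two_add_self (a : ZMod 2) : a + a = 0 := CharTwo.add_self_eq_zero a

theorem vec_add_self (v : Q → ZMod 2) : v + v = 0 := by
  ext q; exact zmod_two_add_self _

@[simp] theorem sgn_zero : sgn 0 = 1 := by simp [sgn]

@[simp] theorem sgn_one : sgn 1 = -1 := by simp [sgn, ZMod.val_one]

theorem sgn_add (a b : ZMod 2) : sgn (a + b) = sgn a * sgn b := by
  rcases zmod_two_cases a with rfl | rfl <;> rcases zmod_two_cases b with rfl | rfl <;>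
    simp [zmod_two_add_self]

theorem sgn_mul_self (a : ZMod 2) : sgn a * sgn a = 1 := by
  rw [← sgn_add, zmod_two_add_self, sgn_zero]

/-! ### Products of Pauli operators -/

/-- Product of Pauli operators, up to phase. -/
def Pauli.mul (P R : Pauli Q) : Pauli Q := ⟨P.x + R.x, P.z + R.z⟩

/-- The `X` or `Z` part of a Pauli operator. -/
def Pauli.comp (P : Pauli Q) : Half → Q → ZMod 2
  | .X => P.x
  | .Z => P.z

@[simp] theorem Pauli.mul_comp (P R : Pauli Q) (t : Half) :
    (P.mul R).comp t = P.comp t + R.comp t := by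
  cases t <;> rfl

section

variable [Fintype Q]

/-- The sign does not depend on the state. This allows all phases to be collected in scalars and
finally moved to the ancillas. -/
theorem Pauli.apply_apply (P R : Pauli Q) (Ψ : QState Q) :
    P.apply (R.apply Ψ) = sgn (R.z ⬝ᵥ P.x) • (P.mul R).apply Ψ := by
  ext s
  change sgn (P.z ⬝ᵥ s) * (sgn (R.z ⬝ᵥ (s + P.x)) * Ψ (s + P.x + R.x)) =
    sgn (R.z ⬝ᵥ P.x) * (sgn ((P.z + R.z) ⬝ᵥ s) * Ψ (s + (P.x + R.x)))
  rw [dotProduct_add, add_dotProduct, sgn_add, sgn_add, add_assoc]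
  ring

theorem Pauli.apply_smul (P : Pauli Q) (c : ℂ) (Ψ : QState Q) :
    P.apply (c • Ψ) = c • P.apply Ψ := by
  ext s
  simp only [Pauli.apply, Pi.smul_apply, smul_eq_mul]
  ring

theorem Pauli.apply_id (Ψ : QState Q) : (⟨0, 0⟩ : Pauli Q).apply Ψ = Ψ := by
  ext s
  simp [Pauli.apply]

theorem Pauli.apply_ne_zero {P : Pauli Q} {Ψ : QState Q} (h : P.apply Ψ ≠ 0) : Ψ ≠ 0 := by
  rintro rfl
  apply h
  ext s
  simp [Pauli.apply]

end

/-! ### Propagation of errors through circuits -/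

/-- Conjugation by Hadamard gates, for `Half.Z` only. -/
def Op.conj (t : Half) (o : Op Q) : Op Q :=
  match t with
  | .X => o
  | .Z => o.dual

/-- The other half. -/
def Half.swap : Half → Half
  | .X => .Z
  | .Z => .X

/-- The qubits an operation acts on. -/
def Op.Acts : Op Q → Q → Prop
  | .prepZ p, q => q = p
  | .prepX p, q => q = p
  | .cx c t, q => q = c ∨ q = t
  | .measZ p, q => q = p
  | .measX p, q => q = p

/-- The operation is a measurement of the given qubit. -/
def Op.Measures : Op Q → Q → Prop
  | .measZ p, q => q = p
  | .measX p, q => q = p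
  | _, _ => False

/-- A controlled-X gate has distinct control and target. -/
def Op.Valid : Op Q → Prop
  | .cx c t => c ≠ t
  | _ => True

@[simp] theorem Op.dual_dual (o : Op Q) : o.dual.dual = o := by cases o <;> rfl

theorem Op.acts_dual (o : Op Q) (q : Q) : o.dual.Acts q ↔ o.Acts q := by
  cases o <;> simp [Op.dual, Op.Acts, or_comm]

theorem Op.measures_dual (o : Op Q) (q : Q) : o.dual.Measures q ↔ o.Measures q := by
  cases o <;> simp [Op.dual, Op.Measures]

theorem Op.valid_dual (o : Op Q) : o.dual.Valid ↔ o.Valid := by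
  cases o <;> simp [Op.dual, Op.Valid, eq_comm]

theorem Op.acts_conj (t : Half) (o : Op Q) (q : Q) : (o.conj t).Acts q ↔ o.Acts q := by
  cases t
  · rfl
  · exact o.acts_dual q

theorem Op.measures_conj (t : Half) (o : Op Q) (q : Q) :
    (o.conj t).Measures q ↔ o.Measures q := by
  cases t
  · rfl
  · exact o.measures_dual q

theorem Op.valid_conj (t : Half) (o : Op Q) : (o.conj t).Valid ↔ o.Valid := by
  cases t
  · rfl
  · exact o.valid_dual

variable [DecidableEq Q]

/-- Propagation of a string of `X` errors through an operation. -/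
def Op.push : Op Q → (Q → ZMod 2) → Q → ZMod 2
  -- A reset erases the error of its qubit; what the error changes is the reset branch.
  | .prepZ q, v => v + Pi.single q (v q)
  | .prepX q, v => v + Pi.single q (v q)
  | .cx c t, v => v + Pi.single t (v c)
  | .measZ _, v => v
  | .measX _, v => v

theorem Op.push_add (o : Op Q) (v w : Q → ZMod 2) : o.push (v + w) = o.push v + o.push w := by
  cases o <;> simp only [Op.push, Pi.add_apply, Pi.single_add] <;> abel

theorem Op.push_of_not_acts (o : Op Q) (v : Q → ZMod 2) {q : Q} (h : ¬ o.Acts q) :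
    o.push v q = v q := by
  cases o <;> simp_all [Op.push, Op.Acts]

theorem Op.push_of_forall_acts (o : Op Q) (v : Q → ZMod 2) (h : ∀ q, o.Acts q → v q = 0) :
    o.push v = v := by
  cases o <;> simp_all [Op.push, Op.Acts]

/-- Propagation of a string of `X` errors through a circuit. -/
def prop (C : List (Op Q)) (v : Q → ZMod 2) : Q → ZMod 2 := C.foldl (fun v o => o.push v) v

@[simp] theorem prop_nil (v : Q → ZMod 2) : prop [] v = v := rfl

@[simp] theorem prop_cons (o : Op Q) (C : List (Op Q)) (v : Q → ZMod 2) :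
    prop (o :: C) v = prop C (o.push v) := rfl

theorem prop_append (C D : List (Op Q)) (v : Q → ZMod 2) :
    prop (C ++ D) v = prop D (prop C v) := List.foldl_append

theorem prop_add (C : List (Op Q)) (v w : Q → ZMod 2) : prop C (v + w) = prop C v + prop C w := by
  induction C generalizing v w with
  | nil => rfl
  | cons o C ih => simp [Op.push_add, ih]

theorem prop_inv {C : List (Op Q)} {R : (Q → ZMod 2) → Prop}
    (h : ∀ o ∈ C, ∀ v, R v → R (o.push v)) {v : Q → ZMod 2} (hv : R v) : R (prop C v) := by
  induction C generalizing v with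
  | nil => exact hv
  | cons o C ih =>
    exact ih (fun o ho => h o (List.mem_cons_of_mem _ ho)) (h o List.mem_cons_self v hv)

theorem prop_of_not_acts {C : List (Op Q)} {q : Q} (h : ∀ o ∈ C, ¬ o.Acts q) (v : Q → ZMod 2) :
    prop C v q = v q :=
  prop_inv (R := fun w => w q = v q) (fun o ho w hw => (o.push_of_not_acts w (h o ho)).trans hw) rfl

theorem prop_fixed {C : List (Op Q)} {v : Q → ZMod 2} (h : ∀ o ∈ C, o.push v = v) :
    prop C v = v :=
  prop_inv (R := fun w => w = v) (fun o ho w hw => by rw [hw, h o ho]) rfl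

/-- The strings of `X` errors at the end of a circuit which come from a fault at one location. -/
def FaultOut : List (Op Q) → (Q → ZMod 2) → Prop
  | [], _ => False
  -- The string `u` is arbitrary on the qubits of `o` and travels through the remaining circuit
  -- only. Faults before a measurement are included, as measurements leave strings unchanged.
  | o :: C, v => (∃ u, (∀ q, ¬ o.Acts q → u q = 0) ∧ v = prop C u) ∨ FaultOut C v

theorem faultOut_append {C D : List (Op Q)} {v : Q → ZMod 2} :
    FaultOut (C ++ D) v ↔ (∃ u, FaultOut C u ∧ v = prop D u) ∨ FaultOut D v := by
  induction C with
  | nil => simp [FaultOut]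
  | cons o C ih =>
    simp only [List.cons_append, FaultOut, ih, prop_append]
    constructor
    · rintro (⟨u, h, rfl⟩ | ⟨u, h, rfl⟩ | h)
      · exact .inl ⟨_, .inl ⟨u, h, rfl⟩, rfl⟩
      · exact .inl ⟨_, .inr h, rfl⟩
      · exact .inr h
    · rintro (⟨_, ⟨u, h, rfl⟩ | h, rfl⟩ | h)
      · exact .inl ⟨u, h, rfl⟩
      · exact .inr (.inl ⟨_, h, rfl⟩)
      · exact .inr (.inr h)

/-- The index `i` remembers where the fault occurred: it is chosen at the faulty location and stays
fixed during the propagation. -/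
theorem FaultOut.exists_inv {ι : Type*} {C : List (Op Q)} (R : ι → (Q → ZMod 2) → Prop)
    (h₀ : ∀ o ∈ C, ∀ u, (∀ q, ¬ o.Acts q → u q = 0) → ∃ i, R i u)
    (h₁ : ∀ o ∈ C, ∀ i u, R i u → R i (o.push u)) {v : Q → ZMod 2} (hv : FaultOut C v) :
    ∃ i, R i v := by
  induction C with
  | nil => exact hv.elim
  | cons o C ih =>
    rcases hv with ⟨u, hu, rfl⟩ | hv
    · obtain ⟨i, hi⟩ := h₀ o List.mem_cons_self u hu
      exact ⟨i, prop_inv (fun o ho => h₁ o (List.mem_cons_of_mem _ ho) i) hi⟩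
    · exact ih (fun o ho => h₀ o (List.mem_cons_of_mem _ ho))
        (fun o ho => h₁ o (List.mem_cons_of_mem _ ho)) hv

theorem FaultOut.flatMap {α : Type*} {l : List α} {f : α → List (Op Q)} {v : Q → ZMod 2}
    (hv : FaultOut (l.flatMap f) v) :
    ∃ l₁ a l₂ u, l = l₁ ++ a :: l₂ ∧ FaultOut (f a) u ∧ v = prop (l₂.flatMap f) u := by
  induction l with
  | nil => exact hv.elim
  | cons a l ih =>
    rw [List.flatMap_cons, faultOut_append] at hv
    rcases hv with ⟨u, hu, rfl⟩ | hv
    · exact ⟨[], a, l, u, rfl, hu, rfl⟩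
    · obtain ⟨l₁, a', l₂, u, rfl, hu, rfl⟩ := ih hv
      exact ⟨a :: l₁, a', l₂, u, rfl, hu, rfl⟩

/-! ### Pauli frames -/

/-- Propagation of a Pauli operator through an operation. -/
def Pauli.push (P : Pauli Q) (o : Op Q) : Pauli Q := ⟨o.push P.x, o.dual.push P.z⟩

/-- The Pauli operator of a fault. -/
def faultPauli : Op Q → Fault → Pauli Q
  | .prepZ q, f => pauliOn q f.1
  | .prepX q, f => pauliOn q f.1
  | .cx c t, f => (pauliOn c f.1).mul (pauliOn t f.2)
  | .measZ q, f => pauliOn q f.1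
  | .measX q, f => pauliOn q f.1

/-- The Pauli operator after a noisy circuit. -/
def frame (ops : List (Op Q × Fault)) (P : Pauli Q) : Pauli Q :=
  ops.foldl (fun P p => (faultPauli p.1 p.2).mul (P.push p.1)) P

theorem frame_cons (p : Op Q × Fault) (ops : List (Op Q × Fault)) (P : Pauli Q) :
    frame (p :: ops) P = frame ops ((faultPauli p.1 p.2).mul (P.push p.1)) := rfl

/-- This is the purpose of `Op.conj`: strings of type `t` propagate through a circuit as `X` strings
do through the conjugated circuit, so that only `X` strings need to be followed. -/
theorem Pauli.push_comp (P : Pauli Q) (o : Op Q) (t : Half) :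
    (P.push o).comp t = (o.conj t).push (P.comp t) := by
  cases t <;> rfl

theorem faultPauli_comp_of_not_acts (o : Op Q) (f : Fault) (t : Half) {q : Q}
    (h : ¬ o.Acts q) : (faultPauli o f).comp t q = 0 := by
  cases o <;> cases t <;>
    simp_all [faultPauli, Op.Acts, Pauli.comp, pauliOn, Pauli.mul]

theorem faultPauli_zero_comp (o : Op Q) (t : Half) :
    (faultPauli o 0).comp t = 0 := by
  cases o <;> cases t <;> simp [faultPauli, Pauli.comp, pauliOn, Pauli.mul]

theorem frame_comp_of_not_acts {ops : List (Op Q × Fault)} {q : Q} (h : ∀ p ∈ ops, ¬ p.1.Acts q)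
    (P : Pauli Q) (t : Half) : (frame ops P).comp t q = P.comp t q := by
  induction ops generalizing P with
  | nil => rfl
  | cons p ops ih =>
    have hp := h p List.mem_cons_self
    rw [frame_cons, ih (fun p hp => h p (List.mem_cons_of_mem _ hp)), Pauli.mul_comp,
      Pi.add_apply, faultPauli_comp_of_not_acts _ _ _ hp, Pauli.push_comp,
      Op.push_of_not_acts _ _ (mt (p.1.acts_conj t q).1 hp), zero_add]

theorem frame_comp_of_no_fault {ops : List (Op Q × Fault)}
    (h : ops.countP (fun p => decide (p.2 ≠ 0)) = 0) (P : Pauli Q) (t : Half) :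
    (frame ops P).comp t = prop ((ops.map Prod.fst).map (Op.conj t)) (P.comp t) := by
  induction ops generalizing P with
  | nil => rfl
  | cons p ops ih =>
    obtain ⟨o, f⟩ := p
    have h' : f = 0 ∧ ops.countP (fun p => decide (p.2 ≠ 0)) = 0 := by
      rw [List.countP_cons, Nat.add_eq_zero_iff] at h
      exact ⟨by simpa using h.2, h.1⟩
    obtain ⟨rfl, h'⟩ := h'
    rw [frame_cons, ih h']
    simp [faultPauli_zero_comp, Pauli.push_comp]

/-- By linearity the frame is the propagated input plus the contribution `G` of the faulty location.
Correlations between the `X` and `Z` parts of a fault are forgotten here; each part is bounded by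
the worst string that the location can produce. -/
theorem frame_comp_of_one_fault {ops : List (Op Q × Fault)}
    (h : ops.countP (fun p => decide (p.2 ≠ 0)) ≤ 1) (P : Pauli Q) (t : Half) :
    ∃ G, (frame ops P).comp t = prop ((ops.map Prod.fst).map (Op.conj t)) (P.comp t) + G ∧
      (G = 0 ∨ FaultOut ((ops.map Prod.fst).map (Op.conj t)) G) := by
  induction ops generalizing P with
  | nil => exact ⟨0, by simp [frame], .inl rfl⟩
  | cons p ops ih =>
    obtain ⟨o, f⟩ := p
    by_cases hf : f = 0
    · subst hf
      have h' : ops.countP (fun p => decide (p.2 ≠ 0)) ≤ 1 := by simpa [List.countP_cons] using h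
      obtain ⟨G, hG, hG'⟩ := ih h' ((faultPauli o 0).mul (P.push o))
      refine ⟨G, ?_, hG'.imp_right .inr⟩
      rw [frame_cons, hG]
      simp [faultPauli_zero_comp, Pauli.push_comp]
    · have h' : ops.countP (fun p => decide (p.2 ≠ 0)) = 0 := by
        simp only [ne_eq, List.countP_cons, hf, not_false_eq_true, decide_true, if_true] at h
        simp only [ne_eq]
        omega
      rw [frame_cons, frame_comp_of_no_fault h']
      refine ⟨prop ((ops.map Prod.fst).map (Op.conj t)) ((faultPauli o f).comp t), ?_,
        .inr (.inl ⟨_, fun q hq => ?_, rfl⟩)⟩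
      · rw [Pauli.mul_comp, prop_add, Pauli.push_comp, add_comm]
        rfl
      · exact faultPauli_comp_of_not_acts o f t (mt (o.acts_conj t q).2 hq)

end ConcatIceberg

namespace ConcatIceberg

variable {Q : Type} [DecidableEq Q]

/-! ### Noisy circuits and Pauli frames -/

/-- The faultless operation, with reset branch or measurement outcome `b`. -/
noncomputable def Op.kraus (b : ZMod 2) (o : Op Q) (Ψ : QState Q) : QState Q :=
  o.ideal (fun _ => b) (fun _ => b) Ψ

/-- A faultless circuit, each operation with its own reset branch or measurement outcome. -/
noncomputable def krun (K : List (Op Q × ZMod 2)) (Ψ : QState Q) : QState Q :=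
  K.foldl (fun Φ p => p.1.kraus p.2 Φ) Ψ

@[simp] theorem krun_nil (Ψ : QState Q) : krun [] Ψ = Ψ := rfl

@[simp] theorem krun_cons (p : Op Q × ZMod 2) (K : List (Op Q × ZMod 2)) (Ψ : QState Q) :
    krun (p :: K) Ψ = krun K (p.1.kraus p.2 Ψ) := rfl

theorem krun_append (K L : List (Op Q × ZMod 2)) (Ψ : QState Q) :
    krun (K ++ L) Ψ = krun L (krun K Ψ) := List.foldl_append

theorem Op.kraus_smul (b : ZMod 2) (o : Op Q) (c : ℂ) (Ψ : QState Q) :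
    o.kraus b (c • Ψ) = c • o.kraus b Ψ := by
  cases o <;> ext s <;> simp only [Op.kraus, Op.ideal, Pi.smul_apply, smul_eq_mul] <;>
    (try split_ifs) <;> ring

theorem krun_smul (K : List (Op Q × ZMod 2)) (c : ℂ) (Ψ : QState Q) :
    krun K (c • Ψ) = c • krun K Ψ := by
  induction K generalizing Ψ with
  | nil => rfl
  | cons p K ih => rw [krun_cons, Op.kraus_smul, ih, krun_cons]

theorem krun_zero (K : List (Op Q × ZMod 2)) : krun K (0 : QState Q) = 0 := by
  simpa using krun_smul K 0 0

/-- An `X` error before a reset splits into its part on `q`, which shifts the branch, and its part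
elsewhere, which survives. -/
theorem update_add_eq (s x : Q → ZMod 2) (q : Q) (b : ZMod 2) :
    Function.update s q b + x = Function.update (s + (x + Pi.single q (x q))) q (b + x q) := by
  ext p
  by_cases h : p = q
  · subst h; simp
  · simp [h]

variable [Fintype Q]

theorem dotProduct_update (z s : Q → ZMod 2) (q : Q) (b : ZMod 2) :
    z ⬝ᵥ Function.update s q b = z q * b + (z + Pi.single q (z q)) ⬝ᵥ s := by
  have h : Function.update s q b = s + Pi.single q (s q + b) := by
    ext p
    by_cases h : p = q
    · subst h
      simp [← add_assoc, zmod_two_add_self]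
    · simp [h]
  rw [h, dotProduct_add, add_dotProduct, dotProduct_single, single_dotProduct]
  ring

omit [DecidableEq Q] in
theorem Pauli.apply_eval (P : Pauli Q) (Ψ : QState Q) (s : Q → ZMod 2) :
    P.apply Ψ s = sgn (P.z ⬝ᵥ s) * Ψ (s + P.x) := rfl

/-- A controlled-X conjugates Pauli operators to Pauli operators. For a reset, the `X` part on its
qubit shifts the branch and the `Z` part gives a scalar. For a measurement, the part that
anticommutes with the measured operator shifts the outcome. Neither `c` nor `b'` depends on the
state. -/
theorem Op.kraus_apply {o : Op Q} (hv : o.Valid) (b : ZMod 2) (P : Pauli Q) :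
    ∃ (c : ℂ) (b' : ZMod 2),
      (∀ Ψ, o.kraus b (P.apply Ψ) = c • (P.push o).apply (o.kraus b' Ψ)) ∧
      (∀ q, o = .measZ q → b' = b + P.x q) ∧ (∀ q, o = .measX q → b' = b + P.z q) := by
  cases o with
  | prepZ q =>
    refine ⟨sgn (P.z q * b), b + P.x q, fun Ψ => ?_, by simp, by simp⟩
    ext s
    simp only [Op.kraus, Op.ideal, Pauli.push, Op.push, Op.dual, Pi.smul_apply, smul_eq_mul,
      Pauli.apply_eval]
    rw [update_add_eq, dotProduct_update, sgn_add]
    simp only [Pi.add_apply, Pi.single_eq_same, zmod_two_add_self, add_zero]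
    split_ifs
    · ring
    · simp
  | prepX q =>
    refine ⟨sgn (P.z q * b), b + P.x q, fun Ψ => ?_, by simp, by simp⟩
    ext s
    simp only [Op.kraus, Op.ideal, Pauli.push, Op.push, Op.dual, Pi.smul_apply, smul_eq_mul,
      Pauli.apply_eval]
    rw [update_add_eq, dotProduct_update, sgn_add]
    ring
  | cx c t =>
    refine ⟨1, b, fun Ψ => ?_, by simp, by simp⟩
    ext s
    simp only [Op.kraus, Op.ideal, Pauli.push, Op.push, Op.dual, Pi.smul_apply, smul_eq_mul,
      Pauli.apply_eval]
    have hct : c ≠ t := hv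
    have h₁ : ∀ y : Q → ZMod 2, y = s + (P.x + Pi.single t (P.x c)) →
        Function.update s t (s t + s c) + P.x = Function.update y t (y t + y c) := by
      rintro _ rfl
      ext p
      by_cases h : p = t
      · subst h
        simp only [Pi.add_apply, Function.update_self, Pi.single_eq_same, Pi.single_eq_of_ne hct]
        linear_combination (-1 : ZMod 2) * zmod_two_add_self (P.x c)
      · simp [h]
    have h₂ : P.z ⬝ᵥ Function.update s t (s t + s c) =
        (P.z + Pi.single c (P.z t)) ⬝ᵥ s := by
      rw [dotProduct_update]
      simp only [add_dotProduct, single_dotProduct]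
      linear_combination zmod_two_add_self (P.z t * s t)
    rw [h₁ _ rfl, h₂, one_mul]
  | measZ q =>
    refine ⟨1, b + P.x q, fun Ψ => ?_, by simp, by simp⟩
    ext s
    simp only [Op.kraus, Op.ideal, Pauli.push, Op.push, Op.dual, Pi.smul_apply, smul_eq_mul,
      Pauli.apply_eval, Pi.add_apply, add_left_inj]
    split_ifs <;> simp
  | measX q =>
    refine ⟨1, b + P.z q, fun Ψ => ?_, by simp, by simp⟩
    ext s
    simp only [Op.kraus, Op.ideal, Pauli.push, Op.push, Op.dual, Pi.smul_apply, smul_eq_mul,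
      Pauli.apply_eval]
    rw [dotProduct_add, dotProduct_single, mul_one, sgn_add, sgn_add, add_right_comm s]
    ring

theorem Op.noisy_smul (o : Op Q) (r m : Q → ZMod 2) (f : Fault) (c : ℂ) (Ψ : QState Q) :
    o.noisy r m f (c • Ψ) = c • o.noisy r m f Ψ := by
  have h : ∀ (o : Op Q) (Φ : QState Q), o.ideal r m (c • Φ) = c • o.ideal r m Φ := by
    intro o Φ
    cases o <;> ext s <;> simp only [Op.ideal, Pi.smul_apply, smul_eq_mul] <;>
      (try split_ifs) <;> ring
  cases o <;> simp only [Op.noisy, h, Pauli.apply_smul]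

theorem foldl_noisy_smul (ops : List (Op Q × Fault)) (r m : Q → ZMod 2) (c : ℂ) (Ψ : QState Q) :
    ops.foldl (fun φ p => p.1.noisy r m p.2 φ) (c • Ψ) =
      c • ops.foldl (fun φ p => p.1.noisy r m p.2 φ) Ψ := by
  induction ops generalizing Ψ with
  | nil => rfl
  | cons p ops ih => rw [List.foldl_cons, Op.noisy_smul, ih, List.foldl_cons]

theorem Op.noisy_apply {o : Op Q} (hv : o.Valid) (f : Fault) (r m : Q → ZMod 2) (P : Pauli Q) :
    ∃ (c : ℂ) (b : ZMod 2),
      (∀ Ψ, o.noisy r m f (P.apply Ψ) =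
        c • ((faultPauli o f).mul (P.push o)).apply (o.kraus b Ψ)) ∧
      (∀ q, o = .measZ q → b = m q + ((faultPauli o f).mul (P.push o)).x q) ∧
      (∀ q, o = .measX q → b = m q + ((faultPauli o f).mul (P.push o)).z q) := by
  cases o with
  | prepZ q =>
    obtain ⟨c, b, h, -, -⟩ := Op.kraus_apply hv (r q) P
    refine ⟨c * sgn ((P.push (.prepZ q)).z ⬝ᵥ (pauliOn q f.1).x), b, fun Ψ => ?_, by simp, by simp⟩
    change (pauliOn q f.1).apply ((Op.prepZ q).kraus (r q) (P.apply Ψ)) = _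
    rw [h, Pauli.apply_smul, Pauli.apply_apply, smul_smul]
    rfl
  | prepX q =>
    obtain ⟨c, b, h, -, -⟩ := Op.kraus_apply hv (r q) P
    refine ⟨c * sgn ((P.push (.prepX q)).z ⬝ᵥ (pauliOn q f.1).x), b, fun Ψ => ?_, by simp, by simp⟩
    change (pauliOn q f.1).apply ((Op.prepX q).kraus (r q) (P.apply Ψ)) = _
    rw [h, Pauli.apply_smul, Pauli.apply_apply, smul_smul]
    rfl
  | cx p t =>
    obtain ⟨c, b, h, -, -⟩ := Op.kraus_apply hv 0 P
    refine ⟨sgn ((P.push (.cx p t)).z ⬝ᵥ ((pauliOn p f.1).mul (pauliOn t f.2)).x) *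
      (sgn ((pauliOn t f.2).z ⬝ᵥ (pauliOn p f.1).x) * c), b, fun Ψ => ?_, by simp, by simp⟩
    change (pauliOn p f.1).apply ((pauliOn t f.2).apply ((Op.cx p t).kraus 0 (P.apply Ψ))) = _
    rw [h, Pauli.apply_apply, Pauli.apply_smul, Pauli.apply_apply, smul_smul, smul_smul,
      mul_comm]
    rfl
  | measZ q =>
    obtain ⟨c, b, h, hb, -⟩ := Op.kraus_apply hv (m q) ((pauliOn q f.1).mul P)
    refine ⟨sgn (P.z ⬝ᵥ (pauliOn q f.1).x) * c, b, fun Ψ => ?_, fun p hp => ?_, by simp⟩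
    · change (Op.measZ q).kraus (m q) ((pauliOn q f.1).apply (P.apply Ψ)) = _
      rw [Pauli.apply_apply, Op.kraus_smul, h, smul_smul]
      rfl
    · cases hp
      exact hb _ rfl
  | measX q =>
    obtain ⟨c, b, h, -, hb⟩ := Op.kraus_apply hv (m q) ((pauliOn q f.1).mul P)
    refine ⟨sgn (P.z ⬝ᵥ (pauliOn q f.1).x) * c, b, fun Ψ => ?_, by simp, fun p hp => ?_⟩
    · change (Op.measX q).kraus (m q) ((pauliOn q f.1).apply (P.apply Ψ)) = _
      rw [Pauli.apply_apply, Op.kraus_smul, h, smul_smul]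
      rfl
    · cases hp
      exact hb _ rfl

/-- The measurement whose outcome is flipped by errors of type `t`. -/
def measOf (t : Half) (q : Q) : Op Q :=
  match t with
  | .X => .measZ q
  | .Z => .measX q

omit [DecidableEq Q] [Fintype Q] in
theorem measOf_measures (t : Half) (q : Q) : (measOf t q).Measures q := by
  cases t <;> rfl

/-- Circuits of proper gates, in which a qubit is not acted on after its measurement. -/
def WellFormed (C : List (Op Q)) : Prop :=
  (∀ o ∈ C, o.Valid) ∧ C.Pairwise (fun o o' => ∀ q, o.Measures q → ¬ o'.Acts q)

omit [DecidableEq Q] [Fintype Q] in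
theorem WellFormed.conj {C : List (Op Q)} (h : WellFormed C) (t : Half) :
    WellFormed (C.map (Op.conj t)) := by
  refine ⟨fun o ho => ?_, ?_⟩
  · obtain ⟨o', ho', rfl⟩ := List.mem_map.1 ho
    exact (o'.valid_conj t).2 (h.1 o' ho')
  · rw [List.pairwise_map]
    exact h.2.imp (by simp only [Op.measures_conj, Op.acts_conj]; exact fun h => h)

/-- The reduction of noisy circuits to faultless ones. The list `K` carries the shifted branches and
outcomes; for measurements the shift is read off from the frame at the very end of the circuit. -/
theorem foldl_noisy_apply {ops : List (Op Q × Fault)} (h : WellFormed (ops.map Prod.fst))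
    (r m : Q → ZMod 2) (P : Pauli Q) :
    ∃ (c : ℂ) (K : List (Op Q × ZMod 2)), K.map Prod.fst = ops.map Prod.fst ∧
      (∀ Ψ, ops.foldl (fun φ p => p.1.noisy r m p.2 φ) (P.apply Ψ) =
        c • (frame ops P).apply (krun K Ψ)) ∧
      ∀ t q b, (measOf t q, b) ∈ K → b = m q + (frame ops P).comp t q := by
  induction ops generalizing P with
  | nil => exact ⟨1, [], rfl, fun Ψ => by simp [frame], by simp⟩
  | cons p ops ih =>
    obtain ⟨o, f⟩ := p
    obtain ⟨hv, hw⟩ := h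
    rw [List.map_cons, List.pairwise_cons] at hw
    obtain ⟨c, b, h₁, h₂, h₃⟩ := Op.noisy_apply (hv o (by simp)) f r m P
    obtain ⟨c', K, hK, h₄, h₅⟩ :=
      ih ⟨fun o ho => hv o (List.mem_cons_of_mem _ ho), hw.2⟩ ((faultPauli o f).mul (P.push o))
    refine ⟨c * c', (o, b) :: K, by simp [hK], fun Ψ => ?_, fun t q b' hb' => ?_⟩
    · rw [List.foldl_cons, h₁, foldl_noisy_smul, h₄, smul_smul]
      rfl
    · rcases List.mem_cons.1 hb' with hb' | hb'
      · rw [Prod.mk.injEq] at hb'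
        obtain ⟨rfl, rfl⟩ := hb'
        -- No later operation touches the measured qubit, so there the final frame agrees with the
        -- frame at the measurement.
        rw [frame_cons, frame_comp_of_not_acts]
        · cases t
          · exact h₂ q rfl
          · exact h₃ q rfl
        · exact fun p hp => hw.1 p.1 (List.mem_map_of_mem hp) q (measOf_measures t q)
      · exact h₅ t q b' hb'

end ConcatIceberg

namespace ConcatIceberg

/-! ### Stabilizers of a state -/

variable {Q : Type}

@[simp] theorem Half.swap_swap (t : Half) : t.swap.swap = t := by cases t <;> rfl

theorem Op.conj_conj_self (t : Half) (o : Op Q) : (o.conj t).conj t = o := by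
  cases t <;> simp [Op.conj]

theorem Op.conj_swap_conj (t : Half) (o : Op Q) : (o.conj t.swap).conj t = o.dual := by
  cases t <;> rfl

theorem Op.conj_conj_swap (t : Half) (o : Op Q) : (o.conj t).conj t.swap = o.dual := by
  cases t <;> rfl

theorem map_conj_conj_self (t : Half) (C : List (Op Q)) : (C.map (Op.conj t)).map (Op.conj t) = C := by
  simp [Function.comp_def, Op.conj_conj_self]

theorem map_conj_swap_conj (t : Half) (C : List (Op Q)) :
    (C.map (Op.conj t.swap)).map (Op.conj t) = C.map Op.dual := by
  simp [Function.comp_def, Op.conj_swap_conj]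

theorem map_conj_conj_swap (t : Half) (C : List (Op Q)) :
    (C.map (Op.conj t)).map (Op.conj t.swap) = C.map Op.dual := by
  simp [Function.comp_def, Op.conj_conj_swap]

/-- A string of Pauli operators of one type. -/
def ofType (t : Half) (v : Q → ZMod 2) : Pauli Q :=
  match t with
  | .X => ⟨v, 0⟩
  | .Z => ⟨0, v⟩

/-- The initialisation of a qubit in the `+1` eigenstate of the Pauli operator of type `t`. -/
def prepOf (t : Half) (q : Q) : Op Q :=
  match t with
  | .X => .prepX q
  | .Z => .prepZ q

/-- The operation is a controlled-X gate. -/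
def Op.IsCX : Op Q → Prop
  | .cx c t => c ≠ t
  | _ => False

theorem Op.isCX_conj (t : Half) (o : Op Q) : (o.conj t).IsCX ↔ o.IsCX := by
  cases t <;> cases o <;> simp [Op.conj, Op.dual, Op.IsCX, eq_comm]

section

variable [Fintype Q]

/-- The string `v` of Pauli operators of type `t` acts on the state as `(-1) ^ b`. -/
def Stab (t : Half) (v : Q → ZMod 2) (b : ZMod 2) (Ψ : QState Q) : Prop :=
  (ofType t v).apply Ψ = sgn b • Ψ

theorem stab_X_iff {v : Q → ZMod 2} {b : ZMod 2} {Ψ : QState Q} :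
    Stab .X v b Ψ ↔ ∀ s, Ψ (s + v) = sgn b * Ψ s := by
  simp [Stab, funext_iff, Pauli.apply, ofType]

theorem stab_Z_iff {v : Q → ZMod 2} {b : ZMod 2} {Ψ : QState Q} :
    Stab .Z v b Ψ ↔ ∀ s, Ψ s ≠ 0 → v ⬝ᵥ s = b := by
  simp only [Stab, funext_iff, Pauli.apply_eval, ofType, add_zero, Pi.smul_apply, smul_eq_mul,
    mul_eq_mul_right_iff]
  refine forall_congr' fun s => ?_
  rw [or_iff_not_imp_right]
  refine imp_congr_right fun _ => ?_
  rcases zmod_two_cases (v ⬝ᵥ s) with h | h <;> rcases zmod_two_cases b with h' | h' <;>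
    rw [h, h'] <;> norm_num

theorem Stab.add {t : Half} {v w : Q → ZMod 2} {b b' : ZMod 2} {Ψ : QState Q}
    (h : Stab t v b Ψ) (h' : Stab t w b' Ψ) : Stab t (v + w) (b + b') Ψ := by
  cases t
  · rw [stab_X_iff] at *
    intro s
    rw [← add_assoc, h', h, sgn_add]
    ring
  · rw [stab_Z_iff] at *
    intro s hs
    rw [add_dotProduct, h s hs, h' s hs]

theorem Stab.zero (t : Half) (Ψ : QState Q) : Stab t 0 0 Ψ := by
  cases t
  · simp [stab_X_iff]
  · simp [stab_Z_iff]

theorem Stab.unique {t : Half} {v : Q → ZMod 2} {b b' : ZMod 2} {Ψ : QState Q}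
    (h : Stab t v b Ψ) (h' : Stab t v b' Ψ) (hΨ : Ψ ≠ 0) : b = b' := by
  obtain ⟨s, hs⟩ := Function.ne_iff.1 hΨ
  have h₁ : sgn b * Ψ s = sgn b' * Ψ s := congrFun (h.symm.trans h') s
  have h₂ := mul_right_cancel₀ hs h₁
  revert h₂
  rcases zmod_two_cases b with rfl | rfl <;> rcases zmod_two_cases b' with rfl | rfl <;> norm_num

theorem Stab.sum {t : Half} {ι : Type*} {S : Finset ι} {v : ι → Q → ZMod 2} {Ψ : QState Q}
    (h : ∀ i ∈ S, Stab t (v i) 0 Ψ) : Stab t (∑ i ∈ S, v i) 0 Ψ := by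
  classical
  induction S using Finset.induction_on with
  | empty => simpa using Stab.zero t Ψ
  | insert i S hi ih =>
    rw [Finset.sum_insert hi]
    simpa using (h i (by simp)).add (ih fun j hj => h j (by simp [hj]))

theorem Stab.smul {t : Half} {v : Q → ZMod 2} {Ψ : QState Q} (h : Stab t v 0 Ψ) (a : ZMod 2) :
    Stab t (a • v) 0 Ψ := by
  rcases zmod_two_cases a with rfl | rfl
  · simpa using Stab.zero t Ψ
  · simpa using h

theorem Stab.of_support [DecidableEq Q] {t : Half} {v : Q → ZMod 2} {Ψ : QState Q}
    (h : ∀ q, v q ≠ 0 → Stab t (Pi.single q 1) 0 Ψ) : Stab t v 0 Ψ := by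
  have hv : v = ∑ q, v q • (Pi.single q 1 : Q → ZMod 2) := by
    ext p
    simp [Pi.single_apply]
  rw [hv]
  refine Stab.sum fun q _ => ?_
  by_cases hq : v q = 0
  · simpa [hq] using Stab.zero t Ψ
  · exact (h q hq).smul _

end

variable [DecidableEq Q]

theorem update_add_of_eq_zero {s v : Q → ZMod 2} {q : Q} (h : v q = 0) (b : ZMod 2) :
    Function.update (s + v) q b = Function.update s q b + v := by
  ext p
  by_cases hp : p = q
  · subst hp; simp [h]
  · simp [hp]

variable [Fintype Q]

theorem dotProduct_update_of_eq_zero {s v : Q → ZMod 2} {q : Q} (h : v q = 0) (b : ZMod 2) :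
    v ⬝ᵥ Function.update s q b = v ⬝ᵥ s := by
  rw [dotProduct_update, h]
  simp

theorem Stab.kraus_of_not_acts {t : Half} {v : Q → ZMod 2} {b : ZMod 2} {Ψ : QState Q}
    (h : Stab t v b Ψ) {o : Op Q} (ho : ∀ q, o.Acts q → v q = 0) (b' : ZMod 2) :
    Stab t v b (o.kraus b' Ψ) := by
  cases t
  · rw [stab_X_iff] at *
    intro s
    cases o with
    | prepZ q =>
      have hq : v q = 0 := ho q rfl
      simp [Op.kraus, Op.ideal, update_add_of_eq_zero hq, h, hq]
    | prepX q =>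
      have hq : v q = 0 := ho q rfl
      simp only [Op.kraus, Op.ideal, update_add_of_eq_zero hq, h]
      ring
    | cx c t =>
      have hc : v c = 0 := ho c (.inl rfl)
      have ht : v t = 0 := ho t (.inr rfl)
      simp [Op.kraus, Op.ideal, update_add_of_eq_zero ht, h, hc, ht]
    | measZ q =>
      have hq : v q = 0 := ho q rfl
      simp [Op.kraus, Op.ideal, h, hq]
    | measX q =>
      simp only [Op.kraus, Op.ideal, h, add_right_comm s v]
      ring
  · rw [stab_Z_iff] at *
    intro s hs
    cases o with
    | prepZ q =>
      have hq : v q = 0 := ho q rfl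
      simp only [Op.kraus, Op.ideal, ne_eq, ite_eq_right_iff, Classical.not_imp] at hs
      rw [← h _ hs.2, dotProduct_update_of_eq_zero hq]
    | prepX q =>
      have hq : v q = 0 := ho q rfl
      simp only [Op.kraus, Op.ideal] at hs
      rw [← h _ (right_ne_zero_of_mul hs), dotProduct_update_of_eq_zero hq]
    | cx c t =>
      have ht : v t = 0 := ho t (.inr rfl)
      rw [← h _ hs, dotProduct_update_of_eq_zero ht]
    | measZ q =>
      simp only [Op.kraus, Op.ideal, ne_eq, ite_eq_right_iff, Classical.not_imp] at hs
      exact h _ hs.2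
    | measX q =>
      have hq : v q = 0 := ho q rfl
      by_contra hv
      have h₁ : Ψ s = 0 := by
        by_contra h₁
        exact hv (h s h₁)
      have h₂ : Ψ (s + Pi.single q 1) = 0 := by
        by_contra h₂
        apply hv
        rw [← h _ h₂, dotProduct_add, dotProduct_single, hq, zero_mul, add_zero]
      simp [Op.kraus, Op.ideal, h₁, h₂] at hs

/-- The measured operator is itself of type `t`, hence commutes with the string even if the string
contains `q`. -/
theorem Stab.measOf {t : Half} {v : Q → ZMod 2} {b : ZMod 2} {Ψ : QState Q}
    (h : Stab t v b Ψ) (q : Q) (b' : ZMod 2) : Stab t v b ((measOf t.swap q).kraus b' Ψ) := by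
  cases t
  · rw [stab_X_iff] at *
    intro s
    simp only [ConcatIceberg.measOf, Half.swap, Op.kraus, Op.ideal, h, add_right_comm s v]
    ring
  · rw [stab_Z_iff] at *
    intro s hs
    simp only [ConcatIceberg.measOf, Half.swap, Op.kraus, Op.ideal, ne_eq, ite_eq_right_iff,
      Classical.not_imp] at hs
    exact h _ hs.2

theorem stab_measOf (t : Half) (q : Q) (b : ZMod 2) (Ψ : QState Q) :
    Stab t.swap (Pi.single q 1) b ((measOf t q).kraus b Ψ) := by
  cases t
  · refine stab_Z_iff.2 fun s hs => ?_
    simp only [measOf, Op.kraus, Op.ideal, ne_eq, ite_eq_right_iff, Classical.not_imp] at hs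
    simp [hs.1]
  · refine stab_X_iff.2 fun s => ?_
    simp only [measOf, Op.kraus, Op.ideal, add_assoc, vec_add_self, add_zero]
    linear_combination (-1 / 2 : ℂ) * Ψ (s + Pi.single q 1) * sgn_mul_self b

theorem stab_prepOf (t : Half) (q : Q) (b : ZMod 2) (Ψ : QState Q) :
    Stab t (Pi.single q 1) 0 ((prepOf t q).kraus b Ψ) := by
  cases t
  · refine stab_X_iff.2 fun s => ?_
    have h : Function.update (s + Pi.single q 1) q b = Function.update s q b := by
      ext p
      by_cases hp : p = q
      · subst hp; simp
      · simp [hp]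
    simp only [prepOf, Op.kraus, Op.ideal, h, sgn_zero, one_mul]
  · refine stab_Z_iff.2 fun s hs => ?_
    simp only [prepOf, Op.kraus, Op.ideal, ne_eq, ite_eq_right_iff, Classical.not_imp] at hs
    simp [hs.1]

omit [Fintype Q] in
theorem Op.push_push_of_isCX {o : Op Q} (ho : o.IsCX) (s : Q → ZMod 2) : o.push (o.push s) = s := by
  cases o with
  | cx c t =>
    have hct : c ≠ t := ho
    ext p
    simp [Op.push, hct, add_assoc, zmod_two_add_self]
  | _ => exact ho.elim

omit [Fintype Q] in
theorem Op.kraus_push {o : Op Q} (ho : o.IsCX) (b : ZMod 2) (Ψ : QState Q) (s : Q → ZMod 2) :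
    o.kraus b Ψ (o.push s) = Ψ s := by
  cases o with
  | cx c t =>
    have hct : c ≠ t := ho
    simp only [Op.kraus, Op.ideal, Op.push]
    congr 1
    ext p
    by_cases hp : p = t
    · subst hp
      simp [hct, add_assoc, zmod_two_add_self]
    · simp [hp]
  | _ => exact ho.elim

/-- The dual of a controlled-X acts by the inverse transpose, so the commutation of `X` and `Z`
strings is preserved. -/
theorem Op.push_dotProduct_push {o : Op Q} (ho : o.IsCX) (v s : Q → ZMod 2) :
    o.dual.push v ⬝ᵥ o.push s = v ⬝ᵥ s := by
  cases o with
  | cx c t =>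
    have hct : c ≠ t := ho
    simp only [Op.push, Op.dual, dotProduct_add, add_dotProduct, dotProduct_single,
      single_dotProduct, Pi.add_apply, Pi.single_eq_of_ne hct.symm]
    linear_combination zmod_two_add_self (v t * s c)
  | _ => exact ho.elim

theorem Stab.kraus_cx {t : Half} {v : Q → ZMod 2} {b : ZMod 2} {Ψ : QState Q}
    (h : Stab t v b Ψ) {o : Op Q} (ho : o.IsCX) (b' : ZMod 2) :
    Stab t ((o.conj t).push v) b (o.kraus b' Ψ) := by
  cases t
  · rw [stab_X_iff] at *
    intro s
    rw [← Op.push_push_of_isCX ho s, Op.conj, ← Op.push_add, Op.kraus_push ho, Op.kraus_push ho, h]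
  · rw [stab_Z_iff] at *
    intro s
    rw [← Op.push_push_of_isCX ho s, Op.conj, Op.push_dotProduct_push ho, Op.kraus_push ho]
    exact h _

theorem Stab.krun_of_not_acts {t : Half} {v : Q → ZMod 2} {b : ZMod 2} {Ψ : QState Q}
    (h : Stab t v b Ψ) {K : List (Op Q × ZMod 2)} (hK : ∀ o ∈ K.map Prod.fst, ∀ q, o.Acts q → v q = 0) :
    Stab t v b (krun K Ψ) := by
  induction K generalizing Ψ with
  | nil => exact h
  | cons p K ih =>
    exact ih (h.kraus_of_not_acts (hK p.1 (by simp)) _)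
      (fun o ho => hK o (List.mem_cons_of_mem _ ho))

theorem Stab.krun_cx {t : Half} {v : Q → ZMod 2} {b : ZMod 2} {Ψ : QState Q}
    (h : Stab t v b Ψ) {K : List (Op Q × ZMod 2)} (hK : ∀ o ∈ K.map Prod.fst, o.IsCX) :
    Stab t (prop ((K.map Prod.fst).map (Op.conj t)) v) b (krun K Ψ) := by
  induction K generalizing Ψ v with
  | nil => exact h
  | cons p K ih =>
    exact ih (h.kraus_cx (hK p.1 (by simp)) _) (fun o ho => hK o (List.mem_cons_of_mem _ ho))

omit [Fintype Q] in
theorem krun_prop {K : List (Op Q × ZMod 2)} (hK : ∀ o ∈ K.map Prod.fst, o.IsCX)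
    (Ψ : QState Q) (s : Q → ZMod 2) : krun K Ψ (prop (K.map Prod.fst) s) = Ψ s := by
  induction K generalizing Ψ s with
  | nil => rfl
  | cons p K ih =>
    rw [krun_cons, List.map_cons, prop_cons, ih (fun o ho => hK o (List.mem_cons_of_mem _ ho)),
      Op.kraus_push (hK p.1 (by simp))]

omit [Fintype Q] in
theorem prop_surjective {C : List (Op Q)} (hC : ∀ o ∈ C, o.IsCX) : Function.Surjective (prop C) := by
  induction C with
  | nil => exact fun s => ⟨s, rfl⟩
  | cons o C ih =>
    intro s
    obtain ⟨u, rfl⟩ := ih (fun o ho => hC o (List.mem_cons_of_mem _ ho)) s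
    exact ⟨o.push u, by rw [prop_cons, Op.push_push_of_isCX (hC o (by simp))]⟩

omit [Fintype Q] in
-- Controlled-X circuits permute the computational basis by `prop`; a state whose amplitudes are
-- constant along this permutation is fixed.
theorem krun_eq_self {K : List (Op Q × ZMod 2)} (hK : ∀ o ∈ K.map Prod.fst, o.IsCX)
    {Ψ : QState Q} (h : ∀ s, Ψ (prop (K.map Prod.fst) s) = Ψ s) : krun K Ψ = Ψ := by
  ext s
  obtain ⟨u, rfl⟩ := prop_surjective hK s
  rw [krun_prop hK, h]

theorem stab_of_measOf_mem {K : List (Op Q × ZMod 2)} (hK : WellFormed (K.map Prod.fst))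
    {t : Half} {q : Q} {b : ZMod 2} (hq : (measOf t q, b) ∈ K) (Ψ : QState Q) :
    Stab t.swap (Pi.single q 1) b (krun K Ψ) := by
  obtain ⟨K₁, K₂, rfl⟩ := List.append_of_mem hq
  rw [krun_append, krun_cons]
  refine (stab_measOf t q b _).krun_of_not_acts fun o ho p hp => ?_
  have h₂ := hK.2
  rw [List.map_append, List.map_cons, List.pairwise_append, List.pairwise_cons] at h₂
  have h₃ := h₂.2.1.1 o ho q (measOf_measures t q)
  exact Pi.single_eq_of_ne (by rintro rfl; exact h₃ hp) _

/-! ### Product states -/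

variable {A B : Type}

/-- Restriction of a Pauli operator to the first register. -/
def Pauli.left (P : Pauli (A ⊕ B)) : Pauli A := ⟨P.x ∘ Sum.inl, P.z ∘ Sum.inl⟩

/-- Restriction of a Pauli operator to the second register. -/
def Pauli.right (P : Pauli (A ⊕ B)) : Pauli B := ⟨P.x ∘ Sum.inr, P.z ∘ Sum.inr⟩

theorem Pauli.left_comp (P : Pauli (A ⊕ B)) (t : Half) (a : A) :
    P.left.comp t a = P.comp t (Sum.inl a) := by
  cases t <;> rfl

theorem Pauli.apply_prod [Fintype A] [Fintype B] (P : Pauli (A ⊕ B)) (ψ : QState A) (χ : QState B) :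
    P.apply (ψ.prod χ) = (P.left.apply ψ).prod (P.right.apply χ) := by
  ext s
  have h : P.z ⬝ᵥ s = P.left.z ⬝ᵥ (fun a => s (Sum.inl a)) + P.right.z ⬝ᵥ (fun b => s (Sum.inr b)) :=
    Fintype.sum_sum_type _
  rw [Pauli.apply_eval, h, sgn_add]
  change _ * (ψ _ * χ _) = (sgn _ * ψ _) * (sgn _ * χ _)
  exact mul_mul_mul_comm _ _ _ _

theorem Pauli.onLeft_apply_prod [Fintype A] [Fintype B] (P : Pauli A) (ψ : QState A)
    (χ : QState B) : (P.onLeft B).apply (ψ.prod χ) = (P.apply ψ).prod χ := by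
  rw [Pauli.apply_prod]
  have h : (P.onLeft B).right.apply χ = χ := Pauli.apply_id χ
  rw [h]
  rfl

theorem pauliOn_inr_apply_prod [Fintype A] [Fintype B] [DecidableEq A] [DecidableEq B] (b : B)
    (P : Pauli1) (ψ : QState A) (χ : QState B) :
    (pauliOn (Sum.inr b : A ⊕ B) P).apply (ψ.prod χ) = ψ.prod ((pauliOn b P).apply χ) := by
  have h₁ : (pauliOn (Sum.inr b : A ⊕ B) P).left = ⟨0, 0⟩ := by
    simp only [Pauli.left, pauliOn, Pauli.mk.injEq]
    constructor <;> ext a <;> simp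
  have h₂ : (pauliOn (Sum.inr b : A ⊕ B) P).right = pauliOn b P := by
    simp only [Pauli.right, pauliOn, Pauli.mk.injEq]
    constructor <;> ext c <;> by_cases hc : c = b <;> simp [hc]
  rw [Pauli.apply_prod, h₁, h₂, Pauli.apply_id]

/-- The order of quantifiers matters: one `χ'` serves all `ψ`. This is what makes the final error
and ancilla state independent of the encoded state. -/
theorem ideal_onRight [DecidableEq A] [DecidableEq B] {o : Op (A ⊕ B)}
    (ho : ∀ q, o.Acts q → ∃ b, q = Sum.inr b) (r m : A ⊕ B → ZMod 2) (χ : QState B) :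
    ∃ χ' : QState B, ∀ ψ : QState A, o.ideal r m (ψ.prod χ) = ψ.prod χ' := by
  have hu : ∀ (s : A ⊕ B → ZMod 2) (b : B) (x : ZMod 2),
      (fun c => Function.update s (Sum.inr b) x (Sum.inr c)) =
        Function.update (fun c => s (Sum.inr c)) b x := by
    intro s b x
    ext c
    by_cases hc : c = b
    · subst hc; simp
    · simp [hc]
  have hu' : ∀ (s : A ⊕ B → ZMod 2) (b : B) (x : ZMod 2),
      (fun a => Function.update s (Sum.inr b) x (Sum.inl a)) = fun a => s (Sum.inl a) := by
    intro s b x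
    ext c
    simp
  have hs : ∀ (s : A ⊕ B → ZMod 2) (b : B) (x : ZMod 2),
      (fun c => (s + (Pi.single (Sum.inr b) x : A ⊕ B → ZMod 2)) (Sum.inr c)) =
        (fun c => s (Sum.inr c)) + Pi.single b x := by
    intro s b x
    ext c
    by_cases hc : c = b
    · subst hc; simp
    · simp [hc]
  have hs' : ∀ (s : A ⊕ B → ZMod 2) (b : B) (x : ZMod 2),
      (fun a => (s + (Pi.single (Sum.inr b) x : A ⊕ B → ZMod 2)) (Sum.inl a)) =
        fun a => s (Sum.inl a) := by
    intro s b x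
    ext c
    simp
  cases o with
  | prepZ q =>
    obtain ⟨b, rfl⟩ := ho q rfl
    refine ⟨fun s => if s b = 0 then χ (Function.update s b (r (.inr b))) else 0, fun ψ => ?_⟩
    ext s
    simp only [Op.ideal, QState.prod, hu, hu', mul_ite, mul_zero]
  | prepX q =>
    obtain ⟨b, rfl⟩ := ho q rfl
    refine ⟨fun s => ((1 / Real.sqrt 2 : ℝ) : ℂ) * χ (Function.update s b (r (.inr b))),
      fun ψ => ?_⟩
    ext s
    simp only [Op.ideal, QState.prod, hu, hu']
    ring
  | cx c t =>
    obtain ⟨b, rfl⟩ := ho c (.inl rfl)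
    obtain ⟨b', rfl⟩ := ho t (.inr rfl)
    refine ⟨fun s => χ (Function.update s b' (s b' + s b)), fun ψ => ?_⟩
    ext s
    simp only [Op.ideal, QState.prod, hu, hu']
  | measZ q =>
    obtain ⟨b, rfl⟩ := ho q rfl
    refine ⟨fun s => if s b = m (.inr b) then χ s else 0, fun ψ => ?_⟩
    ext s
    simp only [Op.ideal, QState.prod, mul_ite, mul_zero]
  | measX q =>
    obtain ⟨b, rfl⟩ := ho q rfl
    refine ⟨fun s => (1 / 2 : ℂ) * (χ s + sgn (m (.inr b)) * χ (s + Pi.single b 1)),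
      fun ψ => ?_⟩
    ext s
    simp only [Op.ideal, QState.prod, hs, hs']
    ring

theorem noisy_onRight [Fintype A] [Fintype B] [DecidableEq A] [DecidableEq B] {o : Op (A ⊕ B)}
    (ho : ∀ q, o.Acts q → ∃ b, q = Sum.inr b) (r m : A ⊕ B → ZMod 2) (f : Fault) (χ : QState B) :
    ∃ χ' : QState B, ∀ ψ : QState A, o.noisy r m f (ψ.prod χ) = ψ.prod χ' := by
  cases o with
  | prepZ q =>
    obtain ⟨b, rfl⟩ := ho q rfl
    obtain ⟨χ', h⟩ := ideal_onRight ho r m χ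
    exact ⟨_, fun ψ => by rw [Op.noisy, h, pauliOn_inr_apply_prod]⟩
  | prepX q =>
    obtain ⟨b, rfl⟩ := ho q rfl
    obtain ⟨χ', h⟩ := ideal_onRight ho r m χ
    exact ⟨_, fun ψ => by rw [Op.noisy, h, pauliOn_inr_apply_prod]⟩
  | cx c t =>
    obtain ⟨b, rfl⟩ := ho c (.inl rfl)
    obtain ⟨b', rfl⟩ := ho t (.inr rfl)
    obtain ⟨χ', h⟩ := ideal_onRight ho r m χ
    exact ⟨_, fun ψ => by rw [Op.noisy, h, pauliOn_inr_apply_prod, pauliOn_inr_apply_prod]⟩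
  | measZ q =>
    obtain ⟨b, rfl⟩ := ho q rfl
    obtain ⟨χ', h⟩ := ideal_onRight ho r m ((pauliOn b f.1).apply χ)
    exact ⟨_, fun ψ => by rw [Op.noisy, pauliOn_inr_apply_prod, h]⟩
  | measX q =>
    obtain ⟨b, rfl⟩ := ho q rfl
    obtain ⟨χ', h⟩ := ideal_onRight ho r m ((pauliOn b f.1).apply χ)
    exact ⟨_, fun ψ => by rw [Op.noisy, pauliOn_inr_apply_prod, h]⟩

theorem foldl_noisy_onRight [Fintype A] [Fintype B] [DecidableEq A] [DecidableEq B]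
    {ops : List (Op (A ⊕ B) × Fault)}
    (ho : ∀ o ∈ ops.map Prod.fst, ∀ q, o.Acts q → ∃ b, q = Sum.inr b) (r m : A ⊕ B → ZMod 2)
    (χ : QState B) :
    ∃ χ' : QState B, ∀ ψ : QState A,
      ops.foldl (fun φ p => p.1.noisy r m p.2 φ) (ψ.prod χ) = ψ.prod χ' := by
  induction ops generalizing χ with
  | nil => exact ⟨χ, fun ψ => rfl⟩
  | cons p ops ih =>
    obtain ⟨χ₁, h₁⟩ := noisy_onRight (ho p.1 (by simp)) r m p.2 χ
    obtain ⟨χ₂, h₂⟩ := ih (fun o h => ho o (List.mem_cons_of_mem _ h)) χ₁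
    exact ⟨χ₂, fun ψ => by rw [List.foldl_cons, h₁, h₂]⟩

theorem krun_onRight [DecidableEq A] [DecidableEq B] {K : List (Op (A ⊕ B) × ZMod 2)}
    (ho : ∀ o ∈ K.map Prod.fst, ∀ q, o.Acts q → ∃ b, q = Sum.inr b) (χ : QState B) :
    ∃ χ' : QState B, ∀ ψ : QState A, krun K (ψ.prod χ) = ψ.prod χ' := by
  induction K generalizing χ with
  | nil => exact ⟨χ, fun ψ => rfl⟩
  | cons p K ih =>
    obtain ⟨χ₁, h₁⟩ := ideal_onRight (ho p.1 (by simp)) (fun _ => p.2) (fun _ => p.2) χ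
    obtain ⟨χ₂, h₂⟩ := ih (fun o h => ho o (List.mem_cons_of_mem _ h)) χ₁
    exact ⟨χ₂, fun ψ => by rw [krun_cons, Op.kraus, h₁, h₂]⟩

end ConcatIceberg

namespace ConcatIceberg

variable {Q : Type} [DecidableEq Q]

/-! ### The flag gadget -/

/-- Since no control is a target, every control keeps its initial value and the gates simply add up,
in any order. -/
theorem prop_map_cx {α : Type*} (l : List α) (c t : α → Q) (h : ∀ a ∈ l, ∀ a' ∈ l, c a ≠ t a')
    (u : Q → ZMod 2) (q : Q) :
    prop (l.map fun a => .cx (c a) (t a)) u q =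
      u q + (l.map fun a => if q = t a then u (c a) else 0).sum := by
  induction l generalizing u with
  | nil => simp
  | cons a l ih =>
    rw [List.map_cons, prop_cons, ih fun a ha a' ha' => h a (by simp [ha]) a' (by simp [ha'])]
    have h₁ : ∀ a' ∈ l, (Op.cx (c a) (t a)).push u (c a') = u (c a') := fun a' ha' => by
      simp [Op.push, h a' (by simp [ha']) a (by simp)]
    have h₂ : (l.map fun a' => if q = t a' then (Op.cx (c a) (t a)).push u (c a') else 0) =
        l.map fun a' => if q = t a' then u (c a') else 0 :=
      List.map_congr_left fun a' ha' => by rw [h₁ a' ha']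
    rw [h₂, List.map_cons, List.sum_cons, ← add_assoc]
    simp [Op.push, Pi.single_apply]

theorem prop_flatMap_cx {N n : ℕ} (c t : Fin n → Fin N → Q) (h : ∀ j i j' i', c j i ≠ t j' i')
    (u : Q → ZMod 2) (q : Q) :
    prop ((List.finRange n).flatMap fun j => (List.finRange N).map fun i => .cx (c j i) (t j i)) u q =
      u q + ∑ j, ∑ i, if q = t j i then u (c j i) else 0 := by
  have h₁ : ((List.finRange n).flatMap fun j => (List.finRange N).map fun i =>
      Op.cx (c j i) (t j i)) =
      ((List.finRange n).flatMap fun j => (List.finRange N).map fun i => (j, i)).map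
        fun p => .cx (c p.1 p.2) (t p.1 p.2) := by
    simp [List.map_flatMap, Function.comp_def]
  rw [h₁, prop_map_cx _ _ _ fun a _ a' _ => h _ _ _ _]
  congr 1
  simp only [List.map_flatMap, List.map_map, Function.comp_def, Fin.sum_univ_def]
  generalize List.finRange n = l
  induction l with
  | nil => rfl
  | cons a l ih => simp [ih]

/-- The pairwise distinct qubits of a flag gadget. -/
structure Gadget {N n : ℕ} (b f : Fin N → Q) (d : Fin N → Fin n → Q) : Prop where
  b_inj : Function.Injective b
  f_inj : Function.Injective f
  d_inj : ∀ i j i' j', d i j = d i' j' → i = i' ∧ j = j'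
  b_ne_f : ∀ i i', b i ≠ f i'
  b_ne_d : ∀ i i' j, b i ≠ d i' j
  f_ne_d : ∀ i i' j, f i ≠ d i' j

section

variable {N n : ℕ} (b f : Fin N → Q) (d : Fin N → Fin n → Q)

/-- Coupling of the ancillas to their flags. -/
def flagCX : List (Op Q) := (List.finRange N).map fun i => .cx (b i) (f i)

/-- Coupling of the ancillas and flags to the data. -/
def dataCX : List (Op Q) :=
  (List.finRange n).flatMap fun j => (List.finRange N).map fun i =>
    .cx (if Even j.val then b i else f i) (d i j)

/-- The gates of a flag gadget. -/
def gadgetCX : List (Op Q) := flagCX b f ++ dataCX b f d ++ flagCX b f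

/-- Initialisation of the flags. -/
def flagPrep : List (Op Q) := (List.finRange N).map fun i => .prepZ (f i)

/-- The measurements of a flag gadget. -/
def gadgetMeas : List (Op Q) :=
  (List.finRange N).map (fun i => .measX (b i)) ++ (List.finRange N).map fun i => .measZ (f i)

/-- A flag gadget. -/
def gadget : List (Op Q) := flagPrep f ++ gadgetCX b f d ++ gadgetMeas b f

variable {b f d} (G : Gadget b f d)
include G

theorem flagCX_flag (u : Q → ZMod 2) (i : Fin N) :
    prop (flagCX b f) u (f i) = u (f i) + u (b i) := by
  rw [flagCX, prop_map_cx _ _ _ fun i _ i' _ => G.b_ne_f i i', ← Fin.sum_univ_def]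
  simp [G.f_inj.eq_iff]

omit G in
theorem flagCX_of_ne {u : Q → ZMod 2} {q : Q} (hb : ∀ i, q ≠ b i) (hf : ∀ i, q ≠ f i) :
    prop (flagCX b f) u q = u q :=
  prop_of_not_acts (by simp [flagCX, Op.Acts, hb, hf]) u

theorem flagCX_anc (u : Q → ZMod 2) (i : Fin N) : prop (flagCX b f) u (b i) = u (b i) := by
  rw [flagCX, prop_map_cx _ _ _ fun i _ i' _ => G.b_ne_f i i', ← Fin.sum_univ_def]
  simp [G.b_ne_f]

theorem dataCX_data (u : Q → ZMod 2) (i : Fin N) (j : Fin n) :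
    prop (dataCX b f d) u (d i j) = u (d i j) + if Even j.val then u (b i) else u (f i) := by
  rw [dataCX, prop_flatMap_cx]
  · congr 1
    rw [Finset.sum_eq_single j, Finset.sum_eq_single i]
    · simp [apply_ite u]
    · intro i' _ hi'
      rw [if_neg fun h => hi' (G.d_inj _ _ _ _ h).1.symm]
    · simp
    · intro j' _ hj'
      refine Finset.sum_eq_zero fun i' _ => ?_
      rw [if_neg fun h => hj' (G.d_inj _ _ _ _ h).2.symm]
    · simp
  · intro j i j' i'
    split_ifs
    · exact G.b_ne_d _ _ _
    · exact G.f_ne_d _ _ _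

theorem dataCX_of_ne {u : Q → ZMod 2} {q : Q} (hd : ∀ i j, q ≠ d i j) :
    prop (dataCX b f d) u q = u q := by
  rw [dataCX, prop_flatMap_cx]
  · simp [hd]
  · intro j i j' i'
    split_ifs
    · exact G.b_ne_d _ _ _
    · exact G.f_ne_d _ _ _

/-- Odd positions are served by the flag, which has received a copy of the ancilla. With clean flags
all positions therefore receive the ancilla. -/
theorem gadgetCX_data (u : Q → ZMod 2) (i : Fin N) (j : Fin n) :
    prop (gadgetCX b f d) u (d i j) =
      u (d i j) + if Even j.val then u (b i) else u (f i) + u (b i) := by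
  rw [gadgetCX, prop_append, prop_append, flagCX_of_ne (fun i' => (G.b_ne_d i' i j).symm)
    (fun i' => (G.f_ne_d i' i j).symm), dataCX_data G, flagCX_of_ne (fun i' => (G.b_ne_d i' i j).symm)
    (fun i' => (G.f_ne_d i' i j).symm), flagCX_anc G, flagCX_flag G]

/-- The two couplings add the ancilla to its flag twice, which cancels. -/
theorem gadgetCX_of_ne (u : Q → ZMod 2) {q : Q} (hd : ∀ i j, q ≠ d i j) :
    prop (gadgetCX b f d) u q = u q := by
  rw [gadgetCX, prop_append, prop_append]
  by_cases hf : ∃ i, q = f i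
  · obtain ⟨i, rfl⟩ := hf
    rw [flagCX_flag G, dataCX_of_ne G hd, dataCX_of_ne G (G.b_ne_d i), flagCX_flag G, flagCX_anc G,
      add_assoc, zmod_two_add_self, add_zero]
  · by_cases hb : ∃ i, q = b i
    · obtain ⟨i, rfl⟩ := hb
      rw [flagCX_anc G, dataCX_of_ne G hd, flagCX_anc G]
    · push Not at hf hb
      rw [flagCX_of_ne hb hf, dataCX_of_ne G hd, flagCX_of_ne hb hf]

/-! ### Propagation through the dual of the flag gadget. -/

theorem flagCX_dual_anc (u : Q → ZMod 2) (i : Fin N) :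
    prop ((flagCX b f).map Op.dual) u (b i) = u (b i) + u (f i) := by
  have h : (flagCX b f).map Op.dual = (List.finRange N).map fun i => .cx (f i) (b i) := by
    simp [flagCX, Function.comp_def, Op.dual]
  rw [h, prop_map_cx _ _ _ fun i _ i' _ => (G.b_ne_f i' i).symm, ← Fin.sum_univ_def]
  simp [G.b_inj.eq_iff]

theorem flagCX_dual_of_ne {u : Q → ZMod 2} {q : Q} (hb : ∀ i, q ≠ b i) :
    prop ((flagCX b f).map Op.dual) u q = u q := by
  have h : (flagCX b f).map Op.dual = (List.finRange N).map fun i => .cx (f i) (b i) := by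
    simp [flagCX, Function.comp_def, Op.dual]
  rw [h, prop_map_cx _ _ _ fun i _ i' _ => (G.b_ne_f i' i).symm, ← Fin.sum_univ_def]
  simp [hb]

theorem dataCX_dual (u : Q → ZMod 2) (q : Q) :
    prop ((dataCX b f d).map Op.dual) u q =
      u q + ∑ j, ∑ i, if q = (if Even j.val then b i else f i) then u (d i j) else 0 := by
  have h : (dataCX b f d).map Op.dual = (List.finRange n).flatMap fun j =>
      (List.finRange N).map fun i => .cx (d i j) (if Even j.val then b i else f i) := by
    simp [dataCX, List.map_flatMap, Function.comp_def, Op.dual]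
  rw [h, prop_flatMap_cx]
  intro j i j' i'
  split_ifs
  · exact (G.b_ne_d _ _ _).symm
  · exact (G.f_ne_d _ _ _).symm

theorem dataCX_dual_anc (u : Q → ZMod 2) (i : Fin N) :
    prop ((dataCX b f d).map Op.dual) u (b i) =
      u (b i) + ∑ j : Fin n, if Even j.val then u (d i j) else 0 := by
  rw [dataCX_dual G]
  congr 1
  refine Finset.sum_congr rfl fun j _ => ?_
  split_ifs <;> simp [G.b_inj.eq_iff, G.b_ne_f]

theorem dataCX_dual_flag (u : Q → ZMod 2) (i : Fin N) :
    prop ((dataCX b f d).map Op.dual) u (f i) =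
      u (f i) + ∑ j : Fin n, if Even j.val then 0 else u (d i j) := by
  rw [dataCX_dual G]
  congr 1
  refine Finset.sum_congr rfl fun j _ => ?_
  split_ifs <;> simp [G.f_inj.eq_iff, (G.b_ne_f _ _).symm]

theorem dataCX_dual_of_ne {u : Q → ZMod 2} {q : Q} (hb : ∀ i, q ≠ b i) (hf : ∀ i, q ≠ f i) :
    prop ((dataCX b f d).map Op.dual) u q = u q := by
  rw [dataCX_dual G]
  simp [apply_ite, hb, hf]

omit G [DecidableEq Q] in
theorem map_dual_gadgetCX : (gadgetCX b f d).map Op.dual =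
    (flagCX b f).map Op.dual ++ (dataCX b f d).map Op.dual ++ (flagCX b f).map Op.dual := by
  simp [gadgetCX]

/-- Data at even positions reach the ancilla directly, data at odd positions through the flag and
the last coupling. The initial value of the flag arrives twice and cancels. -/
theorem gadgetCX_dual_anc (u : Q → ZMod 2) (i : Fin N) :
    prop ((gadgetCX b f d).map Op.dual) u (b i) = u (b i) + ∑ j, u (d i j) := by
  rw [map_dual_gadgetCX, prop_append, prop_append, flagCX_dual_anc G, dataCX_dual_anc G,
    dataCX_dual_flag G, flagCX_dual_anc G, flagCX_dual_of_ne G fun i' => (G.b_ne_f i' i).symm]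
  have h : ∑ j : Fin n, u (d i j) = (∑ j : Fin n, if Even j.val then u (d i j) else 0) +
      ∑ j : Fin n, if Even j.val then 0 else u (d i j) := by
    rw [← Finset.sum_add_distrib]
    refine Finset.sum_congr rfl fun j _ => ?_
    split_ifs <;> simp
  have h' : ∀ j, prop ((flagCX b f).map Op.dual) u (d i j) = u (d i j) := fun j =>
    flagCX_dual_of_ne G fun i' => (G.b_ne_d i' i j).symm
  simp only [h', h]
  linear_combination zmod_two_add_self (u (f i))

theorem gadgetCX_dual_of_ne {u : Q → ZMod 2} {q : Q} (hb : ∀ i, q ≠ b i) (hf : ∀ i, q ≠ f i) :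
    prop ((gadgetCX b f d).map Op.dual) u q = u q := by
  rw [map_dual_gadgetCX, prop_append, prop_append, flagCX_dual_of_ne G hb,
    dataCX_dual_of_ne G hb hf, flagCX_dual_of_ne G hb]

omit G in
theorem flagPrep_flag (u : Q → ZMod 2) (i : Fin N) : prop (flagPrep f) u (f i) = 0 := by
  obtain ⟨l₁, l₂, h⟩ := List.append_of_mem (List.mem_finRange i)
  have h₁ : prop (l₂.map fun i => .prepZ (f i))
      ((Op.prepZ (f i)).push (prop (l₁.map fun i => .prepZ (f i)) u)) (f i) = 0 := by
    refine prop_inv (R := fun w => w (f i) = 0) ?_ ?_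
    · simp only [List.mem_map]
      rintro o ⟨i', -, rfl⟩ v hv
      by_cases hi : f i = f i'
      · simp [Op.push, hi, zmod_two_add_self]
      · simp [Op.push, hi, hv]
    · simp [Op.push, zmod_two_add_self]
  rw [flagPrep, h, List.map_append, List.map_cons, prop_append, prop_cons, h₁]

omit G in
theorem flagPrep_of_ne {u : Q → ZMod 2} {q : Q} (hf : ∀ i, q ≠ f i) :
    prop (flagPrep f) u q = u q :=
  prop_of_not_acts (by simp [flagPrep, Op.Acts, hf]) u

omit G in
theorem prop_map_dual_flagPrep (u : Q → ZMod 2) :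
    prop ((flagPrep f).map Op.dual) u = prop (flagPrep f) u := by
  unfold flagPrep
  generalize List.finRange N = l
  induction l generalizing u with
  | nil => rfl
  | cons i l ih =>
    simp only [List.map_cons, prop_cons]
    exact ih _

omit G in
theorem prop_gadgetMeas (u : Q → ZMod 2) : prop (gadgetMeas b f) u = u :=
  prop_fixed (by simp only [gadgetMeas, List.mem_append, List.mem_map]; rintro o (⟨i, -, rfl⟩ | ⟨i, -, rfl⟩) <;> rfl)

omit G in
theorem prop_map_dual_gadgetMeas (u : Q → ZMod 2) : prop ((gadgetMeas b f).map Op.dual) u = u :=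
  prop_fixed (by
    simp only [gadgetMeas, List.map_append, List.map_map, List.mem_append, List.mem_map]
    rintro o (⟨i, -, rfl⟩ | ⟨i, -, rfl⟩) <;> rfl)

theorem gadget_data (u : Q → ZMod 2) (i : Fin N) (j : Fin n) :
    prop (gadget b f d) u (d i j) = u (d i j) + u (b i) := by
  rw [gadget, prop_append, prop_append, prop_gadgetMeas, gadgetCX_data G, flagPrep_flag,
    flagPrep_of_ne fun i' => (G.f_ne_d i' i j).symm, flagPrep_of_ne (G.b_ne_f i)]
  simp

theorem gadget_flag (u : Q → ZMod 2) (i : Fin N) : prop (gadget b f d) u (f i) = 0 := by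
  rw [gadget, prop_append, prop_append, prop_gadgetMeas, gadgetCX_of_ne G _ (G.f_ne_d i),
    flagPrep_flag]

theorem gadget_of_ne {u : Q → ZMod 2} {q : Q} (hf : ∀ i, q ≠ f i) (hd : ∀ i j, q ≠ d i j) :
    prop (gadget b f d) u q = u q := by
  rw [gadget, prop_append, prop_append, prop_gadgetMeas, gadgetCX_of_ne G _ hd, flagPrep_of_ne hf]

theorem gadget_dual_anc (u : Q → ZMod 2) (i : Fin N) :
    prop ((gadget b f d).map Op.dual) u (b i) = u (b i) + ∑ j, u (d i j) := by
  rw [gadget, List.map_append, List.map_append, prop_append, prop_append, prop_map_dual_gadgetMeas,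
    gadgetCX_dual_anc G, prop_map_dual_flagPrep, flagPrep_of_ne (G.b_ne_f i)]
  simp only [flagPrep_of_ne fun i' => (G.f_ne_d i' _ _).symm]

theorem gadget_dual_of_ne {u : Q → ZMod 2} {q : Q} (hb : ∀ i, q ≠ b i) (hf : ∀ i, q ≠ f i) :
    prop ((gadget b f d).map Op.dual) u q = u q := by
  rw [gadget, List.map_append, List.map_append, prop_append, prop_append, prop_map_dual_gadgetMeas,
    gadgetCX_dual_of_ne G hb hf, prop_map_dual_flagPrep, flagPrep_of_ne hf]

/-- A fault in a flag gadget creates an error on a single data qubit, on all data qubits of a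
column, or is flagged. -/
theorem faultOut_gadget {v : Q → ZMod 2} (hn : 0 < n) (hv : FaultOut (gadget b f d) v) :
    ∃ i, (∀ q, q ≠ b i → q ≠ f i → (∀ j, q ≠ d i j) → v q = 0) ∧
      (v (f i) = 1 ∨ (v (f i) = 0 ∧ ∃ j, ∀ j', j' ≠ j → v (d i j') = 0) ∨
        (v (f i) = 0 ∧ ∀ j, v (d i j) = 1)) := by
  -- Apart from `dataCX`, all operations stay within one ancilla and its flag, and so does a fault.
  have h₁ : ∀ C : List (Op Q), (∀ o ∈ C, ∃ i, o = .prepZ (f i) ∨ o = .cx (b i) (f i) ∨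
      o = .measX (b i) ∨ o = .measZ (f i)) → ∀ u, FaultOut C u →
      ∃ i, ∀ q, q ≠ b i → q ≠ f i → u q = 0 := by
    intro C hC u hu
    refine hu.exists_inv (fun i u => ∀ q, q ≠ b i → q ≠ f i → u q = 0) ?_ ?_
    · intro o ho u hu
      obtain ⟨i, h⟩ := hC o ho
      refine ⟨i, fun q hb hf => hu q ?_⟩
      rcases h with rfl | rfl | rfl | rfl <;> simp [Op.Acts, hb, hf]
    · intro o ho i u hu q hb hf
      obtain ⟨i', h⟩ := hC o ho
      have hq := hu q hb hf
      rcases h with rfl | rfl | rfl | rfl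
      · by_cases h : q = f i'
        · subst h
          simp [Op.push, hq]
        · simp [Op.push, hq, h]
      · by_cases h : q = f i'
        · subst h
          have hb' : u (b i') = 0 := hu _ (fun h' => hf (by rw [G.b_inj h'])) (G.b_ne_f _ _)
          simp [Op.push, hq, hb']
        · simp [Op.push, hq, h]
      · exact hq
      · exact hq
  -- A gate of `dataCX` touches the ancilla or the flag, never both. Either both remain clean and
  -- one data qubit is hit, or exactly one of them is in error, which the last coupling turns into a
  -- raised flag.
  have h₂ : ∀ u, FaultOut (dataCX b f d) u →
      ∃ p : Fin N × Fin n, (∀ q, q ≠ b p.1 → q ≠ f p.1 → (∀ j, q ≠ d p.1 j) → u q = 0) ∧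
        ((u (b p.1) = 0 ∧ u (f p.1) = 0 ∧ ∀ j, j ≠ p.2 → u (d p.1 j) = 0) ∨
          u (b p.1) + u (f p.1) = 1) := by
    intro u hu
    refine hu.exists_inv (fun (p : Fin N × Fin n) u =>
      (∀ q, q ≠ b p.1 → q ≠ f p.1 → (∀ j, q ≠ d p.1 j) → u q = 0) ∧
        ((u (b p.1) = 0 ∧ u (f p.1) = 0 ∧ ∀ j, j ≠ p.2 → u (d p.1 j) = 0) ∨
          u (b p.1) + u (f p.1) = 1)) ?_ ?_
    · simp only [dataCX, List.mem_flatMap, List.mem_map]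
      rintro o ⟨j, -, i, -, rfl⟩ u hu
      simp only [Op.Acts, not_or] at hu
      refine ⟨(i, j), fun q hb hf hd => hu q ⟨?_, hd j⟩, ?_⟩
      · split_ifs <;> assumption
      · have hd : ∀ j', j' ≠ j → u (d i j') = 0 := fun j' hj' => by
          refine hu _ ⟨?_, fun h => hj' (G.d_inj _ _ _ _ h).2⟩
          split_ifs
          · exact (G.b_ne_d _ _ _).symm
          · exact (G.f_ne_d _ _ _).symm
        split_ifs at hu with hj
        · have hf : u (f i) = 0 := hu _ ⟨(G.b_ne_f _ _).symm, G.f_ne_d _ _ _⟩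
          rcases zmod_two_cases (u (b i)) with h | h
          · exact .inl ⟨h, hf, hd⟩
          · exact .inr (by simp [h, hf])
        · have hf : u (b i) = 0 := hu _ ⟨G.b_ne_f _ _, G.b_ne_d _ _ _⟩
          rcases zmod_two_cases (u (f i)) with h | h
          · exact .inl ⟨hf, h, hd⟩
          · exact .inr (by simp [h, hf])
    · simp only [dataCX, List.mem_flatMap, List.mem_map]
      rintro o ⟨j, -, i, -, rfl⟩ ⟨i', j'⟩ u ⟨hu, hu'⟩
      dsimp only at hu hu' ⊢
      have hb : (Op.cx (if Even j.val then b i else f i) (d i j)).push u (b i') = u (b i') := by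
        simp [Op.push, G.b_ne_d]
      have hf : (Op.cx (if Even j.val then b i else f i) (d i j)).push u (f i') = u (f i') := by
        simp [Op.push, G.f_ne_d]
      have hc : i ≠ i' → u (if Even j.val then b i else f i) = 0 := fun hi => by
        split_ifs
        · exact hu _ (G.b_inj.ne hi) (G.b_ne_f _ _) (G.b_ne_d _ _)
        · exact hu _ (G.b_ne_f _ _).symm (G.f_inj.ne hi) (G.f_ne_d _ _)
      rw [hb, hf]
      refine ⟨fun q hqb hqf hqd => ?_, hu'.imp_left fun ⟨h, h', hd⟩ => ⟨h, h', fun k hk => ?_⟩⟩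
      · by_cases hi : i = i'
        · subst hi
          simp [Op.push, hqd, hu q hqb hqf hqd]
        · simp [Op.push, hc hi, hu q hqb hqf hqd]
      · have hc' : u (if Even j.val then b i else f i) = 0 := by
          by_cases hi : i = i'
          · subst hi
            split_ifs <;> assumption
          · exact hc hi
        simp [Op.push, hc', hd k hk]
  have hC : gadget b f d = (flagPrep f ++ flagCX b f) ++ (dataCX b f d ++
      (flagCX b f ++ gadgetMeas b f)) := by
    simp [gadget, gadgetCX]
  rw [hC, faultOut_append, faultOut_append] at hv
  rcases hv with ⟨u, hu, rfl⟩ | ⟨u, hu, rfl⟩ | hv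
  · obtain ⟨i, hi⟩ := h₁ _ (by
      simp only [flagPrep, flagCX, List.mem_append, List.mem_map]
      rintro o (⟨i, -, rfl⟩ | ⟨i, -, rfl⟩)
      · exact ⟨i, by simp⟩
      · exact ⟨i, by simp⟩) u hu
    have hd : ∀ i' j, prop (dataCX b f d ++ (flagCX b f ++ gadgetMeas b f)) u (d i' j) =
        if Even j.val then u (b i') else u (f i') := fun i' j => by
      rw [prop_append, prop_append, prop_gadgetMeas, flagCX_of_ne (fun k => (G.b_ne_d k i' j).symm)
        fun k => (G.f_ne_d k i' j).symm, dataCX_data G,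
        hi _ (G.b_ne_d _ _ _).symm (G.f_ne_d _ _ _).symm, zero_add]
    have hf : ∀ i', prop (dataCX b f d ++ (flagCX b f ++ gadgetMeas b f)) u (f i') =
        u (f i') + u (b i') := fun i' => by
      rw [prop_append, prop_append, prop_gadgetMeas, flagCX_flag G, dataCX_of_ne G (G.f_ne_d _),
        dataCX_of_ne G (G.b_ne_d _)]
    refine ⟨i, fun q hqb hqf hqd => ?_, ?_⟩
    · by_cases h : ∃ i' j, q = d i' j
      · obtain ⟨i', j, rfl⟩ := h
        have hi' : i' ≠ i := by rintro rfl; exact hqd j rfl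
        rw [hd, hi _ (G.b_inj.ne hi') (G.b_ne_f _ _), hi _ (G.b_ne_f _ _).symm (G.f_inj.ne hi'),
          ite_self]
      · by_cases h' : ∃ i', q = f i'
        · obtain ⟨i', rfl⟩ := h'
          have hi' : i' ≠ i := by rintro rfl; exact hqf rfl
          rw [hf, hi _ (G.b_inj.ne hi') (G.b_ne_f _ _), hi _ hqb hqf, add_zero]
        · push Not at h h'
          rw [prop_append, prop_append, prop_gadgetMeas]
          by_cases hb : ∃ i', q = b i'
          · obtain ⟨i', rfl⟩ := hb
            rw [flagCX_anc G, dataCX_of_ne G (G.b_ne_d _), hi _ hqb hqf]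
          · push Not at hb
            rw [flagCX_of_ne hb h', dataCX_of_ne G h, hi _ hqb hqf]
    · rw [hf]
      simp only [hd]
      -- An error before `dataCX` puts `u (b i)` on the even positions, `u (f i)` on the odd ones
      -- and their sum on the flag. Equal values give the empty or the complete string; different
      -- values raise the flag.
      rcases zmod_two_cases (u (f i)) with h | h <;> rcases zmod_two_cases (u (b i)) with h' | h' <;>
        simp only [h, h', ite_self, zmod_two_add_self, zero_add, add_zero, true_and, true_or]
      · exact .inr (.inl ⟨⟨0, hn⟩, fun _ _ => trivial⟩)
      · simp
  · obtain ⟨⟨i, j⟩, hi, hi'⟩ := h₂ u hu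
    dsimp only at hi hi'
    have hf : ∀ i', prop (flagCX b f ++ gadgetMeas b f) u (f i') = u (f i') + u (b i') :=
      fun i' => by rw [prop_append, prop_gadgetMeas, flagCX_flag G]
    have hd : ∀ q, (∀ i', q ≠ f i') → prop (flagCX b f ++ gadgetMeas b f) u q = u q := by
      intro q hqf
      rw [prop_append, prop_gadgetMeas]
      by_cases hb : ∃ i', q = b i'
      · obtain ⟨i', rfl⟩ := hb
        rw [flagCX_anc G]
      · push Not at hb
        rw [flagCX_of_ne hb hqf]
    refine ⟨i, fun q hqb hqf hqd => ?_, ?_⟩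
    · by_cases h' : ∃ i', q = f i'
      · obtain ⟨i', rfl⟩ := h'
        have hi' : i' ≠ i := by rintro rfl; exact hqf rfl
        rw [hf, hi _ hqb hqf hqd, hi _ (G.b_inj.ne hi') (G.b_ne_f _ _) (G.b_ne_d _ _), add_zero]
      · push Not at h'
        rw [hd q h', hi q hqb hqf hqd]
    · rw [hf]
      simp only [hd _ fun i' => (G.f_ne_d i' _ _).symm]
      rcases hi' with ⟨h, h', h''⟩ | h
      · exact .inr (.inl ⟨by rw [h, h', add_zero], j, h''⟩)
      · exact .inl (by rw [add_comm, h])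
  · obtain ⟨i, hi⟩ := h₁ _ (by
      simp only [gadgetMeas, flagCX, List.mem_append, List.mem_map]
      rintro o (⟨i, -, rfl⟩ | ⟨i, -, rfl⟩ | ⟨i, -, rfl⟩)
      · exact ⟨i, by simp⟩
      · exact ⟨i, by simp⟩
      · exact ⟨i, by simp⟩) v hv
    refine ⟨i, fun q hb hf _ => hi q hb hf, ?_⟩
    rcases zmod_two_cases (v (f i)) with h | h
    · exact .inr (.inl ⟨h, ⟨0, hn⟩, fun j _ => hi _ (G.b_ne_d _ _ _).symm (G.f_ne_d _ _ _).symm⟩)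
    · exact .inl h

/-- A fault in the dual of a flag gadget affects an ancilla, its flag and one data qubit. -/
theorem faultOut_gadget_dual {v : Q → ZMod 2} (hn : 0 < n)
    (hv : FaultOut ((gadget b f d).map Op.dual) v) :
    ∃ i j, ∀ q, q ≠ b i → q ≠ f i → q ≠ d i j → v q = 0 := by
  have hC : ∀ o ∈ (gadget b f d).map Op.dual, ∃ i, o = .prepX (f i) ∨ o = .cx (f i) (b i) ∨
      o = .measZ (b i) ∨ o = .measX (f i) ∨ ∃ j, o = .cx (d i j) (b i) ∨ o = .cx (d i j) (f i) := by
    simp only [gadget, flagPrep, gadgetCX, flagCX, dataCX, gadgetMeas, List.mem_map,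
      List.mem_append, List.mem_flatMap]
    rintro _ ⟨o, ((⟨i, -, rfl⟩ | (⟨i, -, rfl⟩ | ⟨j, -, i, -, rfl⟩) | ⟨i, -, rfl⟩) |
      ⟨i, -, rfl⟩ | ⟨i, -, rfl⟩), rfl⟩ <;> refine ⟨i, ?_⟩
    · exact .inl rfl
    · exact .inr (.inl rfl)
    · refine .inr (.inr (.inr (.inr ⟨j, ?_⟩)))
      split_ifs
      · exact .inl rfl
      · exact .inr rfl
    · exact .inr (.inl rfl)
    · exact .inr (.inr (.inl rfl))
    · exact .inr (.inr (.inr (.inl rfl)))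
  -- In the dual gadget the targets are ancillas and flags only, each in the column of its control.
  -- An error thus never reaches a second data qubit or another column.
  obtain ⟨⟨i, j⟩, h⟩ := hv.exists_inv (fun (p : Fin N × Fin n) u =>
    ∀ q, q ≠ b p.1 → q ≠ f p.1 → q ≠ d p.1 p.2 → u q = 0) (by
      intro o ho u hu
      obtain ⟨i, h | h | h | h | ⟨j, h | h⟩⟩ := hC o ho
      · exact ⟨(i, ⟨0, hn⟩), fun q hb hf hd => hu q (by simp [h, Op.Acts, hf])⟩
      · exact ⟨(i, ⟨0, hn⟩), fun q hb hf hd => hu q (by simp [h, Op.Acts, hf, hb])⟩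
      · exact ⟨(i, ⟨0, hn⟩), fun q hb hf hd => hu q (by simp [h, Op.Acts, hb])⟩
      · exact ⟨(i, ⟨0, hn⟩), fun q hb hf hd => hu q (by simp [h, Op.Acts, hf])⟩
      · exact ⟨(i, j), fun q hb hf hd => hu q (by simp [h, Op.Acts, hb, hd])⟩
      · exact ⟨(i, j), fun q hb hf hd => hu q (by simp [h, Op.Acts, hf, hd])⟩) (by
      rintro o ho ⟨i, j⟩ u hu q hb hf hd
      dsimp only at hu hb hf hd
      have hq := hu q hb hf hd
      obtain ⟨i', h | h | h | h | ⟨j', h | h⟩⟩ := hC o ho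
      · subst h
        by_cases h : q = f i'
        · subst h
          simp [Op.push, hq]
        · simp [Op.push, hq, h]
      · subst h
        by_cases h : q = b i'
        · subst h
          have hc : u (f i') = 0 :=
            hu _ (G.b_ne_f _ _).symm (fun h' => hb (by rw [G.f_inj h'])) (G.f_ne_d _ _ _)
          simp [Op.push, hq, hc]
        · simp [Op.push, hq, h]
      · subst h
        exact hq
      · subst h
        exact hq
      · subst h
        by_cases h : q = b i'
        · subst h
          have hc : u (d i' j') = 0 := hu _ (G.b_ne_d _ _ _).symm (G.f_ne_d _ _ _).symm
            (fun h' => hb (by rw [(G.d_inj _ _ _ _ h').1]))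
          simp [Op.push, hq, hc]
        · simp [Op.push, hq, h]
      · subst h
        by_cases h : q = f i'
        · subst h
          have hc : u (d i' j') = 0 := hu _ (G.b_ne_d _ _ _).symm (G.f_ne_d _ _ _).symm
            (fun h' => hf (by rw [(G.d_inj _ _ _ _ h').1]))
          simp [Op.push, hq, hc]
        · simp [Op.push, hq, h])
  exact ⟨i, j, h⟩

end

end ConcatIceberg

namespace ConcatIceberg

/-! ### The faultless flag gadget -/

theorem measOf_swap_eq (h : Half) {Q : Type} (q : Q) : (Op.measX q).conj h = measOf h.swap q := by
  cases h <;> rfl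

theorem measOf_eq (h : Half) {Q : Type} (q : Q) : (Op.measZ q).conj h = measOf h q := by
  cases h <;> rfl

theorem prepOf_swap_eq (h : Half) {Q : Type} (q : Q) : (Op.prepZ q).conj h = prepOf h.swap q := by
  cases h <;> rfl

theorem prepOf_eq (h : Half) {Q : Type} (q : Q) : (Op.prepX q).conj h = prepOf h q := by
  cases h <;> rfl

theorem prepOf_acts {t : Half} {Q : Type} {q p : Q} : (prepOf t q).Acts p ↔ p = q := by
  cases t <;> rfl

theorem measOf_acts {t : Half} {Q : Type} {q p : Q} : (measOf t q).Acts p ↔ p = q := by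
  cases t <;> rfl

theorem map_eq_append {α β : Type*} {g : α → β} {l : List α} {m₁ m₂ : List β}
    (h : l.map g = m₁ ++ m₂) : ∃ l₁ l₂, l = l₁ ++ l₂ ∧ l₁.map g = m₁ ∧ l₂.map g = m₂ :=
  List.map_eq_append_iff.1 h

variable {Q : Type} [DecidableEq Q]

theorem krun_inv {K : List (Op Q × ZMod 2)} {R : QState Q → Prop}
    (h : ∀ o ∈ K.map Prod.fst, ∀ b Φ, R Φ → R (o.kraus b Φ)) {Ψ : QState Q} (hΨ : R Ψ) :
    R (krun K Ψ) := by
  induction K generalizing Ψ with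
  | nil => exact hΨ
  | cons p K ih =>
    exact ih (fun o ho => h o (List.mem_cons_of_mem _ ho)) (h p.1 (by simp) _ _ hΨ)

variable [Fintype Q]

/-- Once `q` has been initialised it is either left alone or initialised again in the same way. -/
theorem stab_of_prepOf_mem {K : List (Op Q × ZMod 2)} {t : Half} {q : Q}
    (hK : prepOf t q ∈ K.map Prod.fst)
    (h : ∀ o ∈ K.map Prod.fst, o.Acts q → o = prepOf t q) (Ψ : QState Q) :
    Stab t (Pi.single q 1) 0 (krun K Ψ) := by
  obtain ⟨⟨o, b⟩, hp, hp'⟩ := List.mem_map.1 hK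
  dsimp only at hp'
  subst hp'
  obtain ⟨K₁, K₂, rfl⟩ := List.append_of_mem hp
  rw [krun_append, krun_cons]
  refine krun_inv (R := Stab t (Pi.single q 1) 0) (fun o ho b Φ hΦ => ?_) (stab_prepOf _ _ _ _)
  by_cases hq : o.Acts q
  · rw [h o (by simp only [List.map_append, List.map_cons, List.mem_append, List.mem_cons, ho, or_true]) hq]
    exact stab_prepOf _ _ _ _
  · exact hΦ.kraus_of_not_acts
      (fun p hp => Pi.single_eq_of_ne (fun hpq : p = q => hq (hpq ▸ hp)) _) _

section

variable {N n : ℕ} {b f : Fin N → Q} {d : Fin N → Fin n → Q}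

/-- Invariance of a state under the joint action of the ancillas of a gadget on the data. -/
def ShiftInv (h : Half) (b : Fin N → Q) (d : Fin N → Fin n → Q) (Φ : QState Q) : Prop :=
  match h with
  | .X => ∀ s w, (∀ i j, w (d i j) = s (b i)) → (∀ q, (∀ i j, q ≠ d i j) → w q = 0) →
      Φ (s + w) = Φ s
  | .Z => ∀ s w, (∀ i, w (b i) = ∑ j, s (d i j)) → (∀ q, (∀ i, q ≠ b i) → w q = 0) →
      Φ (s + w) = Φ s

/-- With clean flags the gates permute the basis by the shift of `ShiftInv`, up to changes of the
flags, so `krun_eq_self` applies. For `Half.X` the flags vanish on the support of the state. For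
`Half.Z` the flags do change, but the state is invariant under flipping them; these flips are
collected in `w`. -/
theorem krun_gadgetCX (G : Gadget b f d) {h : Half} {K : List (Op Q × ZMod 2)}
    (hK : K.map Prod.fst = (gadgetCX b f d).map (Op.conj h)) {Φ : QState Q}
    (hf : ∀ i, Stab h.swap (Pi.single (f i) 1) 0 Φ) (hs : ShiftInv h b d Φ) :
    krun K Φ = Φ := by
  have hcx : ∀ o ∈ K.map Prod.fst, o.IsCX := by
    rw [hK]
    intro o ho
    obtain ⟨o', ho', rfl⟩ := List.mem_map.1 ho
    rw [Op.isCX_conj]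
    simp only [gadgetCX, flagCX, dataCX, List.mem_append, List.mem_map, List.mem_flatMap] at ho'
    rcases ho' with (⟨i, -, rfl⟩ | ⟨j, -, i, -, rfl⟩) | ⟨i, -, rfl⟩
    · exact G.b_ne_f _ _
    · change (if Even j.val then b i else f i) ≠ d i j
      split_ifs
      · exact G.b_ne_d _ _ _
      · exact G.f_ne_d _ _ _
    · exact G.b_ne_f _ _
  refine krun_eq_self hcx fun s => ?_
  rw [hK]
  cases h
  · have h₁ : (gadgetCX b f d).map (Op.conj .X) = gadgetCX b f d := List.map_id _
    rw [h₁]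
    have h₂ : ∀ s, (∀ i, s (f i) = 0) → Φ (prop (gadgetCX b f d) s) = Φ s := by
      intro s hs'
      have h₃ := hs s (prop (gadgetCX b f d) s + s)
        (fun i j => by
          rw [Pi.add_apply, gadgetCX_data G, hs' i, zero_add, ite_self]
          linear_combination zmod_two_add_self (s (d i j)))
        (fun q hq => by rw [Pi.add_apply, gadgetCX_of_ne G _ hq, zmod_two_add_self])
      rw [← h₃, add_comm, add_assoc, vec_add_self, add_zero]
    have h₄ : ∀ s, Φ s ≠ 0 → ∀ i, s (f i) = 0 := fun s hs i => by
      simpa using stab_Z_iff.1 (hf i) s hs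
    by_cases h₅ : Φ s = 0
    · by_contra h₆
      rw [h₅] at h₆
      have h₇ := h₄ _ h₆
      simp only [gadgetCX_of_ne G _ (G.f_ne_d _)] at h₇
      exact h₆ ((h₂ s h₇).trans h₅)
    · exact h₂ s (h₄ s h₅)
  · have h₁ : (gadgetCX b f d).map (Op.conj .Z) = (gadgetCX b f d).map Op.dual := rfl
    rw [h₁]
    obtain ⟨w, hw⟩ : ∃ w : Q → ZMod 2, w = fun q =>
      if ∃ i, q = f i then prop ((gadgetCX b f d).map Op.dual) s q + s q else 0 := ⟨_, rfl⟩
    have hw' : Stab .X w 0 Φ := by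
      refine Stab.of_support fun q hq => ?_
      have h₂ : ∃ i, q = f i := by
        by_contra h
        simp [hw, h] at hq
      obtain ⟨i, rfl⟩ := h₂
      exact hf i
    have h₃ := hs s (prop ((gadgetCX b f d).map Op.dual) s + s + w)
        (fun i => by
          have : ¬ ∃ i', b i = f i' := fun ⟨i', h⟩ => G.b_ne_f _ _ h
          simp only [hw, Pi.add_apply, this, if_false, gadgetCX_dual_anc G]
          linear_combination zmod_two_add_self (s (b i)))
        (fun q hq => by
          by_cases hqf : ∃ i, q = f i
          · simp only [hw, Pi.add_apply, hqf, if_true, zmod_two_add_self]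
          · simp only [hw, Pi.add_apply, hqf, if_false]
            push Not at hqf
            rw [gadgetCX_dual_of_ne G hq hqf, zmod_two_add_self, zero_add])
    rw [← h₃]
    have h₄ := stab_X_iff.1 hw' (prop ((gadgetCX b f d).map Op.dual) s)
    rw [sgn_zero, one_mul] at h₄
    rw [← h₄]
    congr 1
    linear_combination -vec_add_self s

/-- The list `K'` keeps the initialisations and measurements and drops the gates. Shift invariance
is needed after the initialisation of the flags; it is therefore required of every state that shares
those stabilizers of `Ψ` which avoid the flags. -/
theorem krun_gadget (G : Gadget b f d) {h : Half} {K : List (Op Q × ZMod 2)}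
    (hK : K.map Prod.fst = (gadget b f d).map (Op.conj h)) :
    ∃ K' : List (Op Q × ZMod 2),
      (∀ o ∈ K'.map Prod.fst, ∀ q, o.Acts q → (∃ i, q = b i) ∨ ∃ i, q = f i) ∧
      ∀ Ψ, (∀ Φ, (∀ t v, (∀ i, v (f i) = 0) → Stab t v 0 Ψ → Stab t v 0 Φ) → ShiftInv h b d Φ) →
        krun K Ψ = krun K' Ψ ∧ (∀ i, Stab h.swap (Pi.single (f i) 1) 0 (krun K Ψ)) ∧
        ∀ t v c, (∀ i, v (f i) = 0) → (t = h ∨ ∀ i, v (b i) = 0) → Stab t v c Ψ →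
          Stab t v c (krun K Ψ) := by
  rw [gadget, List.map_append, List.map_append] at hK
  obtain ⟨K₁₂, K₃, rfl, hK, hK₃⟩ := map_eq_append hK
  obtain ⟨K₁, K₂, rfl, hK₁, hK₂⟩ := map_eq_append hK
  have hP : ∀ o ∈ K₁.map Prod.fst, ∃ i, o = prepOf h.swap (f i) := by
    rw [hK₁]
    simp only [flagPrep, List.map_map, List.mem_map]
    rintro o ⟨i, -, rfl⟩
    exact ⟨i, prepOf_swap_eq h (f i)⟩
  have hM : ∀ o ∈ K₃.map Prod.fst, ∃ i, o = measOf h.swap (b i) ∨ o = measOf h (f i) := by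
    rw [hK₃]
    simp only [gadgetMeas, List.map_append, List.map_map, List.mem_append, List.mem_map]
    rintro o (⟨i, -, rfl⟩ | ⟨i, -, rfl⟩)
    · exact ⟨i, .inl (measOf_swap_eq h (b i))⟩
    · exact ⟨i, .inr (measOf_eq h (f i))⟩
  refine ⟨K₁ ++ K₃, ?_, fun Ψ hΨ => ?_⟩
  · intro o ho q hq
    rw [List.map_append, List.mem_append] at ho
    rcases ho with ho | ho
    · obtain ⟨i, rfl⟩ := hP o ho
      exact .inr ⟨i, prepOf_acts.1 hq⟩
    · obtain ⟨i, rfl | rfl⟩ := hM o ho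
      · exact .inl ⟨i, measOf_acts.1 hq⟩
      · exact .inr ⟨i, measOf_acts.1 hq⟩
  · have h₁ : ∀ t v c, (∀ i, v (f i) = 0) → Stab t v c Ψ → Stab t v c (krun K₁ Ψ) := by
      intro t v c hv hs
      refine hs.krun_of_not_acts fun o ho q hq => ?_
      obtain ⟨i, rfl⟩ := hP o ho
      rw [prepOf_acts.1 hq, hv]
    have h₂ : ∀ i, Stab h.swap (Pi.single (f i) 1) 0 (krun K₁ Ψ) := by
      intro i
      refine stab_of_prepOf_mem ?_ (fun o ho hq => ?_) Ψ
      · rw [hK₁, flagPrep, List.map_map, List.mem_map]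
        exact ⟨i, List.mem_finRange i, prepOf_swap_eq h (f i)⟩
      · obtain ⟨i', rfl⟩ := hP o ho
        rw [prepOf_acts.1 hq]
    have h₃ := krun_gadgetCX G hK₂ h₂ (hΨ _ fun t v hv => h₁ t v 0 hv)
    simp only [krun_append, h₃, true_and]
    constructor
    · intro i
      refine krun_inv (R := Stab h.swap (Pi.single (f i) 1) 0) (fun o ho c Φ hΦ => ?_) (h₂ i)
      obtain ⟨i', rfl | rfl⟩ := hM o ho
      · refine hΦ.kraus_of_not_acts (fun q hq => ?_) _
        rw [measOf_acts.1 hq]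
        exact Pi.single_eq_of_ne (G.b_ne_f _ _) _
      · simpa using hΦ.measOf (f i') c
    · intro t v c hv hb hs
      refine krun_inv (R := Stab t v c) (fun o ho c' Φ hΦ => ?_) (h₁ t v c hv hs)
      obtain ⟨i', rfl | rfl⟩ := hM o ho
      · rcases hb with rfl | hb
        · exact hΦ.measOf _ _
        · refine hΦ.kraus_of_not_acts (fun q hq => ?_) _
          rw [measOf_acts.1 hq, hb]
      · refine hΦ.kraus_of_not_acts (fun q hq => ?_) _
        rw [measOf_acts.1 hq, hv]

end

end ConcatIceberg

namespace ConcatIceberg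

/-! ### Preparation of the encoded block -/

theorem Stab.add_trans {Q : Type} [Fintype Q] {t : Half} {u v w : Q → ZMod 2} {Ψ : QState Q}
    (h : Stab t (u + v) 0 Ψ) (h' : Stab t (v + w) 0 Ψ) : Stab t (u + w) 0 Ψ := by
  have h₁ := h.add h'
  rwa [add_zero, add_assoc, ← add_assoc v, vec_add_self, zero_add] at h₁

theorem FaultOut.map {Q : Type} [DecidableEq Q] {α : Type*} {l : List α} {g : α → Op Q}
    {v : Q → ZMod 2} (hv : FaultOut (l.map g) v) :
    ∃ l₁ a l₂ u, l = l₁ ++ a :: l₂ ∧ (∀ q, ¬ (g a).Acts q → u q = 0) ∧ v = prop (l₂.map g) u := by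
  induction l with
  | nil => exact hv.elim
  | cons a l ih =>
    rcases hv with ⟨u, hu, rfl⟩ | hv
    · exact ⟨[], a, l, u, rfl, hu, rfl⟩
    · obtain ⟨l₁, a', l₂, u, rfl, hu, rfl⟩ := ih hv
      exact ⟨a :: l₁, a', l₂, u, rfl, hu, rfl⟩

variable {k₁ k₂ : ℕ}

/-- Indicator vector of the encoded block. -/
def blkVec (k₁ k₂ : ℕ) : Qubit k₁ k₂ → ZMod 2 :=
  Sum.elim 0 fun
    | .blk _ => 1
    | _ => 0

/-- The gate of the preparation tree which ends in node `i`. -/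
def treeOp (k₂ : ℕ) (i : Fin (k₁ + 2)) : Op (Qubit k₁ k₂) :=
  .cx (aq (.blk (parent i))) (aq (.blk i))

/-- Initialisation of the block. -/
def blkPrep (k₁ k₂ : ℕ) : List (Op (Qubit k₁ k₂)) :=
  .prepX (aq (.blk 0)) :: (List.finRange (k₁ + 2)).tail.map fun i => .prepZ (aq (.blk i))

/-- Verification of the block. -/
def blkCheck (k₁ k₂ : ℕ) : List (Op (Qubit k₁ k₂)) :=
  [.prepZ (aq .chk), .cx (aq (.blk ⟨k₁, by omega⟩)) (aq .chk),
    .cx (aq (.blk (Fin.last (k₁ + 1)))) (aq .chk), .measZ (aq .chk)]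

theorem zeroPrep_eq : zeroPrep k₁ k₂ =
    blkPrep k₁ k₂ ++ (List.finRange (k₁ + 2)).tail.map (treeOp k₂) ++ blkCheck k₁ k₂ := rfl

theorem aq_injective : Function.Injective (aq : Anc k₁ k₂ → Qubit k₁ k₂) := Sum.inr_injective

theorem blk_injective : Function.Injective fun i : Fin (k₁ + 2) => (aq (.blk i) : Qubit k₁ k₂) := by
  intro i j h
  simpa [aq] using h

theorem blk_eq_iff {i j : Fin (k₁ + 2)} :
    (aq (.blk i) : Qubit k₁ k₂) = aq (.blk j) ↔ i = j := blk_injective.eq_iff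

theorem parent_lt {i : Fin (k₁ + 2)} (hi : i ≠ 0) : parent i < i := by
  have h : i.val ≠ 0 := fun h => hi (Fin.ext h)
  simp only [parent, Fin.lt_def]
  omega

theorem pairwise_lt_finRange_tail (n : ℕ) : (List.finRange n).tail.Pairwise (· < ·) :=
  (List.pairwise_lt_finRange n).tail

theorem mem_finRange_tail {i : Fin (k₁ + 2)} : i ∈ (List.finRange (k₁ + 2)).tail ↔ i ≠ 0 := by
  rw [List.finRange_succ, List.tail_cons, List.mem_map]
  constructor
  · rintro ⟨j, -, rfl⟩
    exact Fin.succ_ne_zero j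
  · intro h
    exact ⟨i.pred h, List.mem_finRange _, Fin.succ_pred i h⟩

/-- The gates from the one at `i` onwards have targets at least `i`, hence beyond `parent i`. So the
control of that gate already has its final value. -/
theorem prop_tree {l : List (Fin (k₁ + 2))} (hl : l.Pairwise (· < ·)) (h₀ : ∀ i ∈ l, i ≠ 0)
    (u : Qubit k₁ k₂ → ZMod 2) :
    (∀ q, (∀ i ∈ l, q ≠ aq (.blk i)) → prop (l.map (treeOp k₂)) u q = u q) ∧
      ∀ i ∈ l, prop (l.map (treeOp k₂)) u (aq (.blk i)) =
        u (aq (.blk i)) + prop (l.map (treeOp k₂)) u (aq (.blk (parent i))) := by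
  induction l generalizing u with
  | nil => simp
  | cons a l ih =>
    rw [List.pairwise_cons] at hl
    obtain ⟨h₁, h₂⟩ := ih hl.2 (fun i hi => h₀ i (by simp [hi])) ((treeOp k₂ a).push u)
    have h₃ : ∀ q, q ≠ aq (.blk a) → (treeOp k₂ a).push u q = u q := by
      intro q hq
      simp [treeOp, Op.push, hq]
    rw [List.map_cons, prop_cons]
    refine ⟨fun q hq => ?_, fun i hi => ?_⟩
    · rw [h₁ q fun i hi => hq i (by simp [hi]), h₃ q (hq a (by simp))]
    · have ha := parent_lt (h₀ a (by simp))
      rcases List.mem_cons.1 hi with rfl | hi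
      · rw [h₁, h₁, h₃ (aq (.blk (parent i)))]
        · simp [treeOp, Op.push]
        · rw [Ne, blk_eq_iff]
          exact ha.ne
        · intro j hj
          rw [Ne, blk_eq_iff]
          exact (ha.trans (hl.1 j hj)).ne
        · intro j hj
          rw [Ne, blk_eq_iff]
          exact (hl.1 j hj).ne
      · rw [h₂ i hi, h₃]
        rw [Ne, blk_eq_iff]
        exact (hl.1 i hi).ne'

/-- Reversed gates copy from a node to its parent. Gates before that of `i` start from other nodes,
and gates after it start from nodes larger than both `i` and `parent i`; only one gate has an
effect. -/
theorem prop_tree_dual {l : List (Fin (k₁ + 2))} (hl : l.Pairwise (· < ·)) (h₀ : ∀ i ∈ l, i ≠ 0)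
    {i : Fin (k₁ + 2)} (hi : i ∈ l) :
    prop ((l.map (treeOp k₂)).map Op.dual) (Pi.single (aq (.blk i)) 1) =
      Pi.single (aq (.blk i)) 1 + Pi.single (aq (.blk (parent i))) 1 := by
  induction l with
  | nil => simp at hi
  | cons a l ih =>
    rw [List.pairwise_cons] at hl
    rw [List.map_cons, List.map_cons, prop_cons]
    rcases List.mem_cons.1 hi with rfl | hi
    · have h : (treeOp k₂ i).dual.push (Pi.single (aq (.blk i)) 1) =
          Pi.single (aq (.blk i)) 1 + Pi.single (aq (.blk (parent i))) 1 := by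
        simp [treeOp, Op.dual, Op.push]
      rw [h]
      refine prop_fixed fun o ho => ?_
      simp only [List.map_map, List.mem_map, Function.comp_apply] at ho
      obtain ⟨j, hj, rfl⟩ := ho
      have h₁ := hl.1 j hj
      have h₂ := parent_lt (h₀ i (by simp))
      simp only [treeOp, Op.dual, Op.push, Pi.add_apply]
      rw [Pi.single_eq_of_ne, Pi.single_eq_of_ne, add_zero, Pi.single_zero, add_zero]
      · rw [Ne, blk_eq_iff]
        exact (h₂.trans h₁).ne'
      · rw [Ne, blk_eq_iff]
        exact h₁.ne'
    · have h : (treeOp k₂ a).dual.push (Pi.single (aq (.blk i)) 1) = Pi.single (aq (.blk i)) 1 := by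
        simp only [treeOp, Op.dual, Op.push]
        rw [Pi.single_eq_of_ne, Pi.single_zero, add_zero]
        rw [Ne, blk_eq_iff]
        exact (hl.1 i hi).ne
      rw [h]
      exact ih hl.2 (fun j hj => h₀ j (by simp [hj])) hi

theorem prop_blkCheck_chk (u : Qubit k₁ k₂ → ZMod 2) :
    prop (blkCheck k₁ k₂) u (aq .chk) =
      u (aq (.blk ⟨k₁, by omega⟩)) + u (aq (.blk (Fin.last (k₁ + 1)))) := by
  simp [blkCheck, prop_cons, Op.push, aq, zmod_two_add_self]

theorem prop_blkCheck_of_ne {u : Qubit k₁ k₂ → ZMod 2} {q : Qubit k₁ k₂} (h : q ≠ aq .chk) :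
    prop (blkCheck k₁ k₂) u q = u q := by
  simp [blkCheck, prop_cons, Op.push, h]

/-- Values at the nodes of the preparation tree, when there is an error in node `m` only. -/
theorem tree_values {n m : ℕ} {g : ℕ → ZMod 2} {a : ZMod 2} (hm : 0 < m) (hg : g m = a)
    (h₀ : ∀ i < m, i + 2 ≠ m → g i = 0) (h₁ : ∀ i, m < i → i < n → g i = g (i - 2)) :
    ∀ i < n, i + 2 ≠ m → g i = if m ≤ i ∧ i % 2 = m % 2 then a else 0 := by
  intro i
  induction i using Nat.strong_induction_on with
  | _ i ih =>
    intro hi hi'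
    rcases lt_trichotomy i m with h | rfl | h
    · rw [h₀ i h hi', if_neg (by omega)]
    · simp [hg]
    · rw [h₁ i h hi]
      by_cases h2 : i = 1
      · omega
      · by_cases h3 : i - 2 + 2 = m
        · omega
        · rw [ih (i - 2) (by omega) (by omega) h3]
          by_cases h4 : i % 2 = m % 2
          · rw [if_pos (by omega), if_pos (by omega)]
          · rw [if_neg (by omega), if_neg (by omega)]

/-- The terminal nodes `k` and `k + 1` lie on branches of different parity. The error of node `m`
runs down its branch and reaches exactly one of them, so the verification forces `g m = 0`. The node
`m - 2` is exempted because its own error need not vanish. -/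
theorem tree_values_check {k m : ℕ} (hk : Even k) {g : ℕ → ZMod 2} (hm : 0 < m) (hm' : m < k + 2)
    (h₀ : ∀ i < m, i + 2 ≠ m → g i = 0) (h₁ : ∀ i, m < i → i < k + 2 → g i = g (i - 2))
    (hc : g k + g (k + 1) = 0) : ∀ i < k + 2, i + 2 ≠ m → g i = 0 := by
  have h := tree_values (n := k + 2) hm rfl h₀ h₁
  have hk' : k % 2 = 0 := Nat.even_iff.1 hk
  have hm₀ : g m = 0 := by
    rw [h k (by omega) (by omega), h (k + 1) (by omega) (by omega)] at hc
    rcases Nat.mod_two_eq_zero_or_one m with h' | h'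
    · rw [if_pos (by omega), if_neg (by omega), add_zero] at hc
      exact hc
    · rw [if_neg (by omega), if_pos (by omega), zero_add] at hc
      exact hc
  intro i hi hi'
  rw [h i hi hi', hm₀, ite_self]

theorem faultOut_anc {C : List (Op (Qubit k₁ k₂))} (hC : ∀ o ∈ C, ∀ q, o.Acts q → ∃ a, q = aq a)
    {v : Qubit k₁ k₂ → ZMod 2} (hv : FaultOut C v) (i : Fin (k₁ + 2)) (j : Fin (k₂ + 2)) :
    v (dq i j) = 0 := by
  have hd : ∀ o ∈ C, ∀ i j, ¬ o.Acts (dq i j) := by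
    intro o ho i j h
    obtain ⟨a, ha⟩ := hC o ho _ h
    simp [dq, aq] at ha
  obtain ⟨-, h⟩ := hv.exists_inv (fun (_ : Unit) u => ∀ i j, u (dq i j) = 0)
    (fun o ho u hu => ⟨(), fun i j => hu _ (hd o ho i j)⟩)
    (fun o ho _ u hu i j => by rw [Op.push_of_not_acts _ _ (hd o ho i j), hu i j])
  exact h i j

theorem zeroPrep_acts : ∀ o ∈ zeroPrep k₁ k₂, ∀ q, o.Acts q → ∃ a, q = aq a := by
  intro o ho q hq
  simp only [zeroPrep_eq, blkPrep, treeOp, blkCheck, List.mem_append, List.mem_cons, List.mem_map,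
    List.not_mem_nil, or_false] at ho
  rcases ho with ((rfl | ⟨i, -, rfl⟩) | ⟨i, -, rfl⟩) | rfl | rfl | rfl | rfl <;>
    simp only [Op.Acts] at hq <;>
    first
      | exact ⟨_, hq⟩
      | (rcases hq with hq | hq <;> exact ⟨_, hq⟩)

/-- A fault in the preparation of the block which is not detected by the verification is equivalent
to a fault of at most one qubit. -/
theorem faultOut_zeroPrep (hk : Even k₁) {v : Qubit k₁ k₂ → ZMod 2}
    (hv : FaultOut (zeroPrep k₁ k₂) v) (hc : v (aq .chk) = 0) :
    ∃ c i, ∀ i', i' ≠ i → v (aq (.blk i')) = c := by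
  simp only [zeroPrep_eq, faultOut_append] at hv
  have hpar : ∀ {i : ℕ} (hi : i < k₁ + 2), parent (⟨i, hi⟩ : Fin (k₁ + 2)) = ⟨i - 2, by omega⟩ :=
    fun hi => rfl
  rcases hv with ⟨u, ⟨w, hw, rfl⟩ | hu, rfl⟩ | hv
  · obtain ⟨m, hm⟩ := hw.exists_inv (fun (m : Fin (k₁ + 2)) u => ∀ q, q ≠ aq (.blk m) → u q = 0)
      (by
        simp only [blkPrep, List.mem_cons, List.mem_map]
        rintro o (rfl | ⟨i, -, rfl⟩) u hu
        · exact ⟨0, hu⟩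
        · exact ⟨i, hu⟩)
      (by
        simp only [blkPrep, List.mem_cons, List.mem_map]
        rintro o (rfl | ⟨i, -, rfl⟩) m u hu q hq
        · by_cases h : q = aq (.blk 0)
          · subst h; simp [Op.push, hu _ hq]
          · simp [Op.push, h, hu _ hq]
        · by_cases h : q = aq (.blk i)
          · subst h; simp [Op.push, hu _ hq]
          · simp [Op.push, h, hu _ hq])
    rw [prop_blkCheck_chk] at hc
    simp only [prop_blkCheck_of_ne (aq_injective.ne (by simp) : aq (.blk _) ≠ aq .chk)]
    obtain ⟨h₁, h₂⟩ := prop_tree (pairwise_lt_finRange_tail (k₁ + 2))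
      (fun i hi => mem_finRange_tail.1 hi) w
    set y := prop ((List.finRange (k₁ + 2)).tail.map (treeOp k₂)) w with hy
    have hy₀ : y (aq (.blk 0)) = w (aq (.blk 0)) := h₁ _ fun i hi => by
      rw [Ne, blk_eq_iff]
      exact (mem_finRange_tail.1 hi).symm
    -- An error of the root is copied to the whole block and is a common flip. An error of any other
    -- node runs to the end of its branch and would be detected.
    by_cases hm₀ : m = 0
    · subst hm₀
      have h : ∀ n (hn : n < k₁ + 2), y (aq (.blk ⟨n, hn⟩)) = w (aq (.blk 0)) := by
        intro n
        induction n using Nat.strong_induction_on with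
        | _ n ih =>
          intro hn
          by_cases hn₀ : n = 0
          · subst hn₀
            exact hy₀
          · have h0 : (⟨n, hn⟩ : Fin (k₁ + 2)) ≠ 0 := fun h => hn₀ (congrArg Fin.val h)
            rw [h₂ _ (mem_finRange_tail.2 h0), hm _ (by rwa [Ne, blk_eq_iff]), hpar,
              ih (n - 2) (by omega), zero_add]
      exact ⟨_, 0, fun i _ => h i.val i.isLt⟩
    · have hm₁ : 0 < m.val := Nat.pos_of_ne_zero fun h => hm₀ (Fin.ext h)
      have hlt : ∀ n (hn : n < k₁ + 2), n < m.val → y (aq (.blk ⟨n, hn⟩)) = 0 := by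
        intro n
        induction n using Nat.strong_induction_on with
        | _ n ih =>
          intro hn hnm
          have hne : (⟨n, hn⟩ : Fin (k₁ + 2)) ≠ m := fun h => hnm.ne (congrArg Fin.val h)
          by_cases hn₀ : n = 0
          · subst hn₀
            exact hy₀.trans (hm _ (by rwa [Ne, blk_eq_iff]))
          · have h0 : (⟨n, hn⟩ : Fin (k₁ + 2)) ≠ 0 := fun h => hn₀ (congrArg Fin.val h)
            rw [h₂ _ (mem_finRange_tail.2 h0), hm _ (by rwa [Ne, blk_eq_iff]), hpar,
              ih (n - 2) (by omega) _ (by omega), zero_add]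
      have h := tree_values_check hk (g := fun n => if h : n < k₁ + 2 then y (aq (.blk ⟨n, h⟩)) else 0)
        hm₁ m.isLt
        (fun i hi _ => by
          have hi' : i < k₁ + 2 := hi.trans m.isLt
          simp only [hi', dif_pos, hlt i hi' hi])
        (fun i hi hi' => by
          have h0 : (⟨i, hi'⟩ : Fin (k₁ + 2)) ≠ 0 := fun h => by
            have := congrArg Fin.val h
            simp at this
            omega
          have hne : (⟨i, hi'⟩ : Fin (k₁ + 2)) ≠ m := fun h => hi.ne' (congrArg Fin.val h)
          have hi'' : i - 2 < k₁ + 2 := by omega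
          simp only [hi', hi'', dif_pos]
          rw [h₂ _ (mem_finRange_tail.2 h0), hm _ (by rwa [Ne, blk_eq_iff]), zero_add]
          rfl)
        (by
          simp only [Nat.zero_lt_two, Nat.lt_succ_self, dif_pos,
            Nat.lt_add_of_pos_right]
          exact hc)
      refine ⟨0, 0, fun i _ => ?_⟩
      by_cases hi : i.val < m.val
      · exact hlt i.val i.isLt hi
      · simpa using h i.val i.isLt (by omega)
  · obtain ⟨l₁, m, l₂, w, hl, hw, rfl⟩ := hu.map
    rw [prop_blkCheck_chk] at hc
    simp only [prop_blkCheck_of_ne (aq_injective.ne (by simp) : aq (.blk _) ≠ aq .chk)]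
    have hs := pairwise_lt_finRange_tail (k₁ + 2)
    rw [hl, List.pairwise_append, List.pairwise_cons] at hs
    obtain ⟨-, ⟨hs₂, hs₃⟩, hs₁⟩ := hs
    have hm₀ : m ≠ 0 := mem_finRange_tail.1 (by rw [hl]; simp)
    have hm₁ : 0 < m.val := Nat.pos_of_ne_zero fun h => hm₀ (Fin.ext h)
    have hmem : ∀ i, i ∈ l₂ ↔ m < i := by
      refine fun i => ⟨hs₂ i, fun hi => ?_⟩
      have hi' : i ∈ (List.finRange (k₁ + 2)).tail :=
        mem_finRange_tail.2 fun h => by simp [h] at hi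
      rw [hl, List.mem_append, List.mem_cons] at hi'
      rcases hi' with h | h | h
      · exact absurd (hs₁ i h m (by simp)) (not_lt.2 hi.le)
      · exact absurd h hi.ne'
      · exact h
    obtain ⟨h₁, h₂⟩ := prop_tree (k₂ := k₂) hs₃ (fun i hi h => by
      rw [hmem, h] at hi
      simp at hi) w
    set y := prop (l₂.map (treeOp k₂)) w with hy
    have hy₁ : ∀ i, i ≤ m → y (aq (.blk i)) = w (aq (.blk i)) := fun i hi => h₁ _ fun j hj => by
      rw [Ne, blk_eq_iff]
      exact (lt_of_le_of_lt hi ((hmem j).1 hj)).ne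
    have hw' : ∀ i, i ≠ m → i ≠ parent m → w (aq (.blk i)) = 0 := fun i hi hi' =>
      hw _ (by simp only [treeOp, Op.Acts, blk_eq_iff, not_or]; exact ⟨hi', hi⟩)
    have hy₂ : ∀ i (hi : i < k₁ + 2), m.val < i →
        y (aq (.blk ⟨i, hi⟩)) = y (aq (.blk ⟨i - 2, by omega⟩)) := fun i hi hi' => by
      have hlt : m < ⟨i, hi⟩ := hi'
      have hpm := parent_lt hm₀
      rw [h₂ _ ((hmem _).2 hlt), hw' _ hlt.ne' (hpm.trans hlt).ne', zero_add]
      rfl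
    -- For `m = 1` the parent is the root, which has yet to serve the other branch. Both components
    -- of the fault spread, one along each branch, and the verification makes them equal.
    by_cases hm₂ : m.val = 1
    · have h0 : (0 : Fin (k₁ + 2)) ≤ m := Fin.zero_le m
      have h : ∀ n (hn : n < k₁ + 2), y (aq (.blk ⟨n, hn⟩)) =
          if n % 2 = 0 then w (aq (.blk 0)) else w (aq (.blk m)) := by
        intro n
        induction n using Nat.strong_induction_on with
        | _ n ih =>
          intro hn
          by_cases hn₀ : n = 0
          · subst hn₀
            exact hy₁ 0 h0
          · by_cases hn₁ : n = 1
            · have : (⟨n, hn⟩ : Fin (k₁ + 2)) = m := Fin.ext (hn₁.trans hm₂.symm)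
              rw [this, hy₁ m le_rfl, if_neg (by omega)]
            · rw [hy₂ n hn (by omega), ih (n - 2) (by omega)]
              have : (n - 2) % 2 = n % 2 := by omega
              rw [this]
      have hk' : k₁ % 2 = 0 := Nat.even_iff.1 hk
      rw [h, if_pos hk', Fin.last, h, if_neg (by omega)] at hc
      refine ⟨w (aq (.blk 0)), 0, fun i _ => ?_⟩
      rw [h i.val i.isLt, CharTwo.add_eq_zero.1 hc, ite_self]
    · have h := tree_values_check hk (g := fun n => if h : n < k₁ + 2 then y (aq (.blk ⟨n, h⟩)) else 0)
        hm₁ m.isLt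
        (fun i hi hi2 => by
          have hi' : i < k₁ + 2 := hi.trans m.isLt
          simp only [hi', dif_pos]
          rw [hy₁ _ (Fin.le_def.2 hi.le), hw']
          · exact fun h => hi.ne (congrArg Fin.val h)
          · intro h
            have := congrArg Fin.val h
            simp only [parent] at this
            omega)
        (fun i hi hi' => by
          have hi'' : i - 2 < k₁ + 2 := by omega
          simp only [hi', hi'', dif_pos]
          exact hy₂ i hi' hi)
        (by
          simp only [Nat.zero_lt_two, Nat.lt_succ_self, dif_pos,
            Nat.lt_add_of_pos_right]
          exact hc)
      -- For `m ≥ 2` no later gate is controlled by `parent m`, so its error stays where it is.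
      refine ⟨0, parent m, fun i hi => ?_⟩
      have hi' : i.val + 2 ≠ m.val := fun h => hi (Fin.ext (by simp only [parent]; omega))
      simpa using h i.val i.isLt hi'
  · obtain ⟨m, hm⟩ := hv.exists_inv
      (fun (m : Fin (k₁ + 2)) u => ∀ q, q ≠ aq (.blk m) → q ≠ aq .chk → u q = 0)
      (by
        simp only [blkCheck, List.mem_cons, List.not_mem_nil, or_false]
        rintro o (rfl | rfl | rfl | rfl) u hu
        · exact ⟨0, fun q _ h => hu q h⟩
        · exact ⟨_, fun q h h' => hu q (not_or.2 ⟨h, h'⟩)⟩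
        · exact ⟨_, fun q h h' => hu q (not_or.2 ⟨h, h'⟩)⟩
        · exact ⟨0, fun q _ h => hu q h⟩)
      (by
        simp only [blkCheck, List.mem_cons, List.not_mem_nil, or_false]
        rintro o (rfl | rfl | rfl | rfl) m u hu q hq hq' <;> simp [Op.push, hq', hu q hq hq'])
    exact ⟨0, m, fun i hi => hm _ (by rwa [Ne, blk_eq_iff]) (aq_injective.ne (by simp))⟩

/-! ### Stabilizers of the faultlessly prepared block. -/

theorem krun_blkPrep {h : Half} {K : List (Op (Qubit k₁ k₂) × ZMod 2)}
    (hK : K.map Prod.fst = (blkPrep k₁ k₂).map (Op.conj h.swap)) (Ψ : QState (Qubit k₁ k₂)) :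
    Stab h.swap (Pi.single (aq (.blk 0)) 1) 0 (krun K Ψ) ∧
      ∀ i ≠ 0, Stab h (Pi.single (aq (.blk i)) 1) 0 (krun K Ψ) := by
  have hmem : ∀ o, o ∈ K.map Prod.fst ↔ o = prepOf h.swap (aq (.blk 0)) ∨
      ∃ i ≠ 0, o = prepOf h (aq (.blk i)) := by
    intro o
    simp only [hK, blkPrep, List.map_cons, List.map_map, List.mem_cons, List.mem_map,
      Function.comp_apply, prepOf_eq, prepOf_swap_eq, Half.swap_swap, mem_finRange_tail, eq_comm]
  constructor
  · refine stab_of_prepOf_mem ((hmem _).2 (.inl rfl)) (fun o ho hq => ?_) Ψ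
    rcases (hmem o).1 ho with rfl | ⟨i, hi, rfl⟩
    · rfl
    · rw [prepOf_acts, blk_eq_iff] at hq
      exact absurd hq.symm hi
  · intro i hi
    refine stab_of_prepOf_mem ((hmem _).2 (.inr ⟨i, hi, rfl⟩)) (fun o ho hq => ?_) Ψ
    rcases (hmem o).1 ho with rfl | ⟨j, hj, rfl⟩
    · rw [prepOf_acts, blk_eq_iff] at hq
      exact absurd hq hi
    · rw [prepOf_acts, blk_eq_iff] at hq
      rw [hq]

theorem prop_tree_root : prop ((List.finRange (k₁ + 2)).tail.map (treeOp k₂))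
    (Pi.single (aq (.blk 0)) 1) = blkVec k₁ k₂ := by
  obtain ⟨h₁, h₂⟩ := prop_tree (k₂ := k₂) (pairwise_lt_finRange_tail (k₁ + 2))
    (fun i hi => mem_finRange_tail.1 hi) (Pi.single (aq (.blk 0)) 1)
  have hb : ∀ n (hn : n < k₁ + 2), prop ((List.finRange (k₁ + 2)).tail.map (treeOp k₂))
      (Pi.single (aq (.blk 0)) 1) (aq (.blk ⟨n, hn⟩)) = 1 := by
    intro n
    induction n using Nat.strong_induction_on with
    | _ n ih =>
      intro hn
      by_cases hn₀ : n = 0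
      · subst hn₀
        refine (h₁ (aq (.blk 0)) fun i hi => ?_).trans (Pi.single_eq_same _ _)
        rw [Ne, blk_eq_iff]
        exact (mem_finRange_tail.1 hi).symm
      · have h0 : (⟨n, hn⟩ : Fin (k₁ + 2)) ≠ 0 := fun h => hn₀ (congrArg Fin.val h)
        rw [h₂ _ (mem_finRange_tail.2 h0), Pi.single_eq_of_ne (by rwa [Ne, blk_eq_iff]), zero_add]
        exact ih (n - 2) (by omega) _
  ext q
  by_cases hq : ∃ i, q = aq (.blk i)
  · obtain ⟨i, rfl⟩ := hq
    exact hb i.val i.isLt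
  · push Not at hq
    rw [h₁ q fun i _ => hq i, Pi.single_eq_of_ne (hq 0)]
    rcases q with q | q | q | q | q | q
    · rfl
    · exact absurd rfl (hq q)
    all_goals rfl

/-- The encoded block after a faultless preparation. -/
theorem krun_prep {h : Half} {K : List (Op (Qubit k₁ k₂) × ZMod 2)}
    (hK : K.map Prod.fst = (zeroPrep k₁ k₂).map (Op.conj h.swap)) (Ψ : QState (Qubit k₁ k₂)) :
    Stab h.swap (blkVec k₁ k₂) 0 (krun K Ψ) ∧
      (∀ i i', Stab h (Pi.single (aq (.blk i)) 1 + Pi.single (aq (.blk i')) 1) 0 (krun K Ψ)) ∧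
      Stab h (Pi.single (aq .chk) 1) 0 (krun K Ψ) := by
  rw [zeroPrep_eq, List.map_append, List.map_append] at hK
  obtain ⟨K₁₂, K₃, rfl, hK, hK₃⟩ := map_eq_append hK
  obtain ⟨K₁, K₂, rfl, hK₁, hK₂⟩ := map_eq_append hK
  obtain ⟨h₁, h₂⟩ := krun_blkPrep hK₁ Ψ
  have hcx : ∀ o ∈ K₂.map Prod.fst, o.IsCX := by
    rw [hK₂]
    intro o ho
    simp only [List.map_map, List.mem_map, Function.comp_apply] at ho
    obtain ⟨i, hi, rfl⟩ := ho
    rw [Op.isCX_conj]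
    change aq (.blk (parent i)) ≠ aq (.blk i)
    rw [Ne, blk_eq_iff]
    exact (parent_lt (mem_finRange_tail.1 hi)).ne
  -- The stabilizer of the root grows to the whole block; those of the other nodes become pairs of a
  -- node and its parent, which telescope to arbitrary pairs.
  have h₃ := h₁.krun_cx hcx
  rw [hK₂, map_conj_conj_self, prop_tree_root] at h₃
  have h₄ : ∀ i ≠ 0, Stab h (Pi.single (aq (.blk i)) 1 + Pi.single (aq (.blk (parent i))) 1) 0
      (krun K₂ (krun K₁ Ψ)) := by
    intro i hi
    have h := (h₂ i hi).krun_cx hcx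
    rwa [hK₂, map_conj_swap_conj, prop_tree_dual (pairwise_lt_finRange_tail (k₁ + 2))
      (fun i hi => mem_finRange_tail.1 hi) (mem_finRange_tail.2 hi)] at h
  have h₅ : ∀ i i', Stab h (Pi.single (aq (.blk i)) 1 + Pi.single (aq (.blk i')) 1) 0
      (krun K₂ (krun K₁ Ψ)) := by
    have h₅ : ∀ n (hn : n < k₁ + 2), Stab h (Pi.single (aq (.blk ⟨n, hn⟩)) 1 +
        Pi.single (aq (.blk 0)) 1) 0 (krun K₂ (krun K₁ Ψ)) := by
      intro n
      induction n using Nat.strong_induction_on with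
      | _ n ih =>
        intro hn
        by_cases hn₀ : n = 0
        · subst hn₀
          have := Stab.zero h (krun K₂ (krun K₁ Ψ))
          rwa [← vec_add_self (Pi.single (aq (.blk 0)) 1)] at this
        · have h0 : (⟨n, hn⟩ : Fin (k₁ + 2)) ≠ 0 := fun h => hn₀ (congrArg Fin.val h)
          exact (h₄ _ h0).add_trans (ih (n - 2) (by omega) (by omega))
    intro i i'
    refine (h₅ i.val i.isLt).add_trans ?_
    rw [add_comm (Pi.single _ _)]
    exact h₅ i'.val i'.isLt
  rw [krun_append, krun_append]
  generalize krun K₂ (krun K₁ Ψ) = Φ at *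
  simp only [blkCheck, List.map_cons, List.map_nil, List.map_eq_cons_iff, List.map_eq_nil_iff,
    prepOf_swap_eq, Half.swap_swap, measOf_eq] at hK₃
  obtain ⟨⟨o₁, b₁⟩, _, rfl, ho₁, ⟨o₂, b₂⟩, _, rfl, ho₂, ⟨o₃, b₃⟩, _, rfl, ho₃, ⟨o₄, b₄⟩, _, rfl,
    ho₄, rfl⟩ := hK₃
  dsimp only at ho₁ ho₂ ho₃ ho₄
  have hne : ∀ i, (aq (.blk i) : Qubit k₁ k₂) ≠ aq .chk := fun i => aq_injective.ne (by simp)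
  have hc₁ : ∀ t v, v (aq .chk) = 0 → Stab t v 0 Φ → Stab t v 0 (o₁.kraus b₁ Φ) := by
    intro t v hv hs
    refine hs.kraus_of_not_acts (fun q hq => ?_) _
    rw [ho₁, prepOf_acts] at hq
    rw [hq, hv]
  have hc₂ : Stab h (Pi.single (aq .chk) 1) 0 (o₁.kraus b₁ Φ) := by
    rw [ho₁]
    exact stab_prepOf _ _ _ _
  have hcx' : ∀ o ∈ [(o₂, b₂), (o₃, b₃)].map Prod.fst, o.IsCX := by
    simp only [List.map_cons, List.map_nil, List.mem_cons, List.not_mem_nil, or_false, ho₂, ho₃]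
    rintro o (rfl | rfl) <;> rw [Op.isCX_conj] <;> exact hne _
  have hd : ([(o₂, b₂), (o₃, b₃)].map Prod.fst).map (Op.conj h) =
      [.cx (aq .chk) (aq (.blk ⟨k₁, by omega⟩)), .cx (aq .chk) (aq (.blk (Fin.last (k₁ + 1))))] := by
    simp [ho₂, ho₃, Op.conj_swap_conj, Op.dual]
  have hd' : ([(o₂, b₂), (o₃, b₃)].map Prod.fst).map (Op.conj h.swap) =
      [.cx (aq (.blk ⟨k₁, by omega⟩)) (aq .chk), .cx (aq (.blk (Fin.last (k₁ + 1)))) (aq .chk)] := by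
    simp [ho₂, ho₃, Op.conj_conj_self]
  have hs₁ := (hc₁ _ _ rfl h₃).krun_cx hcx'
  have hs₂ := fun i i' => (hc₁ _ _ (by simp [(hne _).symm]) (h₅ i i')).krun_cx hcx'
  have hs₃ := hc₂.krun_cx hcx'
  have hp₁ : prop [.cx (aq (.blk ⟨k₁, by omega⟩)) (aq .chk),
      .cx (aq (.blk (Fin.last (k₁ + 1)))) (aq .chk)] (blkVec k₁ k₂) = blkVec k₁ k₂ := by
    ext q
    simp only [prop_cons, prop_nil, Op.push, Pi.add_apply, Pi.single_eq_of_ne (hne _), add_zero]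
    have h₁ : ∀ i, blkVec k₁ k₂ (aq (.blk i)) = 1 := fun i => rfl
    rw [h₁, h₁, add_assoc, zmod_two_add_self, add_zero]
  have hp₂ : ∀ i i', prop [.cx (aq .chk) (aq (.blk ⟨k₁, by omega⟩)),
      .cx (aq .chk) (aq (.blk (Fin.last (k₁ + 1))))]
      (Pi.single (aq (.blk i)) 1 + Pi.single (aq (.blk i')) 1 : Qubit k₁ k₂ → ZMod 2) =
      Pi.single (aq (.blk i)) 1 + Pi.single (aq (.blk i')) 1 := by
    intro i i'
    simp only [prop_cons, prop_nil, Op.push, Pi.add_apply, Pi.single_eq_of_ne (hne _).symm,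
      Pi.single_zero, add_zero]
  have hp₃ : prop [.cx (aq .chk) (aq (.blk ⟨k₁, by omega⟩)),
      .cx (aq .chk) (aq (.blk (Fin.last (k₁ + 1))))] (Pi.single (aq .chk) 1 : Qubit k₁ k₂ → ZMod 2) =
      Pi.single (aq .chk) 1 + (Pi.single (aq (.blk ⟨k₁, by omega⟩)) 1 +
        Pi.single (aq (.blk (Fin.last (k₁ + 1)))) 1) := by
    simp only [prop_cons, prop_nil, Op.push, Pi.add_apply, Pi.single_eq_same,
      Pi.single_eq_of_ne (hne _).symm, add_zero, add_assoc]
  rw [hd', hp₁] at hs₁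
  simp only [hd, hp₂] at hs₂
  rw [hd, hp₃] at hs₃
  -- The stabilizer of the verification qubit has picked up the pair of terminal nodes, itself a
  -- stabilizer. Without faults the verification thus succeeds with certainty.
  have hs₄ : Stab h (Pi.single (aq .chk) 1) 0 (krun [(o₂, b₂), (o₃, b₃)] (o₁.kraus b₁ Φ)) := by
    have h₁ := hs₃.add (hs₂ ⟨k₁, by omega⟩ (Fin.last (k₁ + 1)))
    rwa [add_zero, add_assoc, vec_add_self, add_zero] at h₁
  change Stab _ _ _ (o₄.kraus b₄ (krun [(o₂, b₂), (o₃, b₃)] (o₁.kraus b₁ Φ))) ∧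
    (∀ i i', Stab _ _ _ (o₄.kraus b₄ (krun [(o₂, b₂), (o₃, b₃)] (o₁.kraus b₁ Φ)))) ∧
    Stab _ _ _ (o₄.kraus b₄ (krun [(o₂, b₂), (o₃, b₃)] (o₁.kraus b₁ Φ)))
  rw [ho₄]
  refine ⟨hs₁.kraus_of_not_acts (fun q hq => ?_) _, fun i i' => (hs₂ i i').measOf _ _,
    hs₄.measOf _ _⟩
  rw [measOf_acts.1 hq]
  rfl

end ConcatIceberg

namespace ConcatIceberg

/-! ### The circuit of half a cycle -/

section

variable {Q : Type}

theorem WellFormed.append {C D : List (Op Q)} (hC : WellFormed C) (hD : WellFormed D)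
    (h : ∀ o ∈ C, ∀ q, o.Measures q → ∀ o' ∈ D, ¬ o'.Acts q) : WellFormed (C ++ D) := by
  refine ⟨fun o ho => ?_, List.pairwise_append.2 ⟨hC.2, hD.2, fun o ho o' ho' q hq =>
    h o ho q hq o' ho'⟩⟩
  rcases List.mem_append.1 ho with ho | ho
  · exact hC.1 o ho
  · exact hD.1 o ho

theorem wellFormed_of_not_measures {C : List (Op Q)} (hC : ∀ o ∈ C, o.Valid)
    (h : ∀ o ∈ C, ∀ q, ¬ o.Measures q) : WellFormed C :=
  ⟨hC, List.pairwise_of_forall_mem_list fun o ho _ _ q hq => absurd hq (h o ho q)⟩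

variable {N n : ℕ} {b f : Fin N → Q} {d : Fin N → Fin n → Q}

theorem gadget_acts {o : Op Q} (ho : o ∈ gadget b f d) {q : Q} (hq : o.Acts q) :
    ∃ i, q = b i ∨ q = f i ∨ ∃ j, q = d i j := by
  simp only [gadget, flagPrep, gadgetCX, flagCX, dataCX, gadgetMeas, List.mem_map,
    List.mem_append, List.mem_flatMap] at ho
  rcases ho with (⟨i, -, rfl⟩ | (⟨i, -, rfl⟩ | ⟨j, -, i, -, rfl⟩) | ⟨i, -, rfl⟩) |
      ⟨i, -, rfl⟩ | ⟨i, -, rfl⟩ <;> refine ⟨i, ?_⟩ <;> simp only [Op.Acts] at hq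
  · exact .inr (.inl hq)
  · exact hq.imp_right .inl
  · rcases hq with hq | hq
    · split_ifs at hq
      · exact .inl hq
      · exact .inr (.inl hq)
    · exact .inr (.inr ⟨j, hq⟩)
  · exact hq.imp_right .inl
  · exact .inl hq
  · exact .inr (.inl hq)

theorem gadget_measures {o : Op Q} (ho : o ∈ gadget b f d) {q : Q} (hq : o.Measures q) :
    ∃ i, q = b i ∨ q = f i := by
  simp only [gadget, flagPrep, gadgetCX, flagCX, dataCX, gadgetMeas, List.mem_map,
    List.mem_append, List.mem_flatMap] at ho
  rcases ho with (⟨i, -, rfl⟩ | (⟨i, -, rfl⟩ | ⟨j, -, i, -, rfl⟩) | ⟨i, -, rfl⟩) |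
      ⟨i, -, rfl⟩ | ⟨i, -, rfl⟩
  · exact hq.elim
  · exact hq.elim
  · exact hq.elim
  · exact hq.elim
  · exact ⟨i, .inl hq⟩
  · exact ⟨i, .inr hq⟩

theorem Gadget.wellFormed (G : Gadget b f d) : WellFormed (gadget b f d) := by
  refine WellFormed.append (wellFormed_of_not_measures ?_ ?_) (WellFormed.append ⟨?_, ?_⟩ ⟨?_, ?_⟩ ?_) ?_
  · simp only [flagPrep, gadgetCX, flagCX, dataCX, List.mem_map, List.mem_append, List.mem_flatMap]
    rintro o (⟨i, -, rfl⟩ | (⟨i, -, rfl⟩ | ⟨j, -, i, -, rfl⟩) | ⟨i, -, rfl⟩)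
    · trivial
    · exact G.b_ne_f _ _
    · change (if Even j.val then b i else f i) ≠ d i j
      split_ifs
      · exact G.b_ne_d _ _ _
      · exact G.f_ne_d _ _ _
    · exact G.b_ne_f _ _
  · simp only [flagPrep, gadgetCX, flagCX, dataCX, List.mem_map, List.mem_append, List.mem_flatMap]
    rintro o (⟨i, -, rfl⟩ | (⟨i, -, rfl⟩ | ⟨j, -, i, -, rfl⟩) | ⟨i, -, rfl⟩) q <;> exact id
  · simp only [List.mem_map]
    rintro o ⟨i, -, rfl⟩
    trivial
  · rw [List.pairwise_map]
    refine (List.nodup_finRange N).imp fun {i i'} h q hq hq' => h (G.b_inj ?_)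
    exact hq.symm.trans hq'
  · simp only [List.mem_map]
    rintro o ⟨i, -, rfl⟩
    trivial
  · rw [List.pairwise_map]
    refine (List.nodup_finRange N).imp fun {i i'} h q hq hq' => h (G.f_inj ?_)
    exact hq.symm.trans hq'
  · simp only [List.mem_map]
    rintro o ⟨i, -, rfl⟩ q hq o' ⟨i', -, rfl⟩ hq'
    exact G.b_ne_f _ _ (hq.symm.trans hq')
  · simp only [flagPrep, gadgetCX, flagCX, dataCX, List.mem_map, List.mem_append, List.mem_flatMap]
    rintro o (⟨i, -, rfl⟩ | (⟨i, -, rfl⟩ | ⟨j, -, i, -, rfl⟩) | ⟨i, -, rfl⟩) q hq <;> exact hq.elim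

end

variable {k₁ k₂ : ℕ}

theorem gadget_high : Gadget (fun i => aq (.blk i)) (fun i => aq (.flg i))
    (dq : Fin (k₁ + 2) → Fin (k₂ + 2) → Qubit k₁ k₂) where
  b_inj := blk_injective
  f_inj i j h := by simpa [aq] using h
  d_inj i j i' j' h := by simpa [dq] using h
  b_ne_f i i' := by simp [aq]
  b_ne_d i i' j := by simp [aq, dq]
  f_ne_d i i' j := by simp [aq, dq]

theorem gadget_low (j : Fin (k₂ + 2)) : Gadget (N := 1) (fun _ => aq (.low j))
    (fun _ => aq (.lowFlg j)) (fun _ i => (dq i j : Qubit k₁ k₂)) where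
  b_inj i j h := Subsingleton.elim _ _
  f_inj i j h := Subsingleton.elim _ _
  d_inj i j i' j' h := ⟨Subsingleton.elim _ _, by simpa [dq] using h⟩
  b_ne_f i i' := by simp [aq]
  b_ne_d i i' j := by simp [aq, dq]
  f_ne_d i i' j := by simp [aq, dq]

theorem highExtraction_eq : highExtraction k₁ k₂ =
    gadget (fun i => aq (.blk i)) (fun i => aq (.flg i)) dq := by
  simp [highExtraction, gadget, flagPrep, gadgetCX, flagCX, dataCX, gadgetMeas, apply_ite aq]

theorem lowExtraction_eq (j : Fin (k₂ + 2)) : lowExtraction k₁ k₂ j =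
    .prepX (aq (.low j)) :: gadget (N := 1) (fun _ => aq (.low j)) (fun _ => aq (.lowFlg j))
      (fun _ i => dq i j) := by
  simp [lowExtraction, gadget, flagPrep, gadgetCX, flagCX, dataCX, gadgetMeas, apply_ite aq]
  exact List.map_eq_flatMap

theorem lowExtraction_acts {j : Fin (k₂ + 2)} {o : Op (Qubit k₁ k₂)}
    (ho : o ∈ lowExtraction k₁ k₂ j) {q : Qubit k₁ k₂} (hq : o.Acts q) :
    q = aq (.low j) ∨ q = aq (.lowFlg j) ∨ ∃ i, q = dq i j := by
  rw [lowExtraction_eq, List.mem_cons] at ho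
  rcases ho with rfl | ho
  · exact .inl hq
  · obtain ⟨-, h⟩ := gadget_acts ho hq
    exact h

theorem lowExtraction_measures {j : Fin (k₂ + 2)} {o : Op (Qubit k₁ k₂)}
    (ho : o ∈ lowExtraction k₁ k₂ j) {q : Qubit k₁ k₂} (hq : o.Measures q) :
    q = aq (.low j) ∨ q = aq (.lowFlg j) := by
  rw [lowExtraction_eq, List.mem_cons] at ho
  rcases ho with rfl | ho
  · exact hq.elim
  · obtain ⟨-, h⟩ := gadget_measures ho hq
    exact h

theorem lowExtraction_wellFormed (j : Fin (k₂ + 2)) : WellFormed (lowExtraction k₁ k₂ j) := by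
  rw [lowExtraction_eq]
  refine WellFormed.append (C := [_]) (wellFormed_of_not_measures ?_ ?_) (gadget_low j).wellFormed ?_
  · simp [Op.Valid]
  · simp [Op.Measures]
  · simp [Op.Measures]

theorem xExtraction_wellFormed : WellFormed (xExtraction k₁ k₂) := by
  have h : ∀ l : List (Fin (k₂ + 2)), l.Nodup → WellFormed (l.flatMap (lowExtraction k₁ k₂)) := by
    intro l hl
    induction l with
    | nil => exact ⟨by simp, by simp⟩
    | cons j l ih =>
      rw [List.nodup_cons] at hl
      rw [List.flatMap_cons]
      refine (lowExtraction_wellFormed j).append (ih hl.2) fun o ho q hq o' ho' hq' => hl.1 ?_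
      obtain ⟨j', hj', ho'⟩ := List.mem_flatMap.1 ho'
      have h₁ := lowExtraction_measures ho hq
      have h₂ := lowExtraction_acts ho' hq'
      have hj : j = j' := by
        rcases h₁ with rfl | rfl <;> simpa [aq, dq] using h₂
      rwa [hj]
  refine WellFormed.append ?_ (h _ (List.nodup_finRange _)) fun o ho q hq o' ho' hq' => ?_
  · rw [highExtraction_eq]
    exact gadget_high.wellFormed
  · rw [highExtraction_eq] at ho
    obtain ⟨j, -, ho'⟩ := List.mem_flatMap.1 ho'
    have h₁ := gadget_measures ho hq
    have h₂ := lowExtraction_acts ho' hq'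
    obtain ⟨i, rfl | rfl⟩ := h₁ <;> simp [aq, dq] at h₂

theorem zeroPrep_wellFormed : WellFormed (zeroPrep k₁ k₂) := by
  have h : zeroPrep k₁ k₂ = (blkPrep k₁ k₂ ++ (List.finRange (k₁ + 2)).tail.map (treeOp k₂) ++
      [.prepZ (aq .chk), .cx (aq (.blk ⟨k₁, by omega⟩)) (aq .chk),
    .cx (aq (.blk (Fin.last (k₁ + 1)))) (aq .chk)]) ++ [.measZ (aq .chk)] := by
    simp [zeroPrep_eq, blkCheck]
  rw [h]
  refine WellFormed.append (wellFormed_of_not_measures ?_ ?_) ⟨?_, ?_⟩ ?_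
  · simp only [blkPrep, List.mem_append, List.mem_cons, List.mem_map, List.not_mem_nil, or_false]
    rintro o (((rfl | ⟨i, -, rfl⟩) | ⟨i, hi, rfl⟩) | rfl | rfl | rfl)
    · trivial
    · trivial
    · change aq (.blk (parent i)) ≠ aq (.blk i)
      rw [Ne, blk_eq_iff]
      exact (parent_lt (mem_finRange_tail.1 hi)).ne
    · trivial
    · exact aq_injective.ne (by simp)
    · exact aq_injective.ne (by simp)
  · simp only [blkPrep, List.mem_append, List.mem_cons, List.mem_map, List.not_mem_nil, or_false]
    rintro o (((rfl | ⟨i, -, rfl⟩) | ⟨i, hi, rfl⟩) | rfl | rfl | rfl) q <;> exact id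
  · simp [Op.Valid]
  · simp
  · simp only [blkPrep, List.mem_append, List.mem_cons, List.mem_map, List.not_mem_nil, or_false]
    rintro o (((rfl | ⟨i, -, rfl⟩) | ⟨i, hi, rfl⟩) | rfl | rfl | rfl) q hq <;> exact hq.elim

/-! ### Propagation of errors through half a cycle -/

/-- The gadget only copies its ancilla to the data, and the ancilla has just been reset. -/
theorem lowExtraction_of_ne {u : Qubit k₁ k₂ → ZMod 2} {j : Fin (k₂ + 2)} {q : Qubit k₁ k₂}
    (h : q ≠ aq (.low j)) (h' : q ≠ aq (.lowFlg j)) : prop (lowExtraction k₁ k₂ j) u q = u q := by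
  rw [lowExtraction_eq, prop_cons]
  by_cases hq : ∃ i, q = dq i j
  · obtain ⟨i, rfl⟩ := hq
    rw [(gadget_data (gadget_low j) _ 0 i : prop _ _ (dq i j) = _)]
    simp [Op.push, aq, dq, zmod_two_add_self]
  · push Not at hq
    rw [gadget_of_ne (gadget_low j) (fun _ => h') (fun _ => hq)]
    simp [Op.push, h]

theorem lowExtraction_flag (u : Qubit k₁ k₂ → ZMod 2) (j : Fin (k₂ + 2)) :
    prop (lowExtraction k₁ k₂ j) u (aq (.lowFlg j)) = 0 := by
  rw [lowExtraction_eq, prop_cons]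
  exact gadget_flag (gadget_low j) _ 0

theorem lowExtraction_dual_of_ne {u : Qubit k₁ k₂ → ZMod 2} {j : Fin (k₂ + 2)} {q : Qubit k₁ k₂}
    (h : q ≠ aq (.low j)) (h' : q ≠ aq (.lowFlg j)) :
    prop ((lowExtraction k₁ k₂ j).map Op.dual) u q = u q := by
  rw [lowExtraction_eq, List.map_cons, prop_cons,
    gadget_dual_of_ne (gadget_low j) (fun _ => h) (fun _ => h')]
  simp [Op.push, Op.dual, h]

theorem lowExtraction_dual_anc (u : Qubit k₁ k₂ → ZMod 2) (j : Fin (k₂ + 2)) :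
    prop ((lowExtraction k₁ k₂ j).map Op.dual) u (aq (.low j)) = ∑ i, u (dq i j) := by
  rw [lowExtraction_eq, List.map_cons, prop_cons]
  refine (gadget_dual_anc (gadget_low j) _ 0).trans ?_
  simp [Op.push, Op.dual, aq, dq, zmod_two_add_self]

theorem prop_flatMap_of_eq {Q α : Type} [DecidableEq Q] {l : List α} {g : α → List (Op Q)} {q : Q}
    (h : ∀ a ∈ l, ∀ u, prop (g a) u q = u q) (u : Q → ZMod 2) : prop (l.flatMap g) u q = u q := by
  induction l generalizing u with
  | nil => rfl
  | cons a l ih =>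
    rw [List.flatMap_cons, prop_append, ih fun a ha => h a (by simp [ha]), h a (by simp)]

theorem finRange_split {n : ℕ} (j : Fin n) :
    ∃ l₁ l₂, List.finRange n = l₁ ++ j :: l₂ ∧ j ∉ l₁ ∧ j ∉ l₂ := by
  obtain ⟨l₁, l₂, h⟩ := List.append_of_mem (List.mem_finRange j)
  have hn := List.nodup_finRange n
  rw [h, List.nodup_append, List.nodup_cons] at hn
  exact ⟨l₁, l₂, h, fun hj => hn.2.2 j hj j (by simp) rfl, hn.2.1.1⟩

/-- Extraction of the row stabilizers. -/
def lowPart (k₁ k₂ : ℕ) : List (Op (Qubit k₁ k₂)) :=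
  (List.finRange (k₂ + 2)).flatMap (lowExtraction k₁ k₂)

theorem xExtraction_eq : xExtraction k₁ k₂ = highExtraction k₁ k₂ ++ lowPart k₁ k₂ := rfl

theorem map_dual_lowPart : (lowPart k₁ k₂).map Op.dual =
    (List.finRange (k₂ + 2)).flatMap fun j => (lowExtraction k₁ k₂ j).map Op.dual := by
  rw [lowPart, List.map_flatMap]

theorem lowPart_of_ne {q : Qubit k₁ k₂} (h : ∀ j, q ≠ aq (.low j)) (h' : ∀ j, q ≠ aq (.lowFlg j))
    (u : Qubit k₁ k₂ → ZMod 2) : prop (lowPart k₁ k₂) u q = u q :=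
  prop_flatMap_of_eq (fun j _ _ => lowExtraction_of_ne (h j) (h' j)) u

theorem lowPart_dual_of_ne {q : Qubit k₁ k₂} (h : ∀ j, q ≠ aq (.low j))
    (h' : ∀ j, q ≠ aq (.lowFlg j)) (u : Qubit k₁ k₂ → ZMod 2) :
    prop ((lowPart k₁ k₂).map Op.dual) u q = u q := by
  rw [map_dual_lowPart]
  exact prop_flatMap_of_eq (fun j _ _ => lowExtraction_dual_of_ne (h j) (h' j)) u

theorem lowPart_flag (u : Qubit k₁ k₂ → ZMod 2) (j : Fin (k₂ + 2)) :
    prop (lowPart k₁ k₂) u (aq (.lowFlg j)) = 0 := by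
  obtain ⟨l₁, l₂, h, -, h₂⟩ := finRange_split j
  rw [lowPart, h, List.flatMap_append, List.flatMap_cons, prop_append, prop_append,
    prop_flatMap_of_eq, lowExtraction_flag]
  intro j' hj' u
  refine lowExtraction_of_ne (by simp [aq]) ?_
  simp only [aq, ne_eq, Sum.inr.injEq, Anc.lowFlg.injEq]
  rintro rfl
  exact h₂ hj'

theorem lowPart_dual_anc (u : Qubit k₁ k₂ → ZMod 2) (j : Fin (k₂ + 2)) :
    prop ((lowPart k₁ k₂).map Op.dual) u (aq (.low j)) = ∑ i, u (dq i j) := by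
  obtain ⟨l₁, l₂, h, -, h₂⟩ := finRange_split j
  rw [map_dual_lowPart, h, List.flatMap_append, List.flatMap_cons, prop_append, prop_append,
    prop_flatMap_of_eq, lowExtraction_dual_anc]
  · refine Finset.sum_congr rfl fun i _ => prop_flatMap_of_eq (fun j' _ _ =>
      lowExtraction_dual_of_ne (by simp [aq, dq]) (by simp [aq, dq])) u
  intro j' hj' u
  refine lowExtraction_dual_of_ne ?_ (by simp [aq])
  simp only [aq, ne_eq, Sum.inr.injEq, Anc.low.injEq]
  rintro rfl
  exact h₂ hj'

/-- The block, unlike the row ancillas, is not reset here: an error from its preparation is copied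
to a complete column. -/
theorem xExtraction_data (u : Qubit k₁ k₂ → ZMod 2) (i : Fin (k₁ + 2)) (j : Fin (k₂ + 2)) :
    prop (xExtraction k₁ k₂) u (dq i j) = u (dq i j) + u (aq (.blk i)) := by
  rw [xExtraction_eq, prop_append, lowPart_of_ne (by simp [aq, dq]) (by simp [aq, dq]),
    highExtraction_eq, gadget_data gadget_high]

theorem xExtraction_flg (u : Qubit k₁ k₂ → ZMod 2) (i : Fin (k₁ + 2)) :
    prop (xExtraction k₁ k₂) u (aq (.flg i)) = 0 := by
  rw [xExtraction_eq, prop_append, lowPart_of_ne (by simp [aq]) (by simp [aq]),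
    highExtraction_eq]
  exact gadget_flag gadget_high _ i

theorem xExtraction_lowFlg (u : Qubit k₁ k₂ → ZMod 2) (j : Fin (k₂ + 2)) :
    prop (xExtraction k₁ k₂) u (aq (.lowFlg j)) = 0 := by
  rw [xExtraction_eq, prop_append, lowPart_flag]

theorem xExtraction_dual_data (u : Qubit k₁ k₂ → ZMod 2) (i : Fin (k₁ + 2)) (j : Fin (k₂ + 2)) :
    prop ((xExtraction k₁ k₂).map Op.dual) u (dq i j) = u (dq i j) := by
  rw [xExtraction_eq, List.map_append, prop_append,
    lowPart_dual_of_ne (by simp [aq, dq]) (by simp [aq, dq]),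
    highExtraction_eq, gadget_dual_of_ne gadget_high (by simp [aq, dq]) (by simp [aq, dq])]

theorem xExtraction_dual_blk (u : Qubit k₁ k₂ → ZMod 2) (i : Fin (k₁ + 2)) :
    prop ((xExtraction k₁ k₂).map Op.dual) u (aq (.blk i)) = u (aq (.blk i)) + ∑ j, u (dq i j) := by
  rw [xExtraction_eq, List.map_append, prop_append,
    lowPart_dual_of_ne (by simp [aq]) (by simp [aq]), highExtraction_eq]
  exact gadget_dual_anc gadget_high u i

theorem xExtraction_dual_low (u : Qubit k₁ k₂ → ZMod 2) (j : Fin (k₂ + 2)) :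
    prop ((xExtraction k₁ k₂).map Op.dual) u (aq (.low j)) = ∑ i, u (dq i j) := by
  rw [xExtraction_eq, List.map_append, prop_append, lowPart_dual_anc]
  refine Finset.sum_congr rfl fun i _ => ?_
  rw [highExtraction_eq, gadget_dual_of_ne gadget_high (by simp [aq, dq]) (by simp [aq, dq])]

end ConcatIceberg

namespace ConcatIceberg

variable {k₁ k₂ : ℕ}

/-! ### Faults in half a cycle -/

/-- Strings of Pauli operators of one type in the stabilizer group of the code. -/
def IsStabilizer (v : Data k₁ k₂ → ZMod 2) : Prop :=
  -- An even number of columns, chosen by `a`, and any set of rows, chosen by `c`.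
  ∃ (a : Fin (k₁ + 2) → ZMod 2) (c : Fin (k₂ + 2) → ZMod 2), ∑ i, a i = 0 ∧
    v = fun p => a p.1 + c p.2

theorem isStabilizer_zero : IsStabilizer (0 : Data k₁ k₂ → ZMod 2) :=
  ⟨0, 0, by simp, by ext; simp⟩

theorem IsStabilizer.add {v w : Data k₁ k₂ → ZMod 2} (hv : IsStabilizer v) (hw : IsStabilizer w) :
    IsStabilizer (v + w) := by
  obtain ⟨a, c, h, rfl⟩ := hv
  obtain ⟨a', c', h', rfl⟩ := hw
  refine ⟨a + a', c + c', by simp [Finset.sum_add_distrib, h, h'], ?_⟩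
  ext p
  simp only [Pi.add_apply]
  ring

theorem isStabilizer_rowVec (j : Fin (k₂ + 2)) : IsStabilizer (rowVec k₁ k₂ j) :=
  ⟨0, Pi.single j 1, by simp, by ext p; simp [rowVec, Pi.single_apply]⟩

/-- Errors of one type created by a fault in the half of a cycle in which they are not detected;
`V` and `H` are the flagged columns and rows. -/
def Hook (V : Finset (Fin (k₁ + 2))) (H : Finset (Fin (k₂ + 2))) (e : Data k₁ k₂ → ZMod 2) :
    Prop :=
  -- In contrast to `GenWeightLEOne`, single errors and complete columns must be unflagged, so that
  -- the flags tell the decoder which rule to use.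
  (V = ∅ ∧ H = ∅ ∧ ∃ q, ∀ p, p ≠ q → e p = 0) ∨
  (∃ x, V = {x} ∧ H = ∅ ∧ ∀ p, p.1 ≠ x → e p = 0) ∨
  (∃ y, V = ∅ ∧ H = {y} ∧ ∀ p, p.2 ≠ y → e p = 0) ∨
  (V = ∅ ∧ H = ∅ ∧ ∃ x, e = colVec k₁ k₂ x)

theorem Hook.genWeightLEOne {V : Finset (Fin (k₁ + 2))} {H : Finset (Fin (k₂ + 2))}
    {e : Data k₁ k₂ → ZMod 2} (h : Hook V H e) : GenWeightLEOne V H e := by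
  rcases h with ⟨-, -, h⟩ | h | h | ⟨-, -, h⟩
  · exact .inl h
  · exact .inr (.inl h)
  · exact .inr (.inr (.inl h))
  · exact .inr (.inr (.inr h))

theorem faultOut_lowExtraction {j : Fin (k₂ + 2)} {u : Qubit k₁ k₂ → ZMod 2}
    (hu : FaultOut (lowExtraction k₁ k₂ j) u) :
    (∀ q, q ≠ aq (.low j) → q ≠ aq (.lowFlg j) → (∀ i, q ≠ dq i j) → u q = 0) ∧
      (u (aq (.lowFlg j)) = 1 ∨
        (u (aq (.lowFlg j)) = 0 ∧ ∃ i, ∀ i', i' ≠ i → u (dq i' j) = 0) ∨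
        (u (aq (.lowFlg j)) = 0 ∧ ∀ i, u (dq i j) = 1)) := by
  have G : Gadget (N := 1) (fun _ => aq (.low j)) (fun _ => aq (.lowFlg j))
    (fun _ i => (dq i j : Qubit k₁ k₂)) := gadget_low j
  rw [lowExtraction_eq] at hu
  -- An error of the freshly initialised ancilla is copied to the complete row.
  rcases hu with ⟨w, hw, rfl⟩ | hu
  · have hw' : ∀ q, q ≠ aq (.low j) → w q = 0 := hw
    have hf := gadget_flag G w 0
    have hd : ∀ i, _ := fun i => gadget_data G w 0 i
    simp only [hw' _ (show dq _ _ ≠ aq (.low j) by simp [aq, dq]), zero_add] at hd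
    refine ⟨fun q h h' h'' => ?_, .inr ?_⟩
    · rw [gadget_of_ne G (fun _ => h') (fun _ => h''), hw' q h]
    · rcases zmod_two_cases (w (aq (.low j))) with h | h
      · exact .inl ⟨hf, 0, fun i _ => (hd i).trans h⟩
      · exact .inr ⟨hf, fun i => (hd i).trans h⟩
  · obtain ⟨-, h₁, h₂⟩ := faultOut_gadget G (by omega) hu
    exact ⟨h₁, h₂⟩

theorem faultOut_lowExtraction_dual {j : Fin (k₂ + 2)} {u : Qubit k₁ k₂ → ZMod 2}
    (hu : FaultOut ((lowExtraction k₁ k₂ j).map Op.dual) u) :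
    ∃ i, ∀ q, q ≠ aq (.low j) → q ≠ aq (.lowFlg j) → q ≠ dq i j → u q = 0 := by
  have G : Gadget (N := 1) (fun _ => aq (.low j)) (fun _ => aq (.lowFlg j))
    (fun _ i => (dq i j : Qubit k₁ k₂)) := gadget_low j
  rw [lowExtraction_eq, List.map_cons] at hu
  rcases hu with ⟨w, hw, rfl⟩ | hu
  · have hw' : ∀ q, q ≠ aq (.low j) → w q = 0 := hw
    refine ⟨0, fun q h h' _ => ?_⟩
    rw [gadget_dual_of_ne G (fun _ => h) (fun _ => h'), hw' q h]
  · obtain ⟨-, i, h⟩ := faultOut_gadget_dual G (by omega) hu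
    exact ⟨i, h⟩

theorem prop_lowExtraction_fixed {t : Half} {l : List (Fin (k₂ + 2))} {j : Fin (k₂ + 2)}
    (hj : j ∉ l) {u : Qubit k₁ k₂ → ZMod 2}
    (hu : ∀ q, q ≠ aq (.low j) → q ≠ aq (.lowFlg j) → (∀ i, q ≠ dq i j) → u q = 0) :
    prop (l.flatMap fun j => (lowExtraction k₁ k₂ j).map (Op.conj t)) u = u := by
  refine prop_fixed fun o ho => Op.push_of_forall_acts _ _ fun q hq => ?_
  obtain ⟨j', hj', ho'⟩ := List.mem_flatMap.1 ho
  obtain ⟨o'', hm, rfl⟩ := List.mem_map.1 ho'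
  rw [Op.acts_conj] at hq
  have hne : j' ≠ j := by
    rintro rfl
    exact hj hj'
  rcases lowExtraction_acts hm hq with rfl | rfl | ⟨i, rfl⟩ <;>
    exact hu _ (by simp [aq, dq, hne]) (by simp [aq, dq, hne]) (by simp [aq, dq, hne])

theorem faultOut_lowPart {v : Qubit k₁ k₂ → ZMod 2} (hv : FaultOut (lowPart k₁ k₂) v) :
    ∃ j, (∀ q, q ≠ aq (.low j) → q ≠ aq (.lowFlg j) → (∀ i, q ≠ dq i j) → v q = 0) ∧
      (v (aq (.lowFlg j)) = 1 ∨
        (v (aq (.lowFlg j)) = 0 ∧ ∃ i, ∀ i', i' ≠ i → v (dq i' j) = 0) ∨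
        (v (aq (.lowFlg j)) = 0 ∧ ∀ i, v (dq i j) = 1)) := by
  obtain ⟨l₁, j, l₂, u, hl, hu, rfl⟩ := hv.flatMap
  have hn := List.nodup_finRange (k₂ + 2)
  rw [hl, List.nodup_append, List.nodup_cons] at hn
  have h := faultOut_lowExtraction hu
  have h' := prop_lowExtraction_fixed (t := .X) hn.2.1.1 h.1
  have hid : ∀ C : List (Op (Qubit k₁ k₂)), C.map (Op.conj .X) = C := List.map_id
  simp only [hid] at h'
  rw [h']
  exact ⟨j, h⟩

theorem faultOut_lowPart_dual {v : Qubit k₁ k₂ → ZMod 2}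
    (hv : FaultOut ((lowPart k₁ k₂).map Op.dual) v) :
    ∃ i j, ∀ q, q ≠ aq (.low j) → q ≠ aq (.lowFlg j) → q ≠ dq i j → v q = 0 := by
  rw [map_dual_lowPart] at hv
  obtain ⟨l₁, j, l₂, u, hl, hu, rfl⟩ := hv.flatMap
  have hn := List.nodup_finRange (k₂ + 2)
  rw [hl, List.nodup_append, List.nodup_cons] at hn
  obtain ⟨i, h⟩ := faultOut_lowExtraction_dual hu
  have h' := prop_lowExtraction_fixed (t := .Z) hn.2.1.1 (fun q h₁ h₂ h₃ => h q h₁ h₂ (h₃ i))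
  exact ⟨i, j, fun q h₁ h₂ h₃ => (congrFun h' q).trans (h q h₁ h₂ h₃)⟩

theorem filter_eq_singleton {n : ℕ} {g : Fin n → ZMod 2} {i : Fin n} (h : g i = 1)
    (h' : ∀ i', i' ≠ i → g i' = 0) : Finset.univ.filter (fun i => g i = 1) = {i} := by
  ext i'
  by_cases hi : i' = i
  · simp [hi, h]
  · simp [hi, h' i' hi]

theorem filter_eq_empty {n : ℕ} {g : Fin n → ZMod 2} (h : ∀ i, g i = 0) :
    Finset.univ.filter (fun i => g i = 1) = ∅ := by
  ext i'
  simp [h]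

/-- A fault in half a cycle, for the errors not detected in this half. -/
theorem faultOut_xExtraction {v : Qubit k₁ k₂ → ZMod 2} (hv : FaultOut (xExtraction k₁ k₂) v) :
    ∃ s, IsStabilizer s ∧ Hook (Finset.univ.filter fun i => v (aq (.flg i)) = 1)
      (Finset.univ.filter fun j => v (aq (.lowFlg j)) = 1) ((fun p => v (dq p.1 p.2)) + s) := by
  rw [xExtraction_eq, faultOut_append] at hv
  rcases hv with ⟨u, hu, rfl⟩ | hv
  · rw [highExtraction_eq] at hu
    obtain ⟨i, h₁, h₂⟩ := faultOut_gadget gadget_high (by omega) hu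
    refine ⟨0, isStabilizer_zero, ?_⟩
    simp only [lowPart_flag, lowPart_of_ne (show ∀ j, dq _ _ ≠ aq (.low j) by simp [aq, dq])
      (show ∀ j, dq _ _ ≠ aq (.lowFlg j) by simp [aq, dq]),
      lowPart_of_ne (show ∀ j, aq (.flg _) ≠ aq (.low j) by simp [aq])
      (show ∀ j, aq (.flg _) ≠ aq (.lowFlg j) by simp [aq]), add_zero]
    rw [filter_eq_empty fun _ => rfl]
    have h₃ : ∀ i', i' ≠ i → u (aq (.flg i')) = 0 := fun i' hi' =>
      h₁ _ (by simp [aq]) (by simpa [aq] using hi') (by simp [aq, dq])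
    have h₄ : ∀ p : Data k₁ k₂, p.1 ≠ i → u (dq p.1 p.2) = 0 := fun p hp =>
      h₁ _ (by simp [aq, dq]) (by simp [aq, dq])
        (fun _ h => hp (Prod.mk.inj (Sum.inl.inj h)).1)
    have h₅ : u (aq (.flg i)) = 0 → ∀ i', u (aq (.flg i')) = 0 := fun h i' => by
      by_cases hi : i' = i
      · rw [hi, h]
      · exact h₃ i' hi
    rcases h₂ with h₂ | ⟨h₂, j, hj⟩ | ⟨h₂, hj⟩
    · rw [filter_eq_singleton h₂ h₃]
      exact .inr (.inl ⟨i, rfl, rfl, h₄⟩)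
    · rw [filter_eq_empty (h₅ h₂)]
      refine .inl ⟨rfl, rfl, (i, j), fun p hp => ?_⟩
      by_cases hi : p.1 = i
      · have hne : p.2 ≠ j := fun h => hp (Prod.ext hi h)
        simpa [hi] using hj p.2 hne
      · exact h₄ p hi
    · rw [filter_eq_empty (h₅ h₂)]
      refine .inr (.inr (.inr ⟨rfl, rfl, i, ?_⟩))
      ext p
      by_cases hi : p.1 = i
      · simp [colVec, hi, hj]
      · simp [colVec, hi, h₄ p hi]
  · obtain ⟨j, h₁, h₂⟩ := faultOut_lowPart hv
    have hf : (Finset.univ.filter fun i => v (aq (.flg i)) = 1) = ∅ :=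
      filter_eq_empty fun i => h₁ _ (by simp [aq]) (by simp [aq]) (by simp [aq, dq])
    have h₃ : ∀ j', j' ≠ j → v (aq (.lowFlg j')) = 0 := fun j' hj' =>
      h₁ _ (by simp [aq]) (by simpa [aq] using hj') (by simp [aq, dq])
    have h₄ : ∀ p : Data k₁ k₂, p.2 ≠ j → v (dq p.1 p.2) = 0 := fun p hp =>
      h₁ _ (by simp [aq, dq]) (by simp [aq, dq])
        (fun _ h => hp (Prod.mk.inj (Sum.inl.inj h)).2)
    have h₅ : v (aq (.lowFlg j)) = 0 → ∀ j', v (aq (.lowFlg j')) = 0 := fun h j' => by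
      by_cases hj : j' = j
      · rw [hj, h]
      · exact h₃ j' hj
    rw [hf]
    rcases h₂ with h₂ | ⟨h₂, i, hi⟩ | ⟨h₂, hi⟩
    · rw [filter_eq_singleton h₂ h₃]
      exact ⟨0, isStabilizer_zero, .inr (.inr (.inl ⟨j, rfl, rfl, by simpa using h₄⟩))⟩
    · rw [filter_eq_empty (h₅ h₂)]
      refine ⟨0, isStabilizer_zero, .inl ⟨rfl, rfl, (i, j), fun p hp => ?_⟩⟩
      by_cases hj : p.2 = j
      · have hne : p.1 ≠ i := fun h => hp (Prod.ext h hj)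
        simpa [hj] using hi p.1 hne
      · simpa using h₄ p hj
    · rw [filter_eq_empty (h₅ h₂)]
      -- A complete row is removed by its stabilizer; nothing is left, and the qubit `(0, 0)` is
      -- arbitrary.
      refine ⟨rowVec k₁ k₂ j, isStabilizer_rowVec j, .inl ⟨rfl, rfl, (0, 0), fun p _ => ?_⟩⟩
      by_cases hj : p.2 = j
      · simp [rowVec, hj, hi, zmod_two_add_self]
      · simp [rowVec, hj, h₄ p hj]

/-- A fault in half a cycle, for the errors detected in this half. -/
theorem faultOut_xExtraction_dual {v : Qubit k₁ k₂ → ZMod 2}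
    (hv : FaultOut ((xExtraction k₁ k₂).map Op.dual) v) :
    ∃ i j, (∀ i' j', (i', j') ≠ (i, j) → v (dq i' j') = 0) ∧
      (∀ i', i' ≠ i → v (aq (.blk i')) = 0) ∧ (∀ j', j' ≠ j → v (aq (.low j')) = 0) ∧
      (v (dq i j) = 0 → v (aq (.blk i)) = 0 ∨ v (aq (.low j)) = 0) := by
  rw [xExtraction_eq, List.map_append, faultOut_append] at hv
  -- A fault in the column extraction flips a row outcome only through a data error, which the later
  -- row extraction sees. A fault in the row extraction comes too late to flip the block. Hence both
  -- outcomes are never flipped without a data error.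
  rcases hv with ⟨u, hu, rfl⟩ | hv
  · rw [highExtraction_eq] at hu
    obtain ⟨i, j, h⟩ := faultOut_gadget_dual gadget_high (by omega) hu
    have hd : ∀ i' j', (i', j') ≠ (i, j) → u (dq i' j') = 0 := fun i' j' hp =>
      h _ (by simp [aq, dq]) (by simp [aq, dq]) (by simpa [dq] using hp)
    refine ⟨i, j, ?_⟩
    simp only [lowPart_dual_anc, lowPart_dual_of_ne (show ∀ j, dq _ _ ≠ aq (.low j) by simp [aq, dq])
      (show ∀ j, dq _ _ ≠ aq (.lowFlg j) by simp [aq, dq]),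
      lowPart_dual_of_ne (show ∀ j, aq (.blk _) ≠ aq (.low j) by simp [aq])
      (show ∀ j, aq (.blk _) ≠ aq (.lowFlg j) by simp [aq])]
    refine ⟨hd, fun i' hi' => h _ (by simpa [aq] using hi') (by simp [aq]) (by simp [aq, dq]),
      fun j' hj' => ?_, fun h₀ => .inr ?_⟩
    · exact Finset.sum_eq_zero fun i' _ => hd _ _ (by simp [hj'])
    · refine Finset.sum_eq_zero fun i' _ => ?_
      by_cases hi : i' = i
      · rw [hi, h₀]
      · exact hd _ _ (by simp [hi])
  · obtain ⟨i, j, h⟩ := faultOut_lowPart_dual hv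
    have hb : ∀ i', v (aq (.blk i')) = 0 := fun i' =>
      h _ (by simp [aq]) (by simp [aq]) (by simp [aq, dq])
    exact ⟨i, j, fun i' j' hp => h _ (by simp [aq, dq]) (by simp [aq, dq]) (by simpa [dq] using hp),
      fun i' _ => hb i', fun j' hj' => h _ (by simpa [aq] using hj') (by simp [aq]) (by simp [aq, dq]),
      fun _ => .inl (hb i)⟩

/-! ### The faultless half of a cycle -/

/-- The state is stabilized by the stabilizers of the code of one type. -/
def CodeStab (t : Half) (Ψ : QState (Qubit k₁ k₂)) : Prop :=
  ∀ v : Data k₁ k₂ → ZMod 2, IsStabilizer v → Stab t (Sum.elim v 0) 0 Ψ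

theorem sum_elim_dotProduct (v : Data k₁ k₂ → ZMod 2) (s : Qubit k₁ k₂ → ZMod 2) :
    (Sum.elim v 0 : Qubit k₁ k₂ → ZMod 2) ⬝ᵥ s = ∑ i, ∑ j, v (i, j) * s (dq i j) := by
  rw [dotProduct, Fintype.sum_sum_type]
  simp [dq, Fintype.sum_prod_type]

theorem blkVec_dotProduct (s : Qubit k₁ k₂ → ZMod 2) :
    blkVec k₁ k₂ ⬝ᵥ s = ∑ i, s (aq (.blk i)) := by
  have h : blkVec k₁ k₂ = ∑ i, Pi.single (aq (.blk i)) 1 := by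
    ext q
    rw [Finset.sum_apply]
    rcases q with q | q | q | q | q | q
    · simp [blkVec, aq]
    · simp [blkVec, aq, Pi.single_apply]
    all_goals simp [blkVec, aq]
  rw [h, sum_dotProduct]
  simp

/-- For `Half.X` the block has even parity on the support, so the shift is by an even number of
columns, a stabilizer. For `Half.Z` all column parities agree on the support, so the shift is by a
multiple of `blkVec`, which stabilizes the block. Off the support both amplitudes vanish, since the
shift preserves the parities in question. -/
theorem shiftInv_high {h : Half} {Φ : QState (Qubit k₁ k₂)} (hc : CodeStab h Φ)
    (hb : Stab h.swap (blkVec k₁ k₂) 0 Φ) :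
    ShiftInv h (fun i => aq (.blk i)) (dq : Fin (k₁ + 2) → Fin (k₂ + 2) → Qubit k₁ k₂) Φ := by
  cases h
  · intro s w hw hw'
    have hb' := stab_Z_iff.1 hb
    simp only [blkVec_dotProduct] at hb'
    by_cases h : ∑ i, s (aq (.blk i)) = 0
    · have h₁ : w = Sum.elim (fun p : Data k₁ k₂ => s (aq (.blk p.1))) 0 := by
        ext q
        rcases q with ⟨i, j⟩ | q
        · exact hw i j
        · exact hw' _ (by simp [dq])
      have h₂ := stab_X_iff.1 (hc _ ⟨fun i => s (aq (.blk i)), 0, h, rfl⟩) s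
      simp only [Pi.zero_apply, add_zero, sgn_zero, one_mul] at h₂
      rw [h₁, h₂]
    · have h₁ : Φ s = 0 := by
        by_contra h₁
        exact h (hb' s h₁)
      have h₂ : Φ (s + w) = 0 := by
        by_contra h₂
        have h₃ := hb' _ h₂
        simp only [Pi.add_apply, hw' _ (show ∀ i j, aq (.blk _) ≠ dq i j by simp [aq, dq]),
          add_zero] at h₃
        exact h h₃
      rw [h₁, h₂]
  · intro s w hw hw'
    have hd : ∀ i j, w (dq i j) = 0 := fun i j => hw' _ (by simp [aq, dq])
    have hc' : ∀ s, Φ s ≠ 0 → ∀ i, ∑ j, s (dq i j) = ∑ j, s (dq 0 j) := by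
      intro s hs i
      have h₁ := stab_Z_iff.1 (hc (fun p => (Pi.single i 1 + Pi.single 0 1 : _ → ZMod 2) p.1)
        ⟨Pi.single i 1 + Pi.single 0 1, 0, by simp [Finset.sum_add_distrib, zmod_two_add_self],
          by simp⟩) s hs
      rw [sum_elim_dotProduct] at h₁
      simp only [Pi.add_apply, add_mul, Finset.sum_add_distrib, Pi.single_apply, ite_mul, one_mul,
        zero_mul] at h₁
      rw [Finset.sum_comm, Finset.sum_comm (f := fun i j => if i = 0 then _ else _)] at h₁
      simp only [Finset.sum_ite_eq', Finset.mem_univ, if_true] at h₁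
      exact CharTwo.add_eq_zero.1 h₁
    by_cases h : ∀ i, ∑ j, s (dq i j) = ∑ j, s (dq 0 j)
    · have h₁ : w = (∑ j, s (dq 0 j)) • blkVec k₁ k₂ := by
        ext q
        rcases q with ⟨i, j⟩ | q | q | q | q | q
        · change w (dq i j) = _
          simpa [blkVec] using hd i j
        · change w (aq (.blk q)) = _
          simpa [blkVec, h q] using hw q
        all_goals
          simp only [blkVec, Pi.smul_apply, Sum.elim_inr, smul_zero]
          exact hw' _ (by simp [aq])
      have h₂ := stab_X_iff.1 (hb.smul (∑ j, s (dq 0 j))) s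
      rw [← h₁, sgn_zero, one_mul] at h₂
      exact h₂
    · have h₁ : Φ s = 0 := by
        by_contra h₁
        exact h (hc' s h₁)
      have h₂ : Φ (s + w) = 0 := by
        by_contra h₂
        have h₃ := hc' _ h₂
        simp only [Pi.add_apply, hd, add_zero] at h₃
        exact h h₃
      rw [h₁, h₂]

/-- The shift is by a multiple of a row for `Half.X`; for `Half.Z` it is by a row parity, which
vanishes on the support. -/
theorem shiftInv_low {h : Half} {Φ : QState (Qubit k₁ k₂)} (hc : CodeStab h Φ)
    (j : Fin (k₂ + 2)) :
    ShiftInv (N := 1) h (fun _ => aq (.low j)) (fun _ i => (dq i j : Qubit k₁ k₂)) Φ := by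
  cases h
  · intro s w hw hw'
    have h₁ : w = Sum.elim (s (aq (.low j)) • rowVec k₁ k₂ j) 0 := by
      ext q
      rcases q with ⟨i, j'⟩ | q
      · by_cases hj : j' = j
        · subst hj
          change w (dq i j') = _
          simpa [rowVec] using hw 0 i
        · change w (dq i j') = _
          simpa [rowVec, hj] using hw' (dq i j') (by simp [dq, hj])
      · exact hw' _ (by simp [dq])
    have h₂ : IsStabilizer (s (aq (.low j)) • rowVec k₁ k₂ j) := by
      rcases zmod_two_cases (s (aq (.low j))) with h | h <;> rw [h]
      · rw [zero_smul]
        exact isStabilizer_zero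
      · rw [one_smul]
        exact isStabilizer_rowVec j
    have h₃ := stab_X_iff.1 (hc _ h₂) s
    rw [← h₁, sgn_zero, one_mul] at h₃
    exact h₃
  · intro s w hw hw'
    have hc' : ∀ s, Φ s ≠ 0 → ∑ i, s (dq i j) = 0 := by
      intro s hs
      have h₁ := stab_Z_iff.1 (hc _ (isStabilizer_rowVec j)) s hs
      rw [sum_elim_dotProduct] at h₁
      simpa [rowVec] using h₁
    by_cases h : ∑ i, s (dq i j) = 0
    · have h₁ : w = 0 := by
        ext q
        by_cases hq : q = aq (.low j)
        · rw [hq]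
          exact (hw 0).trans h
        · exact hw' q fun _ => hq
      rw [h₁, add_zero]
    · have hd : ∀ i, w (dq i j) = 0 := fun i => hw' _ (by simp [aq, dq])
      have h₁ : Φ s = 0 := by
        by_contra h₁
        exact h (hc' s h₁)
      have h₂ : Φ (s + w) = 0 := by
        by_contra h₂
        have h₃ := hc' _ h₂
        simp only [Pi.add_apply, hd, add_zero] at h₃
        exact h h₃
      rw [h₁, h₂]

theorem krun_lowExtraction {h : Half} {j : Fin (k₂ + 2)} {K : List (Op (Qubit k₁ k₂) × ZMod 2)}
    (hK : K.map Prod.fst = (lowExtraction k₁ k₂ j).map (Op.conj h)) :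
    ∃ K' : List (Op (Qubit k₁ k₂) × ZMod 2),
      (∀ o ∈ K'.map Prod.fst, ∀ q, o.Acts q → ∃ a, q = aq a) ∧
      ∀ Ψ, CodeStab h Ψ → krun K Ψ = krun K' Ψ ∧
        Stab h (Pi.single (aq (.low j)) 1) 0 (krun K Ψ) ∧
        Stab h.swap (Pi.single (aq (.lowFlg j)) 1) 0 (krun K Ψ) ∧
        ∀ t v c, v (aq (.low j)) = 0 → v (aq (.lowFlg j)) = 0 → Stab t v c Ψ →
          Stab t v c (krun K Ψ) := by
  rw [lowExtraction_eq, List.map_cons, List.map_eq_cons_iff] at hK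
  obtain ⟨⟨o, b⟩, K, rfl, ho, hK⟩ := hK
  dsimp only at ho
  rw [prepOf_eq] at ho
  obtain ⟨K', hK', hΨ'⟩ := krun_gadget (gadget_low j) hK
  refine ⟨(o, b) :: K', ?_, fun Ψ hΨ => ?_⟩
  · intro o' ho' q hq
    rw [List.map_cons, List.mem_cons] at ho'
    rcases ho' with rfl | ho'
    · rw [ho, prepOf_acts] at hq
      exact ⟨_, hq⟩
    · rcases hK' o' ho' q hq with ⟨-, h⟩ | ⟨-, h⟩ <;> exact ⟨_, h⟩
  · have h₁ : ∀ t v c, v (aq (.low j)) = 0 → Stab t v c Ψ → Stab t v c (o.kraus b Ψ) := by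
      intro t v c hv hs
      refine hs.kraus_of_not_acts (fun q hq => ?_) _
      rw [ho, prepOf_acts] at hq
      rw [hq, hv]
    have hc : CodeStab h (o.kraus b Ψ) := fun v hv => h₁ _ _ _ rfl (hΨ v hv)
    obtain ⟨h₂, h₃, h₄⟩ := hΨ' (o.kraus b Ψ) fun Φ hΦ =>
      shiftInv_low (fun v hv => hΦ _ _ (fun _ => rfl) (hc v hv)) j
    simp only [krun_cons]
    refine ⟨h₂, h₄ _ _ _ (fun _ => by simp [aq]) (.inl rfl) ?_, h₃ 0, fun t v c hv hv' hs =>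
      h₄ _ _ _ (fun _ => hv') (.inr fun _ => hv) (h₁ t v c hv hs)⟩
    rw [ho]
    exact stab_prepOf _ _ _ _

theorem krun_lowPart {h : Half} {K : List (Op (Qubit k₁ k₂) × ZMod 2)}
    {l : List (Fin (k₂ + 2))} (hl : l.Nodup)
    (hK : K.map Prod.fst = (l.flatMap (lowExtraction k₁ k₂)).map (Op.conj h)) :
    ∃ K' : List (Op (Qubit k₁ k₂) × ZMod 2),
      (∀ o ∈ K'.map Prod.fst, ∀ q, o.Acts q → ∃ a, q = aq a) ∧
      ∀ Ψ, CodeStab h Ψ → krun K Ψ = krun K' Ψ ∧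
        (∀ j ∈ l, Stab h (Pi.single (aq (.low j)) 1) 0 (krun K Ψ) ∧
          Stab h.swap (Pi.single (aq (.lowFlg j)) 1) 0 (krun K Ψ)) ∧
        ∀ t v c, (∀ j ∈ l, v (aq (.low j)) = 0) → (∀ j ∈ l, v (aq (.lowFlg j)) = 0) →
          Stab t v c Ψ → Stab t v c (krun K Ψ) := by
  induction l generalizing K with
  | nil =>
    rw [List.flatMap_nil, List.map_nil, List.map_eq_nil_iff] at hK
    subst hK
    exact ⟨[], by simp, fun Ψ hΨ => ⟨rfl, by simp, fun t v c _ _ hs => hs⟩⟩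
  | cons j l ih =>
    rw [List.nodup_cons] at hl
    rw [List.flatMap_cons, List.map_append] at hK
    obtain ⟨K₁, K₂, rfl, hK₁, hK₂⟩ := map_eq_append hK
    obtain ⟨K₁', h₁, hΨ₁⟩ := krun_lowExtraction hK₁
    obtain ⟨K₂', h₂, hΨ₂⟩ := ih hl.2 hK₂
    refine ⟨K₁' ++ K₂', ?_, fun Ψ hΨ => ?_⟩
    · intro o ho
      rw [List.map_append, List.mem_append] at ho
      rcases ho with ho | ho
      · exact h₁ o ho
      · exact h₂ o ho
    · obtain ⟨h₃, h₄, h₅, h₆⟩ := hΨ₁ Ψ hΨ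
      have hc : CodeStab h (krun K₁ Ψ) := fun v hv => h₆ _ _ _ rfl rfl (hΨ v hv)
      obtain ⟨h₇, h₈, h₉⟩ := hΨ₂ _ hc
      have hne : ∀ j' ∈ l, j' ≠ j := fun j' hj' h => hl.1 (h ▸ hj')
      rw [krun_append, krun_append, ← h₃]
      refine ⟨h₇, fun j' hj' => ?_, fun t v c hv hv' hs => ?_⟩
      · rcases List.mem_cons.1 hj' with rfl | hj'
        · refine ⟨h₉ _ _ _ (fun j'' hj'' => ?_) (fun j'' hj'' => ?_) h₄,
            h₉ _ _ _ (fun j'' hj'' => ?_) (fun j'' hj'' => ?_) h₅⟩ <;>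
            simp [aq, hne j'' hj'']
        · exact h₈ j' hj'
      · exact h₉ _ _ _ (fun j' hj' => hv j' (by simp [hj'])) (fun j' hj' => hv' j' (by simp [hj']))
          (h₆ _ _ _ (hv j (by simp)) (hv' j (by simp)) hs)

/-- The faultless half of a cycle acts on the ancillas only. -/
theorem krun_main {h : Half} {K : List (Op (Qubit k₁ k₂) × ZMod 2)}
    (hK : K.map Prod.fst = (xExtraction k₁ k₂).map (Op.conj h)) :
    ∃ K' : List (Op (Qubit k₁ k₂) × ZMod 2),
      (∀ o ∈ K'.map Prod.fst, ∀ q, o.Acts q → ∃ a, q = aq a) ∧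
      ∀ Ψ, CodeStab h Ψ → Stab h.swap (blkVec k₁ k₂) 0 Ψ → krun K Ψ = krun K' Ψ ∧
        (∀ i, Stab h.swap (Pi.single (aq (.flg i)) 1) 0 (krun K Ψ)) ∧
        (∀ j, Stab h.swap (Pi.single (aq (.lowFlg j)) 1) 0 (krun K Ψ)) ∧
        (∀ j, Stab h (Pi.single (aq (.low j)) 1) 0 (krun K Ψ)) ∧
        ((∀ i i', Stab h (Pi.single (aq (.blk i)) 1 + Pi.single (aq (.blk i')) 1) 0 Ψ) →
          ∀ i i', Stab h (Pi.single (aq (.blk i)) 1 + Pi.single (aq (.blk i')) 1) 0 (krun K Ψ)) := by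
  rw [xExtraction_eq, List.map_append] at hK
  obtain ⟨K₁, K₂, rfl, hK₁, hK₂⟩ := map_eq_append hK
  rw [highExtraction_eq] at hK₁
  obtain ⟨K₁', h₁, hΨ₁⟩ := krun_gadget gadget_high hK₁
  obtain ⟨K₂', h₂, hΨ₂⟩ := krun_lowPart (List.nodup_finRange _) hK₂
  refine ⟨K₁' ++ K₂', ?_, fun Ψ hΨ hb => ?_⟩
  · intro o ho q hq
    rw [List.map_append, List.mem_append] at ho
    rcases ho with ho | ho
    · rcases h₁ o ho q hq with ⟨i, hi⟩ | ⟨i, hi⟩ <;> exact ⟨_, hi⟩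
    · exact h₂ o ho q hq
  · obtain ⟨h₃, h₄, h₅⟩ := hΨ₁ Ψ fun Φ hΦ => shiftInv_high
      (fun v hv => hΦ _ _ (fun _ => rfl) (hΨ v hv)) (hΦ _ _ (fun _ => rfl) hb)
    have hc : CodeStab h (krun K₁ Ψ) := fun v hv => h₅ _ _ _ (fun _ => rfl) (.inl rfl) (hΨ v hv)
    obtain ⟨h₆, h₇, h₈⟩ := hΨ₂ _ hc
    rw [krun_append, krun_append, ← h₃]
    refine ⟨h₆, fun i => ?_, fun j => (h₇ j (List.mem_finRange j)).2,
      fun j => (h₇ j (List.mem_finRange j)).1, fun hs i i' => ?_⟩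
    · exact h₈ _ _ _ (by simp [aq]) (by simp [aq]) (h₄ i)
    · exact h₈ _ _ _ (by simp [aq]) (by simp [aq])
        (h₅ _ _ _ (by simp [aq]) (.inl rfl) (hs i i'))

end ConcatIceberg

namespace ConcatIceberg

variable {k₁ k₂ : ℕ}

/-! ### Code states -/

theorem stab_of_mem_codeSpace {ψ : QState (Data k₁ k₂)} (hψ : ψ ∈ codeSpace k₁ k₂) (t : Half)
    {v : Data k₁ k₂ → ZMod 2} (hv : IsStabilizer v) : Stab t v 0 ψ := by
  obtain ⟨a, c, ha, rfl⟩ := hv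
  have hr : ∀ j, Stab t (rowVec k₁ k₂ j) 0 ψ := fun j => by
    rw [Stab, sgn_zero, one_smul]
    cases t
    · exact (hψ.1 j).1
    · exact (hψ.1 j).2
  have hc : ∀ i, Stab t (colVec k₁ k₂ i + colVec k₁ k₂ 0) 0 ψ := fun i => by
    rw [Stab, sgn_zero, one_smul]
    cases t
    · exact (hψ.2 i 0).1
    · exact (hψ.2 i 0).2
  -- Each column is paired with column `0`; the copies of column `0` cancel because the sum of `a`
  -- vanishes.
  have h : (fun p : Data k₁ k₂ => a p.1 + c p.2) =
      ∑ i, a i • (colVec k₁ k₂ i + colVec k₁ k₂ 0) + ∑ j, c j • rowVec k₁ k₂ j := by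
    ext p
    simp only [smul_add, Finset.sum_add_distrib, ← Finset.sum_smul, ha, zero_smul, add_zero]
    simp [colVec, rowVec]
  rw [h]
  simpa using (Stab.sum fun i _ => (hc i).smul (a i)).add
    (Stab.sum (S := Finset.univ) fun j _ => (hr j).smul (c j))

theorem Stab.prod {A B : Type} [Fintype A] [Fintype B] {t : Half} {v : A → ZMod 2} {b : ZMod 2}
    {ψ : QState A} (h : Stab t v b ψ) (χ : QState B) :
    Stab t (Sum.elim v 0) b (ψ.prod χ) := by
  have h' : ofType t (Sum.elim v 0 : A ⊕ B → ZMod 2) = (ofType t v).onLeft B := by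
    cases t <;> simp [ofType, Pauli.onLeft]
  rw [Stab, h', Pauli.onLeft_apply_prod, h]
  ext s
  exact mul_assoc _ _ _

theorem codeStab_prod {ψ : QState (Data k₁ k₂)} (hψ : ψ ∈ codeSpace k₁ k₂) (t : Half)
    (χ : QState (Anc k₁ k₂)) : CodeStab t (ψ.prod χ) :=
  fun _ hv => (stab_of_mem_codeSpace hψ t hv).prod χ

theorem QState.prod_smul {A B : Type} (ψ : QState A) (c : ℂ) (χ : QState B) :
    ψ.prod (c • χ) = c • ψ.prod χ := by
  ext s
  exact mul_left_comm _ _ _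

/-! ### Half a cycle -/

theorem prepCircuit_eq (h : Half) :
    prepCircuit k₁ k₂ h = (zeroPrep k₁ k₂).map (Op.conj h.swap) := by
  cases h
  · rfl
  · exact (List.map_id _).symm

theorem mainCircuit_eq (h : Half) : mainCircuit k₁ k₂ h = (xExtraction k₁ k₂).map (Op.conj h) := by
  cases h
  · exact (List.map_id _).symm
  · rfl

theorem prepCircuit_acts {h : Half} :
    ∀ o ∈ prepCircuit k₁ k₂ h, ∀ q, o.Acts q → ∃ a, q = aq a := by
  rw [prepCircuit_eq]
  intro o ho q hq
  obtain ⟨o', ho', rfl⟩ := List.mem_map.1 ho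
  exact zeroPrep_acts o' ho' q ((o'.acts_conj _ q).1 hq)

theorem exists_mem_of_mem_map_fst {α β : Type*} {a : α} {l : List (α × β)}
    (h : a ∈ l.map Prod.fst) : ∃ b, (a, b) ∈ l := by
  obtain ⟨p, hp, rfl⟩ := List.mem_map.1 h
  exact ⟨p.2, hp⟩

theorem Pauli.onLeft_comp {A B : Type} (E : Pauli A) (t : Half) :
    (E.onLeft B).comp t = Sum.elim (E.comp t) 0 := by
  cases t <;> rfl

/-- Rejected attempts, with whatever faults, touch only the ancillas and merely replace their state.
-/
theorem Attempt.foldl_run {h : Half} (l : List (Attempt k₁ k₂ h)) (v : ZMod 2)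
    (χ : QState (Anc k₁ k₂)) :
    ∃ χ' : QState (Anc k₁ k₂), ∀ ψ : QState (Data k₁ k₂),
      l.foldl (fun Φ A => A.run v Φ) (ψ.prod χ) = ψ.prod χ' := by
  induction l generalizing χ with
  | nil => exact ⟨χ, fun ψ => rfl⟩
  | cons A l ih =>
    have hA : ∀ o ∈ A.noisy.ops.map Prod.fst, ∀ q, o.Acts q → ∃ b, q = Sum.inr b := by
      rw [A.noisy.ops_eq]
      exact prepCircuit_acts
    obtain ⟨χ₁, h₁⟩ := foldl_noisy_onRight hA A.reset (fun _ => v) χ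
    obtain ⟨χ₂, h₂⟩ := ih χ₁
    exact ⟨χ₂, fun ψ => by rw [List.foldl_cons, ← h₂, ← h₁]; rfl⟩

theorem measOf_mem_prep (h : Half) :
    measOf h.swap (aq .chk) ∈ prepCircuit k₁ k₂ h := by
  cases h <;> simp [prepCircuit, zeroPrep, measOf, Half.swap, Op.dual]

theorem measOf_mem_main (h : Half) :
    (∀ i, measOf h (aq (.flg i)) ∈ mainCircuit k₁ k₂ h) ∧
    (∀ j, measOf h (aq (.lowFlg j)) ∈ mainCircuit k₁ k₂ h) ∧
    (∀ i, measOf h.swap (aq (.blk i)) ∈ mainCircuit k₁ k₂ h) ∧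
    (∀ j, measOf h.swap (aq (.low j)) ∈ mainCircuit k₁ k₂ h) := by
  have h₁ : ∀ o ∈ xExtraction k₁ k₂, o.conj h ∈ mainCircuit k₁ k₂ h := fun o ho => by
    rw [mainCircuit_eq]
    exact List.mem_map_of_mem ho
  refine ⟨fun i => ?_, fun j => ?_, fun i => ?_, fun j => ?_⟩
  · rw [← measOf_eq]
    exact h₁ _ (by simp [xExtraction, highExtraction])
  · rw [← measOf_eq]
    exact h₁ _ (List.mem_append_right _ (List.mem_flatMap.2
      ⟨j, List.mem_finRange j, by simp [lowExtraction]⟩))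
  · rw [← measOf_swap_eq]
    exact h₁ _ (by simp [xExtraction, highExtraction])
  · rw [← measOf_swap_eq]
    exact h₁ _ (List.mem_append_right _ (List.mem_flatMap.2
      ⟨j, List.mem_finRange j, by simp [lowExtraction]⟩))

/-- The Pauli operator after the accepted preparation of the block. -/
def HalfRun.prepFrame {h : Half} (H : HalfRun k₁ k₂ h) (E : Pauli (Data k₁ k₂)) :
    Pauli (Qubit k₁ k₂) :=
  frame H.accepted.noisy.ops (E.onLeft _)

/-- The Pauli operator after half a cycle. -/
def HalfRun.outFrame {h : Half} (H : HalfRun k₁ k₂ h) (E : Pauli (Data k₁ k₂)) :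
    Pauli (Qubit k₁ k₂) :=
  frame H.main.ops (H.prepFrame E)

/-- The passage from quantum states to linear algebra. A single code state `ψ₀` for which the
history does not vanish suffices to determine the outcomes; the formula for the output then holds
for all code states. -/
theorem HalfRun.run_prod {h : Half} (H : HalfRun k₁ k₂ h) (E : Pauli (Data k₁ k₂))
    (χ : QState (Anc k₁ k₂)) {ψ₀ : QState (Data k₁ k₂)} (hψ₀ : ψ₀ ∈ codeSpace k₁ k₂)
    (hne : H.run ((E.apply ψ₀).prod χ) ≠ 0) :
    (∃ χ' : QState (Anc k₁ k₂), ∀ ψ ∈ codeSpace k₁ k₂,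
      H.run ((E.apply ψ).prod χ) = ((H.outFrame E).left.apply ψ).prod χ') ∧
    (H.prepFrame E).comp h.swap (aq .chk) = 0 ∧
    (∀ i, H.meas (aq (.flg i)) = (H.outFrame E).comp h (aq (.flg i))) ∧
    (∀ j, H.meas (aq (.lowFlg j)) = (H.outFrame E).comp h (aq (.lowFlg j))) ∧
    (∃ c, ∀ i, H.meas (aq (.blk i)) = (H.outFrame E).comp h.swap (aq (.blk i)) + c) ∧
    ∀ j, H.meas (aq (.low j)) = (H.outFrame E).comp h.swap (aq (.low j)) := by
  obtain ⟨χ₁, h₁⟩ := Attempt.foldl_run H.rejected 1 χ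
  have hwp : WellFormed (H.accepted.noisy.ops.map Prod.fst) := by
    rw [H.accepted.noisy.ops_eq, prepCircuit_eq]
    exact zeroPrep_wellFormed.conj _
  have hwm : WellFormed (H.main.ops.map Prod.fst) := by
    rw [H.main.ops_eq, mainCircuit_eq]
    exact xExtraction_wellFormed.conj _
  obtain ⟨c₁, K₁, hK₁, hΨ₁, hm₁⟩ := foldl_noisy_apply hwp H.accepted.reset (fun _ => 0) (E.onLeft _)
  obtain ⟨c₂, K₂, hK₂, hΨ₂, hm₂⟩ := foldl_noisy_apply hwm H.reset H.meas (H.prepFrame E)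
  have hrun : ∀ ψ, H.run ((E.apply ψ).prod χ) =
      (c₁ * c₂) • (H.outFrame E).apply (krun K₂ (krun K₁ (ψ.prod χ₁))) := fun ψ => by
    rw [HalfRun.run, h₁, ← Pauli.onLeft_apply_prod, Attempt.run, Noisy.run, Noisy.run, hΨ₁,
      foldl_noisy_smul]
    change c₁ • H.main.ops.foldl _ ((H.prepFrame E).apply _) = _
    rw [hΨ₂, smul_smul]
    rfl
  have hK₁' := hK₁.trans H.accepted.noisy.ops_eq
  have hK₂' := hK₂.trans H.main.ops_eq
  have hK₁'' := hK₁'.trans (prepCircuit_eq h)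
  have hK₂'' := hK₂'.trans (mainCircuit_eq h)
  obtain ⟨χ₂, h₂⟩ := krun_onRight (A := Data k₁ k₂) (K := K₁)
    (by rw [hK₁']; exact prepCircuit_acts) χ₁
  obtain ⟨K₃, hK₃, hΨ₃⟩ := krun_main hK₂''
  obtain ⟨χ₃, h₃⟩ := krun_onRight (A := Data k₁ k₂) hK₃ χ₂
  have hcode : ∀ ψ ∈ codeSpace k₁ k₂, CodeStab h (krun K₁ (ψ.prod χ₁)) := fun ψ hψ => by
    rw [h₂]
    exact codeStab_prod hψ h χ₂
  have hne₂ : krun K₂ (krun K₁ (ψ₀.prod χ₁)) ≠ 0 := by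
    intro h₀
    apply hne
    rw [hrun, h₀]
    have := (H.outFrame E).apply_smul 0 0
    simp only [zero_smul] at this
    rw [this, smul_zero]
  have hne₁ : krun K₁ (ψ₀.prod χ₁) ≠ 0 := by
    intro h₀
    rw [h₀, krun_zero] at hne₂
    exact hne₂ rfl
  obtain ⟨hp₁, hp₂, hp₃⟩ := krun_prep hK₁'' (ψ₀.prod χ₁)
  obtain ⟨-, hf, hlf, hl, hb⟩ := hΨ₃ _ (hcode ψ₀ hψ₀) hp₁
  have hb := hb hp₂
  have hw₁ : WellFormed (K₁.map Prod.fst) := hK₁ ▸ hwp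
  have hw₂ : WellFormed (K₂.map Prod.fst) := hK₂ ▸ hwm
  -- The state after the faultless circuit is an eigenstate with the shifted outcome as eigenvalue.
  -- If the eigenvalue is known from `krun_main`, the two must agree because the state is nonzero.
  have hval : ∀ {t : Half} {q : Qubit k₁ k₂}, measOf t q ∈ mainCircuit k₁ k₂ h →
      ∃ b, b = H.meas q + (H.outFrame E).comp t q ∧
        Stab t.swap (Pi.single q 1) b (krun K₂ (krun K₁ (ψ₀.prod χ₁))) := by
    intro t q hq
    obtain ⟨b, hb⟩ := exists_mem_of_mem_map_fst (hK₂'.symm ▸ hq)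
    exact ⟨b, hm₂ t q b hb, stab_of_measOf_mem hw₂ hb _⟩
  obtain ⟨hmf, hmlf, hmb, hml⟩ := measOf_mem_main (k₁ := k₁) (k₂ := k₂) h
  refine ⟨⟨(c₁ * c₂) • (H.outFrame E).right.apply χ₃, fun ψ hψ => ?_⟩, ?_, fun i => ?_, fun j => ?_,
    ?_, fun j => ?_⟩
  · rw [hrun, (hΨ₃ _ (hcode ψ hψ) (krun_prep hK₁'' _).1).1, h₂, h₃, Pauli.apply_prod,
      QState.prod_smul]
  · obtain ⟨b, hb⟩ := exists_mem_of_mem_map_fst (hK₁'.symm ▸ measOf_mem_prep (k₁ := k₁) (k₂ := k₂) h)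
    have h₄ := stab_of_measOf_mem hw₁ hb (ψ₀.prod χ₁)
    rw [Half.swap_swap] at h₄
    have h₅ := hm₁ _ _ _ hb
    rw [h₄.unique hp₃ hne₁, zero_add] at h₅
    exact h₅.symm
  · obtain ⟨b, hb, hs⟩ := hval (hmf i)
    rw [hs.unique (hf i) hne₂] at hb
    exact CharTwo.add_eq_zero.1 hb.symm
  · obtain ⟨b, hb, hs⟩ := hval (hmlf j)
    rw [hs.unique (hlf j) hne₂] at hb
    exact CharTwo.add_eq_zero.1 hb.symm
  · obtain ⟨b₀, hb₀, hs₀⟩ := hval (hmb 0)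
    refine ⟨b₀, fun i => ?_⟩
    obtain ⟨b, hb', hs⟩ := hval (hmb i)
    rw [Half.swap_swap] at hs hs₀
    have h₆ := CharTwo.add_eq_zero.1 ((hs.add hs₀).unique (hb i 0) hne₂)
    rw [← h₆, hb', add_comm, add_assoc, zmod_two_add_self, add_zero]
  · obtain ⟨b, hb, hs⟩ := hval (hml j)
    rw [Half.swap_swap] at hs
    rw [hs.unique (hl j) hne₂] at hb
    exact CharTwo.add_eq_zero.1 hb.symm

theorem prop_prep_elim {h t : Half} (e : Data k₁ k₂ → ZMod 2) :
    prop ((prepCircuit k₁ k₂ h).map (Op.conj t)) (Sum.elim e 0) = Sum.elim e 0 := by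
  refine prop_fixed fun o ho => Op.push_of_forall_acts _ _ fun q hq => ?_
  obtain ⟨o', ho', rfl⟩ := List.mem_map.1 ho
  obtain ⟨a, rfl⟩ := prepCircuit_acts o' ho' q ((o'.acts_conj _ q).1 hq)
  rfl

/-- The error caused by at most one fault in half a cycle. -/
theorem HalfRun.outFrame_comp {h : Half} (H : HalfRun k₁ k₂ h) (hf : H.faults ≤ 1)
    (E : Pauli (Data k₁ k₂)) (t : Half) :
    ∃ G G', (H.prepFrame E).comp t = Sum.elim (E.comp t) 0 + G ∧
      (H.outFrame E).comp t =
        prop ((mainCircuit k₁ k₂ h).map (Op.conj t)) (Sum.elim (E.comp t) 0 + G) + G' ∧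
      ((G = 0 ∧ G' = 0) ∨
        (0 < H.faults ∧ FaultOut ((prepCircuit k₁ k₂ h).map (Op.conj t)) G ∧ G' = 0) ∨
        (0 < H.faults ∧ G = 0 ∧ FaultOut ((mainCircuit k₁ k₂ h).map (Op.conj t)) G')) := by
  -- A fault in a rejected attempt belongs to the first case: it has no effect on the frame.
  have hf' : (H.accepted.noisy.faults = 0 ∧ H.main.faults = 0) ∨
      (0 < H.faults ∧ H.accepted.noisy.faults ≤ 1 ∧ H.main.faults = 0) ∨
      (0 < H.faults ∧ H.accepted.noisy.faults = 0 ∧ H.main.faults ≤ 1) := by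
    rw [HalfRun.faults] at hf ⊢
    omega
  have hp : H.accepted.noisy.faults = 0 → (H.prepFrame E).comp t = Sum.elim (E.comp t) 0 := by
    intro h₀
    rw [HalfRun.prepFrame, frame_comp_of_no_fault h₀, H.accepted.noisy.ops_eq, Pauli.onLeft_comp,
      prop_prep_elim]
  have hm : H.main.faults = 0 → (H.outFrame E).comp t =
      prop ((mainCircuit k₁ k₂ h).map (Op.conj t)) ((H.prepFrame E).comp t) := by
    intro h₀
    rw [HalfRun.outFrame, frame_comp_of_no_fault h₀, H.main.ops_eq]
  rcases hf' with ⟨h₁, h₂⟩ | ⟨h₀, h₁, h₂⟩ | ⟨h₀, h₁, h₂⟩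
  · exact ⟨0, 0, by rw [hp h₁, add_zero], by rw [hm h₂, hp h₁, add_zero, add_zero], .inl ⟨rfl, rfl⟩⟩
  · obtain ⟨G, hG, hG'⟩ := frame_comp_of_one_fault h₁ (E.onLeft _) t
    rw [H.accepted.noisy.ops_eq, Pauli.onLeft_comp, prop_prep_elim] at hG
    rw [H.accepted.noisy.ops_eq] at hG'
    refine ⟨G, 0, hG, ?_, hG'.imp (fun h => ⟨h, rfl⟩) fun h => .inl ⟨h₀, h, rfl⟩⟩
    rw [hm h₂, add_zero, ← hG]
    rfl
  · obtain ⟨G, hG, hG'⟩ := frame_comp_of_one_fault h₂ (H.prepFrame E) t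
    rw [H.main.ops_eq, hp h₁] at hG
    rw [H.main.ops_eq] at hG'
    refine ⟨0, G, by rw [hp h₁, add_zero], by rw [add_zero]; exact hG,
      hG'.imp (fun h => ⟨rfl, h⟩) fun h => .inr ⟨h₀, rfl, h⟩⟩

/-- The syndromes of half a cycle for the errors `e`, when the outcomes of the block and of the
row ancillas are flipped by `β` and `l`. -/
def HalfRun.Syndromes {h : Half} (H : HalfRun k₁ k₂ h) (e : Data k₁ k₂ → ZMod 2)
    (β : Fin (k₁ + 2) → ZMod 2) (l : Fin (k₂ + 2) → ZMod 2) : Prop :=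
  (∃ c, ∀ i, H.meas (aq (.blk i)) = ∑ j, e (i, j) + β i + c) ∧
    ∀ j, H.meas (aq (.low j)) = ∑ i, e (i, j) + l j

theorem eq_single_of_forall_ne {α : Type*} [DecidableEq α] {g : α → ZMod 2} {a : α}
    (h : ∀ a', a' ≠ a → g a' = 0) : g = Pi.single a (g a) := by
  ext a'
  by_cases ha : a' = a
  · rw [ha, Pi.single_eq_same]
  · rw [h a' ha, Pi.single_eq_of_ne ha]

/-- Errors of type `h` already present on the data pass unchanged and invisibly, so the flags and
the difference between output and input are due to the fault alone. -/
theorem HalfRun.hook_errors {h : Half} (H : HalfRun k₁ k₂ h) (hf : H.faults ≤ 1)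
    {E : Pauli (Data k₁ k₂)}
    (hflg : ∀ i, H.meas (aq (.flg i)) = (H.outFrame E).comp h (aq (.flg i)))
    (hlow : ∀ j, H.meas (aq (.lowFlg j)) = (H.outFrame E).comp h (aq (.lowFlg j))) :
    (∃ s, IsStabilizer s ∧
      Hook H.highFlags H.lowFlags ((H.outFrame E).left.comp h + E.comp h + s)) ∧
    (H.faults = 0 → H.highFlags = ∅ ∧ H.lowFlags = ∅ ∧ (H.outFrame E).left.comp h = E.comp h) := by
  have hV : H.highFlags = Finset.univ.filter fun i => (H.outFrame E).comp h (aq (.flg i)) = 1 := by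
    simp only [HalfRun.highFlags, hflg]
  have hH : H.lowFlags = Finset.univ.filter fun j => (H.outFrame E).comp h (aq (.lowFlg j)) = 1 := by
    simp only [HalfRun.lowFlags, hlow]
  rw [hV, hH]
  obtain ⟨G, G', -, hF, hG⟩ := H.outFrame_comp hf E h
  rw [mainCircuit_eq, map_conj_conj_self] at hF hG
  have hd : (H.outFrame E).left.comp h =
      E.comp h + (fun p => G (aq (.blk p.1))) + (fun p => G (dq p.1 p.2) + G' (dq p.1 p.2)) := by
    ext ⟨i, j⟩
    rw [Pauli.left_comp, hF]
    change prop _ _ (dq i j) + G' (dq i j) = _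
    rw [xExtraction_data]
    change E.comp h (i, j) + G (dq i j) + (0 + G (aq (.blk i))) + _ = _
    simp only [Pi.add_apply]
    ring
  have hflg' : ∀ i, (H.outFrame E).comp h (aq (.flg i)) = G' (aq (.flg i)) := fun i => by
    rw [hF, Pi.add_apply, xExtraction_flg, zero_add]
  have hlow' : ∀ j, (H.outFrame E).comp h (aq (.lowFlg j)) = G' (aq (.lowFlg j)) := fun j => by
    rw [hF, Pi.add_apply, xExtraction_lowFlg, zero_add]
  simp only [hflg', hlow']
  have hsum : ∀ u : Data k₁ k₂ → ZMod 2, E.comp h + u + E.comp h = u := fun u => by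
    rw [add_right_comm, vec_add_self, zero_add]
  constructor
  · rcases hG with ⟨rfl, rfl⟩ | ⟨-, hG, rfl⟩ | ⟨-, rfl, hG⟩
    · refine ⟨0, isStabilizer_zero, .inl ⟨filter_eq_empty fun _ => rfl, filter_eq_empty fun _ => rfl,
        (0, 0), fun p _ => ?_⟩⟩
      rw [hd]
      simp [zmod_two_add_self]
    · have hG₀ : ∀ i j, G (dq i j) = 0 := by
        refine fun i j => faultOut_anc (fun o ho q hq => ?_) hG i j
        obtain ⟨o', ho', rfl⟩ := List.mem_map.1 ho
        exact prepCircuit_acts o' ho' q ((o'.acts_conj _ q).1 hq)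
      have hd' : (H.outFrame E).left.comp h + E.comp h = fun p => G (aq (.blk p.1)) := by
        rw [hd]
        ext p
        simp only [Pi.add_apply, hG₀, Pi.zero_apply, add_zero]
        rw [add_right_comm, zmod_two_add_self, zero_add]
      rw [hd']
      simp only [Pi.zero_apply]
      rw [filter_eq_empty fun _ => rfl, filter_eq_empty fun _ => rfl]
      -- A preparation fault becomes a set of complete columns. An even number of them is a
      -- stabilizer, an odd number is equivalent to column `0`.
      rcases zmod_two_cases (∑ i, G (aq (.blk i))) with h₀ | h₁
      · refine ⟨fun p => G (aq (.blk p.1)), ⟨fun i => G (aq (.blk i)), 0, h₀, by simp⟩,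
          .inl ⟨rfl, rfl, (0, 0), fun p _ => ?_⟩⟩
        exact zmod_two_add_self _
      · refine ⟨fun p => G (aq (.blk p.1)) + colVec k₁ k₂ 0 p,
          ⟨fun i => G (aq (.blk i)) + Pi.single (M := fun _ => ZMod 2) 0 1 i, 0, ?_, ?_⟩,
          .inr (.inr (.inr ⟨rfl, rfl, 0, ?_⟩))⟩
        · rw [Finset.sum_add_distrib, h₁]
          simp [zmod_two_add_self]
        · ext p
          simp [colVec, Pi.single_apply]
        · ext p
          simp only [Pi.add_apply]
          rw [← add_assoc, zmod_two_add_self, zero_add]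
    · obtain ⟨s, hs, hs'⟩ := faultOut_xExtraction hG
      refine ⟨s, hs, ?_⟩
      rw [hd]
      simp only [Pi.zero_apply, zero_add]
      change Hook _ _ (E.comp h + 0 + _ + E.comp h + s)
      rw [add_zero, hsum]
      exact hs'
  · intro h₀
    rcases hG with ⟨rfl, rfl⟩ | ⟨h₁, -⟩ | ⟨h₁, -⟩
    · refine ⟨filter_eq_empty fun _ => rfl, filter_eq_empty fun _ => rfl, ?_⟩
      rw [hd]
      ext p
      simp
    · omega
    · omega

/-- The fault flips the outcome of column `i` by `b` and that of row `j` by `l`, and adds the error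
`d` at `(i, j)`. The syndromes refer to the errors at the input of the half. -/
theorem HalfRun.detected_errors (hk : Even k₁) {h : Half} (H : HalfRun k₁ k₂ h) (hf : H.faults ≤ 1)
    {E : Pauli (Data k₁ k₂)} (hchk : (H.prepFrame E).comp h.swap (aq .chk) = 0)
    (hblk : ∃ c, ∀ i, H.meas (aq (.blk i)) = (H.outFrame E).comp h.swap (aq (.blk i)) + c)
    (hlow : ∀ j, H.meas (aq (.low j)) = (H.outFrame E).comp h.swap (aq (.low j))) :
    ∃ i j b l d, (d = 0 → b = 0 ∨ l = 0) ∧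
      (H.outFrame E).left.comp h.swap = E.comp h.swap + Pi.single (i, j) d ∧
      H.Syndromes (E.comp h.swap) (Pi.single i b) (Pi.single j l) ∧
      (H.faults = 0 → b = 0 ∧ l = 0 ∧ d = 0) := by
  obtain ⟨c, hblk⟩ := hblk
  obtain ⟨G, G', hP, hF, hG⟩ := H.outFrame_comp hf E h.swap
  rw [mainCircuit_eq, map_conj_conj_swap] at hF hG
  rw [prepCircuit_eq, map_conj_conj_self] at hG
  have hG₀ : ∀ i j, G (dq i j) = 0 := by
    rcases hG with ⟨rfl, -⟩ | ⟨-, hG, -⟩ | ⟨-, rfl, -⟩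
    · exact fun _ _ => rfl
    · exact fun i j => faultOut_anc zeroPrep_acts hG i j
    · exact fun _ _ => rfl
  have hd : (H.outFrame E).left.comp h.swap = E.comp h.swap + fun p => G' (dq p.1 p.2) := by
    ext ⟨i, j⟩
    rw [Pauli.left_comp, hF]
    change prop _ _ (dq i j) + G' (dq i j) = _
    rw [xExtraction_dual_data, Pi.add_apply, hG₀, add_zero]
    rfl
  have hb : ∀ i, H.meas (aq (.blk i)) =
      ∑ j, E.comp h.swap (i, j) + (G (aq (.blk i)) + G' (aq (.blk i))) + c := fun i => by
    rw [hblk, hF, Pi.add_apply, xExtraction_dual_blk]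
    simp only [Pi.add_apply, hG₀, add_zero]
    change 0 + G (aq (.blk i)) + ∑ j, E.comp h.swap (i, j) + _ + c = _
    ring
  have hl : ∀ j, H.meas (aq (.low j)) = ∑ i, E.comp h.swap (i, j) + G' (aq (.low j)) := fun j => by
    rw [hlow, hF, Pi.add_apply, xExtraction_dual_low]
    simp only [Pi.add_apply, hG₀, add_zero]
    rfl
  rcases hG with ⟨rfl, rfl⟩ | ⟨h₀, hG, rfl⟩ | ⟨h₀, rfl, hG⟩
  · refine ⟨0, 0, 0, 0, 0, by simp, ?_, ⟨⟨c, fun i => ?_⟩, fun j => ?_⟩, by simp⟩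
    · rw [hd, Pi.single_zero]
      rfl
    · simp [hb]
    · simp [hl]
  · have hchk' : G (aq .chk) = 0 := by
      rw [hP] at hchk
      simpa [aq] using hchk
    -- The common value `a` is absorbed in the unknown flip of all block outcomes; what remains
    -- concerns the single column `i`.
    obtain ⟨a, i, ha⟩ := faultOut_zeroPrep hk hG hchk'
    refine ⟨i, 0, G (aq (.blk i)) + a, 0, 0, by simp, ?_, ⟨⟨c + a, fun i' => ?_⟩, fun j => ?_⟩,
      by omega⟩
    · rw [hd, Pi.single_zero]
      rfl
    · rw [hb]
      by_cases hi : i' = i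
      · rw [hi, Pi.single_eq_same, Pi.zero_apply, add_zero]
        linear_combination -(zmod_two_add_self a)
      · rw [ha i' hi, Pi.single_eq_of_ne hi, Pi.zero_apply]
        ring
    · simp [hl]
  · obtain ⟨i, j, h₁, h₂, h₃, h₄⟩ := faultOut_xExtraction_dual hG
    refine ⟨i, j, G' (aq (.blk i)), G' (aq (.low j)), G' (dq i j), h₄, ?_,
      ⟨⟨c, fun i' => ?_⟩, fun j' => ?_⟩, by omega⟩
    · rw [hd]
      congr 1
      exact eq_single_of_forall_ne (g := fun p : Data k₁ k₂ => G' (dq p.1 p.2)) (a := (i, j))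
        fun p hp => h₁ p.1 p.2 hp
    · rw [hb, ← congrFun (eq_single_of_forall_ne (g := fun i => G' (aq (.blk i))) h₂) i',
        Pi.zero_apply, zero_add]
    · rw [hl, ← congrFun (eq_single_of_forall_ne (g := fun j => G' (aq (.low j))) h₃) j']

end ConcatIceberg

namespace ConcatIceberg

variable {k₁ k₂ : ℕ}

/-! ### Syndromes -/

theorem HalfRun.highSyndrome_eq_or {h : Half} (H : HalfRun k₁ k₂ h) {w : Fin (k₁ + 2) → ZMod 2}
    {c : ZMod 2} (hw : ∀ i, H.meas (aq (.blk i)) = w i + c) :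
    H.highSyndrome = Finset.univ.filter (fun i => w i = 1) ∨
      H.highSyndrome = (Finset.univ.filter fun i => w i = 1)ᶜ := by
  have h : (Finset.univ.filter fun i => H.meas (aq (.blk i)) ≠ H.meas (aq (.blk 0))) =
      Finset.univ.filter (fun i => w i = 1) ∨
      (Finset.univ.filter fun i => H.meas (aq (.blk i)) ≠ H.meas (aq (.blk 0))) =
        (Finset.univ.filter fun i => w i = 1)ᶜ := by
    simp only [hw, ne_eq, add_left_inj]
    rcases zmod_two_cases (w 0) with h₀ | h₀
    · left
      ext i
      rcases zmod_two_cases (w i) with h | h <;> simp [h, h₀]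
    · right
      ext i
      rcases zmod_two_cases (w i) with h | h <;> simp [h, h₀]
  rw [HalfRun.highSyndrome]
  split_ifs
  · exact h
  · rcases h with h | h <;> rw [h]
    · exact .inr rfl
    · rw [compl_compl]
      exact .inl rfl

theorem HalfRun.two_mul_card_highSyndrome_le {h : Half} (H : HalfRun k₁ k₂ h) :
    2 * H.highSyndrome.card ≤ k₁ + 2 := by
  rw [HalfRun.highSyndrome]
  split_ifs with h
  · exact h
  · rw [Finset.card_compl, Fintype.card_fin]
    omega

/-- A set of fewer than half of the columns is the smaller one of the two complementary candidates,
so there is no ambiguity. -/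
theorem HalfRun.highSyndrome_eq {h : Half} (H : HalfRun k₁ k₂ h) {w : Fin (k₁ + 2) → ZMod 2}
    {c : ZMod 2} (hw : ∀ i, H.meas (aq (.blk i)) = w i + c)
    (hcard : 2 * (Finset.univ.filter fun i => w i = 1).card < k₁ + 2) :
    H.highSyndrome = Finset.univ.filter fun i => w i = 1 := by
  rcases H.highSyndrome_eq_or hw with h | h
  · exact h
  · have h' := H.two_mul_card_highSyndrome_le
    rw [h, Finset.card_compl, Fintype.card_fin] at h'
    omega

theorem filter_single (n : ℕ) (i : Fin n) (b : ZMod 2) :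
    (Finset.univ.filter fun i' => (Pi.single i b : Fin n → ZMod 2) i' = 1) =
      if b = 1 then {i} else ∅ := by
  rcases zmod_two_cases b with rfl | rfl
  · simp
  · ext i'
    by_cases h : i' = i <;> simp [h, Pi.single_apply]

theorem HalfRun.highSyndrome_single (hk : 0 < k₁) {h : Half} (H : HalfRun k₁ k₂ h)
    {i : Fin (k₁ + 2)} {b c : ZMod 2}
    (hw : ∀ i', H.meas (aq (.blk i')) = (Pi.single i b : Fin (k₁ + 2) → ZMod 2) i' + c) :
    H.highSyndrome = if b = 1 then {i} else ∅ := by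
  have hc : (Finset.univ.filter fun i' => (Pi.single i b : Fin (k₁ + 2) → ZMod 2) i' = 1).card ≤ 1 := by
    rw [filter_single]
    split_ifs <;> simp
  rw [H.highSyndrome_eq hw (by omega), filter_single]

theorem HalfRun.lowSyndrome_single {h : Half} (H : HalfRun k₁ k₂ h) {j : Fin (k₂ + 2)} {l : ZMod 2}
    (hl : ∀ j', H.meas (aq (.low j')) = (Pi.single j l : Fin (k₂ + 2) → ZMod 2) j') :
    H.lowSyndrome = if l = 1 then {j} else ∅ := by
  simp only [HalfRun.lowSyndrome, hl, filter_single]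

theorem even_cast_zmod_two {n : ℕ} (hn : Even n) : (n : ZMod 2) = 0 :=
  (ZMod.natCast_eq_zero_iff_even).2 hn

/-- The syndromes do not depend on the choice of an error modulo stabilizers. -/
theorem IsStabilizer.syndrome {s : Data k₁ k₂ → ZMod 2} (hk₁ : Even k₁) (hk₂ : Even k₂)
    (hs : IsStabilizer s) :
    (∃ c, ∀ i, ∑ j, s (i, j) = c) ∧ ∀ j, ∑ i, s (i, j) = 0 := by
  obtain ⟨a, c, ha, rfl⟩ := hs
  have h₁ : ((k₁ : ZMod 2) + 2) = 0 := by exact_mod_cast even_cast_zmod_two (hk₁.add even_two)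
  have h₂ : ((k₂ : ZMod 2) + 2) = 0 := by exact_mod_cast even_cast_zmod_two (hk₂.add even_two)
  refine ⟨⟨∑ j, c j, fun i => ?_⟩, fun j => ?_⟩
  · simp [Finset.sum_add_distrib, h₂]
  · simp [Finset.sum_add_distrib, h₁, ha]

theorem HalfRun.Syndromes.add_stabilizer {h : Half} {H : HalfRun k₁ k₂ h}
    {e s : Data k₁ k₂ → ZMod 2} {β : Fin (k₁ + 2) → ZMod 2} {l : Fin (k₂ + 2) → ZMod 2}
    (hk₁ : Even k₁) (hk₂ : Even k₂) (hH : H.Syndromes e β l) (hs : IsStabilizer s) :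
    H.Syndromes (e + s) β l := by
  obtain ⟨⟨c, hb⟩, hl⟩ := hH
  obtain ⟨⟨a, ha⟩, h₀⟩ := hs.syndrome hk₁ hk₂
  refine ⟨⟨c + a, fun i => ?_⟩, fun j => ?_⟩
  · rw [hb]
    simp only [Pi.add_apply, Finset.sum_add_distrib, ha]
    linear_combination -(zmod_two_add_self a)
  · rw [hl]
    simp only [Pi.add_apply, Finset.sum_add_distrib, h₀, add_zero]

/-! ### The decoder -/

theorem setVec_empty : setVec (∅ : Finset (Data k₁ k₂)) = 0 := by
  ext p
  simp [setVec]

theorem setVec_singleton (i : Fin (k₁ + 2)) (j : Fin (k₂ + 2)) :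
    setVec ({i} ×ˢ {j} : Finset (Data k₁ k₂)) = Pi.single (i, j) 1 := by
  ext ⟨i', j'⟩
  simp [setVec, Pi.single_apply]

theorem decode_empty (o : HookOrigin) (st : Status) :
    decode (k₁ := k₁) (k₂ := k₂) o st ∅ ∅ ∅ ∅ = some (∅, ⟨false, true⟩) := by
  simp [decode]

theorem decode_single (o : HookOrigin) (st : Status) (i : Fin (k₁ + 2)) (j : Fin (k₂ + 2)) :
    decode o st ∅ ∅ {i} {j} =
      if st.inputErrorAllowed then some (({i} ×ˢ {j} : Finset (Data k₁ k₂)), ⟨false, false⟩)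
      else if st.prevFailure then none else some ({i} ×ˢ {j}, ⟨true, false⟩) := by
  simp only [decode, asInput, asInternal, and_self, if_true, Finset.singleton_ne_empty, if_false,
    false_and, Finset.card_singleton]
  split_ifs <;> rfl

theorem decode_high_single (o : HookOrigin) {st : Status} (hst : st.prevFailure = false)
    (i : Fin (k₁ + 2)) :
    decode (k₁ := k₁) (k₂ := k₂) o st ∅ ∅ {i} ∅ = some (∅, ⟨true, true⟩) := by
  simp [decode, asInternal, hst]

theorem decode_low_single (o : HookOrigin) {st : Status} (hst : st.prevFailure = false)
    (j : Fin (k₂ + 2)) :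
    decode (k₁ := k₁) (k₂ := k₂) o st ∅ ∅ ∅ {j} = some (∅, ⟨true, true⟩) := by
  have h : ({j} : Finset (Fin (k₂ + 2))) ≠ Finset.univ := by
    intro h
    have := congrArg Finset.card h
    simp at this
  simp [decode, asInternal, hst, h]

/-- The decoder corrects a single error. -/
theorem decode_single_error (hk₁ : 0 < k₁) {h : Half} (H : HalfRun k₁ k₂ h) {o : HookOrigin}
    {st : Status} (hst : st.inputErrorAllowed = true ∨ st.prevFailure = false)
    {e : Data k₁ k₂ → ZMod 2} {q : Data k₁ k₂} (he : ∀ p, p ≠ q → e p = 0) (hH : H.Syndromes e 0 0) :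
    ∃ C st', decode o st ∅ ∅ H.highSyndrome H.lowSyndrome = some (C, st') ∧
      (st.inputErrorAllowed = true → st'.prevFailure = false) ∧ setVec C = e := by
  obtain ⟨i, j⟩ := q
  have he' := eq_single_of_forall_ne he
  obtain ⟨⟨c, hb⟩, hl⟩ := hH
  have hX : H.highSyndrome = if e (i, j) = 1 then {i} else ∅ := by
    refine H.highSyndrome_single hk₁ (c := c) fun i' => ?_
    rw [hb, Pi.zero_apply, add_zero]
    congr 1
    by_cases hi : i' = i
    · subst hi
      rw [Pi.single_eq_same]
      exact Finset.sum_eq_single _ (fun j' _ hj => he _ (by simpa using hj)) (by simp)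
    · rw [Pi.single_eq_of_ne hi]
      exact Finset.sum_eq_zero fun j' _ => he _ (by simp [hi])
  have hY : H.lowSyndrome = if e (i, j) = 1 then {j} else ∅ := by
    refine H.lowSyndrome_single fun j' => ?_
    rw [hl, Pi.zero_apply, add_zero]
    by_cases hj : j' = j
    · subst hj
      rw [Pi.single_eq_same]
      exact Finset.sum_eq_single _ (fun i' _ hi => he _ (by simpa using hi)) (by simp)
    · rw [Pi.single_eq_of_ne hj]
      exact Finset.sum_eq_zero fun i' _ => he _ (by simp [hj])
  rw [hX, hY]
  rcases zmod_two_cases (e (i, j)) with h | h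
  · rw [h, if_neg zero_ne_one, if_neg zero_ne_one, decode_empty]
    refine ⟨_, _, rfl, fun _ => rfl, ?_⟩
    rw [he', h, setVec_empty, Pi.single_zero]
  · rw [h, if_pos rfl, if_pos rfl, decode_single]
    have hC : setVec ({i} ×ˢ {j} : Finset (Data k₁ k₂)) = e := by
      rw [he', h, setVec_singleton]
    by_cases hA : st.inputErrorAllowed = true
    · exact ⟨_, _, if_pos hA, fun _ => rfl, hC⟩
    · rw [if_neg hA, hst.resolve_left hA]
      exact ⟨_, _, rfl, fun h => absurd h hA, hC⟩

/-- The decoder in a cycle without an error at the input and with at most one fault among the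
operations that detect errors of the type to be decoded. -/
theorem decode_internal_fault (hk₁ : 0 < k₁) (hk₁' : Even k₁) (hk₂' : Even k₂) {h : Half}
    (H : HalfRun k₁ k₂ h) (o : HookOrigin) {st : Status} (hst : st.prevFailure = false)
    {e : Data k₁ k₂ → ZMod 2} (he : IsStabilizer e) {i : Fin (k₁ + 2)} {j : Fin (k₂ + 2)}
    {b l d : ZMod 2} (hd : d = 0 → b = 0 ∨ l = 0)
    (hH : H.Syndromes e (Pi.single i b) (Pi.single j l)) :
    ∃ C st', decode o st ∅ ∅ H.highSyndrome H.lowSyndrome = some (C, st') ∧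
      (IsStabilizer (e + Pi.single (i, j) d + setVec C) ∨
        (st'.inputErrorAllowed = true ∧ setVec C = 0)) := by
  obtain ⟨⟨c, hb⟩, hl⟩ := hH
  obtain ⟨⟨a, ha⟩, h₀⟩ := he.syndrome hk₁' hk₂'
  have hX : H.highSyndrome = if b = 1 then {i} else ∅ :=
    H.highSyndrome_single hk₁ (c := a + c) fun i' => by rw [hb, ha]; ring
  have hY : H.lowSyndrome = if l = 1 then {j} else ∅ :=
    H.lowSyndrome_single fun j' => by rw [hl, h₀, zero_add]
  rw [hX, hY]
  -- With no or one coordinate visible nothing is corrected, and a possible error `d` is left for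
  -- the next cycle with `inputErrorAllowed` set. With both visible, `hd` guarantees an error at
  -- exactly the corrected place.
  rcases zmod_two_cases b with rfl | rfl <;> rcases zmod_two_cases l with rfl | rfl
  · exact ⟨∅, ⟨false, true⟩, by simp [decode_empty], .inr ⟨rfl, setVec_empty⟩⟩
  · exact ⟨∅, ⟨true, true⟩, by simp [decode_low_single o hst], .inr ⟨rfl, setVec_empty⟩⟩
  · exact ⟨∅, ⟨true, true⟩, by simp [decode_high_single o hst], .inr ⟨rfl, setVec_empty⟩⟩
  · have hd' : d = 1 := by
      rcases zmod_two_cases d with h | h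
      · simpa using hd h
      · exact h
    rw [if_pos rfl, if_pos rfl, decode_single, hst, hd']
    have hC : IsStabilizer (e + Pi.single (i, j) 1 + setVec ({i} ×ˢ {j} : Finset (Data k₁ k₂))) := by
      rw [setVec_singleton, add_assoc, vec_add_self, add_zero]
      exact he
    rcases st.inputErrorAllowed
    · exact ⟨_, _, rfl, .inl hC⟩
    · exact ⟨_, _, rfl, .inl hC⟩

theorem card_filter_cast {n : ℕ} (g : Fin n → ZMod 2) :
    (((Finset.univ.filter fun i => g i = 1).card : ℕ) : ZMod 2) = ∑ i, g i := by
  rw [Finset.card_filter, Nat.cast_sum]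
  refine Finset.sum_congr rfl fun i _ => ?_
  rcases zmod_two_cases (g i) with h | h <;> simp [h]

theorem odd_card_filter {n : ℕ} (g : Fin n → ZMod 2) :
    Odd (Finset.univ.filter fun i => g i = 1).card ↔ ∑ i, g i = 1 := by
  rw [← card_filter_cast, ZMod.natCast_eq_one_iff_odd]

/-- The decoder corrects a hook error. -/
theorem decode_hook (hk₁ : 0 < k₁) (hk₁' : Even k₁) (hk₂' : Even k₂) {h : Half}
    (H : HalfRun k₁ k₂ h) {o : HookOrigin} {st : Status}
    (hst : match o with
      | .input => st.inputErrorAllowed = true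
      | .internal => st.prevFailure = false)
    {V : Finset (Fin (k₁ + 2))} {R : Finset (Fin (k₂ + 2))} {e : Data k₁ k₂ → ZMod 2}
    (he : Hook V R e) (hH : H.Syndromes e 0 0) :
    ∃ C st', decode o st V R H.highSyndrome H.lowSyndrome = some (C, st') ∧
      (o = .input → st'.prevFailure = false) ∧ IsStabilizer (e + setVec C) := by
  have hH' := hH
  obtain ⟨⟨c, hb⟩, hl⟩ := hH
  simp only [Pi.zero_apply, add_zero] at hb hl
  have hhook : ∀ C : Finset (Data k₁ k₂), ∃ st' : Status, asHook o st C = some (C, st') ∧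
      (o = .input → st'.prevFailure = false) := by
    intro C
    cases o
    · exact ⟨⟨false, false⟩, by simp [asHook, asInput, hst], fun _ => rfl⟩
    · exact ⟨⟨true, false⟩, by simp [asHook, asInternal, hst], by simp⟩
  have hY : H.lowSyndrome = Finset.univ.filter fun j => ∑ i, e (i, j) = 1 := by
    simp only [HalfRun.lowSyndrome, hl]
  rcases he with ⟨rfl, rfl, q, hq⟩ | ⟨x, rfl, rfl, hx⟩ | ⟨y, rfl, rfl, hy⟩ | ⟨rfl, rfl, x, rfl⟩
  · have hst' : st.inputErrorAllowed = true ∨ st.prevFailure = false := by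
      cases o
      · exact .inl hst
      · exact .inr hst
    obtain ⟨C, st', hC, hP, rfl⟩ := decode_single_error hk₁ H (o := o) hst' hq hH'
    refine ⟨C, st', hC, ?_, ?_⟩
    · rintro rfl
      exact hP hst
    · rw [vec_add_self]
      exact isStabilizer_zero
  -- In a known column the row syndromes show the string itself, and the column syndrome only
  -- repeats its parity.
  · have hYx : H.lowSyndrome = Finset.univ.filter fun j => e (x, j) = 1 := by
      rw [hY]
      congr 1
      ext j
      rw [Finset.sum_eq_single x (fun i _ hi => hx _ hi) (by simp)]
    have hX : H.highSyndrome = if Odd H.lowSyndrome.card then {x} else ∅ := by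
      rw [hYx]
      simp only [odd_card_filter]
      refine H.highSyndrome_single hk₁ (c := c) fun i => ?_
      rw [hb]
      congr 1
      by_cases hi : i = x
      · subst hi
        rw [Pi.single_eq_same]
      · rw [Pi.single_eq_of_ne hi]
        exact Finset.sum_eq_zero fun j _ => hx _ hi
    obtain ⟨st', hC, hst'⟩ := hhook ({x} ×ˢ H.lowSyndrome)
    refine ⟨{x} ×ˢ H.lowSyndrome, st', ?_, hst', ?_⟩
    · rw [← hC]
      simp [decode, hX]
    · have hv : setVec ({x} ×ˢ H.lowSyndrome) = e := by
        ext ⟨i, j⟩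
        by_cases hi : i = x
        · subst hi
          rcases zmod_two_cases (e (i, j)) with h | h <;> simp [setVec, hYx, h]
        · simp [setVec, Ne.symm hi, hx (i, j) hi]
      rw [hv, vec_add_self]
      exact isStabilizer_zero
  -- In a known row the string is visible up to complement. The wrong choice differs by the
  -- stabilizer of the row, and as the number of columns is even it does not affect the parity test.
  · have hbY : ∀ i, H.meas (aq (.blk i)) = e (i, y) + c := fun i => by
      rw [hb, Finset.sum_eq_single y (fun j _ hj => hy _ hj) (by simp)]
    have hXy := H.highSyndrome_eq_or hbY
    have hodd : Odd H.highSyndrome.card ↔ ∑ i, e (i, y) = 1 := by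
      rw [← odd_card_filter]
      rcases hXy with h | h
      · rw [h]
      · have hle := Finset.card_le_univ (Finset.univ.filter fun i => e (i, y) = 1)
        rw [h, Finset.card_compl]
        rw [Fintype.card_fin] at hle ⊢
        obtain ⟨k, rfl⟩ := hk₁'
        simp only [Nat.odd_iff]
        omega
    have hYy : H.lowSyndrome = if Odd H.highSyndrome.card then {y} else ∅ := by
      simp only [hodd]
      refine H.lowSyndrome_single fun j => ?_
      rw [hl]
      by_cases hj : j = y
      · subst hj
        rw [Pi.single_eq_same]
      · rw [Pi.single_eq_of_ne hj]
        exact Finset.sum_eq_zero fun i _ => hy _ hj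
    obtain ⟨st', hC, hst'⟩ := hhook (H.highSyndrome ×ˢ {y})
    refine ⟨H.highSyndrome ×ˢ {y}, st', ?_, hst', ?_⟩
    · rw [← hC]
      simp [decode, hYy]
    · have hcase : setVec (H.highSyndrome ×ˢ {y}) = e ∨
          setVec (H.highSyndrome ×ˢ {y}) = e + rowVec k₁ k₂ y := by
        refine hXy.imp (fun h => ?_) fun h => ?_
        all_goals
          ext ⟨i, j⟩
          by_cases hj : j = y
          · subst hj
            rcases zmod_two_cases (e (i, j)) with h' | h' <;>
              simp [setVec, rowVec, h, h', zmod_two_add_self]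
          · simp [setVec, rowVec, hj, Ne.symm hj, hy (i, j) hj]
      rcases hcase with h | h <;> rw [h]
      · rw [vec_add_self]
        exact isStabilizer_zero
      · rw [← add_assoc, vec_add_self, zero_add]
        exact isStabilizer_rowVec y
  -- A complete column has even length, so it is invisible in the column syndromes, while every row
  -- sees one error. Columns `x` and `0` differ by a stabilizer.
  · have h₂ : ((k₂ : ZMod 2) + 2) = 0 := by exact_mod_cast even_cast_zmod_two (hk₂'.add even_two)
    have hX : H.highSyndrome = if (0 : ZMod 2) = 1 then {0} else ∅ := by
      refine H.highSyndrome_single hk₁ (c := c) fun i => ?_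
      rw [hb, Pi.single_zero]
      by_cases hi : i = x <;> simp [colVec, hi, h₂]
    rw [if_neg zero_ne_one] at hX
    have hY' : H.lowSyndrome = Finset.univ := by
      rw [hY]
      simp [colVec]
    obtain ⟨st', hC, hst'⟩ := hhook ({0} ×ˢ Finset.univ)
    refine ⟨{0} ×ˢ Finset.univ, st', ?_, hst', ?_⟩
    · rw [← hC]
      simp only [decode, hX, hY', and_self, if_true, Finset.univ_nonempty.ne_empty, and_false,
        if_false]
    · refine ⟨Pi.single x 1 + Pi.single 0 1, 0, ?_, ?_⟩
      · simp [Finset.sum_add_distrib, zmod_two_add_self]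
      · ext p
        simp only [colVec, setVec, Pi.add_apply, Pi.single_apply, Finset.mem_product,
          Finset.mem_singleton, Finset.mem_univ, and_true, Pi.zero_apply, add_zero]

end ConcatIceberg

namespace ConcatIceberg

variable {k₁ k₂ : ℕ}

/-! ### A cycle -/

theorem Pauli.ext_comp {Q : Type} {P R : Pauli Q} (h : Half) (h₁ : P.comp h = R.comp h)
    (h₂ : P.comp h.swap = R.comp h.swap) : P = R := by
  obtain ⟨x, z⟩ := P
  obtain ⟨x', z'⟩ := R
  cases h
  · obtain rfl : x = x' := h₁
    obtain rfl : z = z' := h₂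
    rfl
  · obtain rfl : z = z' := h₁
    obtain rfl : x = x' := h₂
    rfl

/-- The result of half a cycle with at most one fault. -/
theorem HalfRun.output (hk : Even k₁) {h : Half} (H : HalfRun k₁ k₂ h) (hf : H.faults ≤ 1)
    (E : Pauli (Data k₁ k₂)) (χ : QState (Anc k₁ k₂)) {ψ₀ : QState (Data k₁ k₂)}
    (hψ₀ : ψ₀ ∈ codeSpace k₁ k₂) (hne : H.run ((E.apply ψ₀).prod χ) ≠ 0) :
    ∃ (E' : Pauli (Data k₁ k₂)) (χ' : QState (Anc k₁ k₂)),
      (∀ ψ ∈ codeSpace k₁ k₂, H.run ((E.apply ψ).prod χ) = (E'.apply ψ).prod χ') ∧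
      (∃ s, IsStabilizer s ∧ Hook H.highFlags H.lowFlags (E'.comp h + E.comp h + s)) ∧
      (∃ i j b l d, (d = 0 → b = 0 ∨ l = 0) ∧
        E'.comp h.swap = E.comp h.swap + Pi.single (i, j) d ∧
        H.Syndromes (E.comp h.swap) (Pi.single i b) (Pi.single j l)) ∧
      (H.faults = 0 → H.highFlags = ∅ ∧ H.lowFlags = ∅ ∧ E' = E ∧
        H.Syndromes (E.comp h.swap) 0 0) := by
  obtain ⟨⟨χ', hχ'⟩, hchk, hflg, hlf, hblk, hlow⟩ := H.run_prod E χ hψ₀ hne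
  obtain ⟨hs, h₀⟩ := H.hook_errors hf hflg hlf
  obtain ⟨i, j, b, l, d, h₁, h₂, h₃, h₄⟩ := H.detected_errors hk hf hchk hblk hlow
  refine ⟨_, χ', hχ', hs, ⟨i, j, b, l, d, h₁, h₂, h₃⟩, fun hf₀ => ?_⟩
  obtain ⟨hV, hR, h₅⟩ := h₀ hf₀
  obtain ⟨rfl, rfl, rfl⟩ := h₄ hf₀
  rw [Pi.single_zero] at h₂ h₃
  rw [Pi.single_zero] at h₃
  exact ⟨hV, hR, Pauli.ext_comp h h₅ (by rw [h₂, add_zero]), h₃⟩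

theorem IsStabilizer.of_add {e s : Data k₁ k₂ → ZMod 2} (h : IsStabilizer (e + s))
    (hs : IsStabilizer s) : IsStabilizer e := by
  have h' := h.add hs
  rwa [add_assoc, vec_add_self, add_zero] at h'

theorem decode_trivial (hk₁ : 0 < k₁) (hk₁' : Even k₁) (hk₂' : Even k₂) {h : Half}
    (H : HalfRun k₁ k₂ h) (o : HookOrigin) (st : Status) {e : Data k₁ k₂ → ZMod 2}
    (he : IsStabilizer e) (hH : H.Syndromes e 0 0) :
    decode o st ∅ ∅ H.highSyndrome H.lowSyndrome =
      some ((∅ : Finset (Data k₁ k₂)), ⟨false, true⟩) := by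
  obtain ⟨⟨c, hb⟩, hl⟩ := hH
  obtain ⟨⟨a, ha⟩, h₀⟩ := he.syndrome hk₁' hk₂'
  have hX : H.highSyndrome = if (0 : ZMod 2) = 1 then {0} else ∅ :=
    H.highSyndrome_single hk₁ (c := a + c) fun i => by rw [hb, ha]; simp
  have hY : H.lowSyndrome = if (0 : ZMod 2) = 1 then {0} else ∅ :=
    H.lowSyndrome_single fun j => by rw [hl, h₀]; simp
  rw [hX, hY, if_neg zero_ne_one, if_neg zero_ne_one, decode_empty]

/-- Errors and memory after a cycle without a fault. -/
def Clean (μ : Memory k₁ k₂) (E : Pauli (Data k₁ k₂)) : Prop :=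
  (IsStabilizer E.x ∧ μ.xStatus.prevFailure = false) ∧
    IsStabilizer E.z ∧ μ.zStatus.prevFailure = false ∧ μ.zHighFlags = ∅ ∧ μ.zLowFlags = ∅

/-- Errors and memory after a cycle with at most one fault. -/
def AlmostClean (μ : Memory k₁ k₂) (E : Pauli (Data k₁ k₂)) : Prop :=
  -- Only `Z` errors may form strings at the end of a cycle: strings of `X` errors arise in the
  -- first half and are corrected with the syndromes of the second. An uncorrected error comes with
  -- `inputErrorAllowed`, so that the next decoder need not halt.
  (IsStabilizer E.x ∨ (μ.xStatus.inputErrorAllowed = true ∧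
    ∃ s : Data k₁ k₂ → ZMod 2, IsStabilizer s ∧ ∃ q, ∀ p, p ≠ q → (E.x + s) p = 0)) ∧
  ((IsStabilizer E.z ∧ μ.zHighFlags = ∅ ∧ μ.zLowFlags = ∅) ∨
    (μ.zStatus.inputErrorAllowed = true ∧
      ∃ s, IsStabilizer s ∧ Hook μ.zHighFlags μ.zLowFlags (E.z + s)))

theorem Clean.almostClean {μ : Memory k₁ k₂} {E : Pauli (Data k₁ k₂)} (h : Clean μ E) :
    AlmostClean μ E :=
  ⟨.inl h.1.1, .inl ⟨h.2.1, h.2.2.2⟩⟩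

theorem AlmostClean.decode_z (hk₁ : 0 < k₁) (hk₁' : Even k₁) (hk₂' : Even k₂)
    {μ : Memory k₁ k₂} {E : Pauli (Data k₁ k₂)} (hE : AlmostClean μ E) {h : Half}
    {H : HalfRun k₁ k₂ h} (hH : H.Syndromes E.z 0 0) :
    ∃ C st', decode .input μ.zStatus μ.zHighFlags μ.zLowFlags H.highSyndrome H.lowSyndrome =
      some (C, st') ∧ st'.prevFailure = false ∧ IsStabilizer (E.z + setVec C) := by
  rcases hE.2 with ⟨h₁, h₂, h₃⟩ | ⟨hA, s, hs, hs'⟩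
  · rw [h₂, h₃]
    exact ⟨_, _, decode_trivial hk₁ hk₁' hk₂' H _ _ h₁ hH, rfl, by rwa [setVec_empty, add_zero]⟩
  · obtain ⟨C, st', hC, hP, hS⟩ := decode_hook hk₁ hk₁' hk₂' H (o := .input) (st := μ.zStatus) hA hs'
      (hH.add_stabilizer hk₁' hk₂' hs)
    exact ⟨C, st', hC, hP rfl, IsStabilizer.of_add (by rwa [add_right_comm]) hs⟩

theorem AlmostClean.decode_x (hk₁ : 0 < k₁) (hk₁' : Even k₁) (hk₂' : Even k₂)
    {μ : Memory k₁ k₂} {E : Pauli (Data k₁ k₂)} (hE : AlmostClean μ E) {h : Half}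
    {H : HalfRun k₁ k₂ h} (hH : H.Syndromes E.x 0 0) :
    ∃ C st', decode .internal μ.xStatus ∅ ∅ H.highSyndrome H.lowSyndrome = some (C, st') ∧
      st'.prevFailure = false ∧ IsStabilizer (E.x + setVec C) := by
  rcases hE.1 with h₁ | ⟨hA, s, hs, q, hq⟩
  · exact ⟨_, _, decode_trivial hk₁ hk₁' hk₂' H _ _ h₁ hH, rfl, by rwa [setVec_empty, add_zero]⟩
  · obtain ⟨C, st', hC, hP, hS⟩ := decode_single_error hk₁ H (o := .internal) (st := μ.xStatus)
      (.inl hA) hq (hH.add_stabilizer hk₁' hk₂' hs)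
    refine ⟨C, st', hC, hP hA, ?_⟩
    rw [hS, ← add_assoc, vec_add_self, zero_add]
    exact hs

theorem HalfRun.run_zero {h : Half} (H : HalfRun k₁ k₂ h) : H.run 0 = 0 := by
  have h₁ : ∀ (ops : List (Op (Qubit k₁ k₂) × Fault)) r m,
      ops.foldl (fun φ p => p.1.noisy r m p.2 φ) (0 : QState (Qubit k₁ k₂)) = 0 := fun ops r m => by
    simpa using foldl_noisy_smul ops r m 0 0
  have h₂ : ∀ l : List (Attempt k₁ k₂ h),
      l.foldl (fun Φ A => A.run 1 Φ) (0 : QState (Qubit k₁ k₂)) = 0 := fun l => by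
    induction l with
    | nil => rfl
    | cons A l ih =>
      have hA : A.run 1 (0 : QState (Qubit k₁ k₂)) = 0 := h₁ _ _ _
      rw [List.foldl_cons, hA, ih]
  rw [HalfRun.run, h₂]
  exact (congrArg _ (h₁ _ _ _)).trans (h₁ _ _ _)

/-- A cycle, when all faults occur in one half. -/
theorem CycleRun.output (hk₁ : 0 < k₁) (hk₁' : Even k₁) (hk₂' : Even k₂) (c : CycleRun k₁ k₂)
    {μ : Memory k₁ k₂} {E : Pauli (Data k₁ k₂)}
    (hE : (Clean μ E ∧ c.faults ≤ 1) ∨ (AlmostClean μ E ∧ c.faults = 0))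
    (χ : QState (Anc k₁ k₂)) {ψ₀ : QState (Data k₁ k₂)} (hψ₀ : ψ₀ ∈ codeSpace k₁ k₂)
    (hne : c.second.run (c.first.run ((E.apply ψ₀).prod χ)) ≠ 0) :
    ∃ (E₂ P : Pauli (Data k₁ k₂)) (χ₂ : QState (Anc k₁ k₂)) (μ' : Memory k₁ k₂),
      (∀ ψ ∈ codeSpace k₁ k₂,
        c.second.run (c.first.run ((E.apply ψ).prod χ)) = (E₂.apply ψ).prod χ₂) ∧
      decodeCycle μ c = some (P, μ') ∧ AlmostClean μ' (P.mul E₂) ∧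
      (c.faults = 0 → Clean μ' (P.mul E₂)) := by
  have hf : c.faults = c.first.faults + c.second.faults := rfl
  have hf₁ : c.faults ≤ 1 := by
    rcases hE with h | h
    · exact h.2
    · omega
  have hne₁ : c.first.run ((E.apply ψ₀).prod χ) ≠ 0 := by
    intro h
    rw [h, HalfRun.run_zero] at hne
    exact hne rfl
  obtain ⟨E₁, χ₁, hrun₁, hhook₁, hdet₁, hclean₁⟩ :=
    c.first.output hk₁' (by omega) E χ hψ₀ hne₁
  rw [hrun₁ ψ₀ hψ₀] at hne
  obtain ⟨E₂, χ₂, hrun₂, hhook₂, hdet₂, hclean₂⟩ :=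
    c.second.output hk₁' (by omega) E₁ χ₁ hψ₀ hne
  have hrun : ∀ ψ ∈ codeSpace k₁ k₂,
      c.second.run (c.first.run ((E.apply ψ).prod χ)) = (E₂.apply ψ).prod χ₂ := fun ψ hψ => by
    rw [hrun₁ ψ hψ, hrun₂ ψ hψ]
  have hdec : ∀ {Cz sz Cx sx},
      decode .input μ.zStatus μ.zHighFlags μ.zLowFlags c.first.highSyndrome c.first.lowSyndrome =
        some (Cz, sz) →
      decode .internal μ.xStatus c.first.highFlags c.first.lowFlags c.second.highSyndrome
        c.second.lowSyndrome = some (Cx, sx) →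
      decodeCycle μ c =
        some (⟨setVec Cx, setVec Cz⟩, ⟨sz, sx, c.second.highFlags, c.second.lowFlags⟩) := by
    intro Cz sz Cx sx h₁ h₂
    rw [decodeCycle, h₁, h₂]
  simp only [Pauli.comp, Half.swap] at hhook₁ hdet₁ hclean₁ hhook₂ hdet₂ hclean₂
  -- Without faults the syndromes are exact and the remaining errors are corrected as input errors.
  by_cases hf₀ : c.faults = 0
  · obtain ⟨hV₁, hR₁, rfl, hS₁⟩ := hclean₁ (by omega)
    obtain ⟨hV₂, hR₂, rfl, hS₂⟩ := hclean₂ (by omega)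
    have hE' : AlmostClean μ E₂ := by
      rcases hE with h | h
      · exact h.1.almostClean
      · exact h.1
    obtain ⟨Cz, sz, hz, hPz, hz'⟩ := hE'.decode_z hk₁ hk₁' hk₂' hS₁
    obtain ⟨Cx, sx, hx, hPx, hx'⟩ := hE'.decode_x hk₁ hk₁' hk₂' hS₂
    rw [← hV₁, ← hR₁] at hx
    have hc : Clean ⟨sz, sx, c.second.highFlags, c.second.lowFlags⟩
        ((⟨setVec Cx, setVec Cz⟩ : Pauli _).mul E₂) := by
      refine ⟨⟨?_, hPx⟩, ?_, hPz, hV₂, hR₂⟩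
      · rw [add_comm] at hx'
        exact hx'
      · rw [add_comm] at hz'
        exact hz'
    exact ⟨E₂, _, χ₂, _, hrun, hdec hz hx, hc.almostClean, fun _ => hc⟩
  · obtain ⟨⟨hEx, hPx⟩, hEz, hPz, hV, hR⟩ : Clean μ E := by
      rcases hE with h | h
      · exact h.1
      · exact absurd h.2 hf₀
    -- A fault in the first half is internal to the detection of `Z` errors, while its `X` errors
    -- are hook errors seen by the faultless second half.
    by_cases hf₂ : c.second.faults = 0
    · obtain ⟨hV₂, hR₂, rfl, hS₂⟩ := hclean₂ hf₂
      obtain ⟨s, hs, hhook⟩ := hhook₁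
      obtain ⟨i, j, b, l, d, hd, hz₁, hS₁⟩ := hdet₁
      obtain ⟨Cz, sz, hz, hz'⟩ :=
        decode_internal_fault hk₁ hk₁' hk₂' c.first .input hPz hEz hd hS₁
      -- The incoming `X` error is a stabilizer, so the syndromes of the total error are those of
      -- the hook error.
      have hS := (hS₂.add_stabilizer hk₁' hk₂' hEx).add_stabilizer hk₁' hk₂' hs
      obtain ⟨Cx, sx, hx, -, hx'⟩ :=
        decode_hook hk₁ hk₁' hk₂' c.second (o := .internal) (st := μ.xStatus) hPx hhook hS
      rw [← hV, ← hR] at hz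
      refine ⟨E₂, _, χ₂, _, hrun, hdec hz hx, ⟨.inl ?_, ?_⟩, fun h => absurd h hf₀⟩
      · refine IsStabilizer.of_add (IsStabilizer.of_add (s := s) ?_ hs) hEx
        convert hx' using 1
        simp only [Pauli.mul]
        abel
      · simp only [Pauli.mul, hz₁]
        rcases hz' with hz' | ⟨hA, hC⟩
        · exact .inl ⟨by rwa [add_comm], hV₂, hR₂⟩
        · refine .inr ⟨hA, E.z, hEz, .inl ⟨hV₂, hR₂, (i, j), fun p hp => ?_⟩⟩
          rw [hC, zero_add, add_right_comm, vec_add_self, zero_add, Pi.single_eq_of_ne hp]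
    -- A fault in the second half is internal to the detection of `X` errors. Its `Z` errors come
    -- after the `Z` decoding, which sees nothing, and are handed on together with their flags.
    · obtain ⟨hV₁, hR₁, rfl, hS₁⟩ := hclean₁ (by omega)
      obtain ⟨s, hs, hhook⟩ := hhook₂
      obtain ⟨i, j, b, l, d, hd, hx₂, hS₂⟩ := hdet₂
      have hz := decode_trivial hk₁ hk₁' hk₂' c.first .input μ.zStatus hEz hS₁
      obtain ⟨Cx, sx, hx, hx'⟩ :=
        decode_internal_fault hk₁ hk₁' hk₂' c.second .internal hPx hEx hd hS₂
      rw [← hV₁, ← hR₁] at hx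
      nth_rw 1 [← hV] at hz
      nth_rw 1 [← hR] at hz
      refine ⟨E₂, _, χ₂, _, hrun, hdec hz hx, ⟨?_, ?_⟩, fun h => absurd h hf₀⟩
      · simp only [Pauli.mul, hx₂]
        rcases hx' with hx' | ⟨hA, hC⟩
        · exact .inl (by rwa [add_comm])
        · refine .inr ⟨hA, E₁.x, hEx, (i, j), fun p hp => ?_⟩
          rw [hC, zero_add, add_right_comm, vec_add_self, zero_add, Pi.single_eq_of_ne hp]
      · refine .inr ⟨rfl, E₁.z + s, hEz.add hs, ?_⟩
        simp only [Pauli.mul, setVec_empty, zero_add, ← add_assoc]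
        exact hhook

/-! ### The computation -/

theorem CycleRun.step_some (Ψ : QState (Qubit k₁ k₂)) (μ : Memory k₁ k₂) (c : CycleRun k₁ k₂) :
    c.step ⟨Ψ, some μ⟩ =
      match decodeCycle μ c with
      | none => ⟨c.second.run (c.first.run Ψ), none⟩
      | some (P, μ') => ⟨(P.onLeft (Anc k₁ k₂)).apply (c.second.run (c.first.run Ψ)), some μ'⟩ := rfl

theorem CycleRun.step_state_ne_zero {Ψ : QState (Qubit k₁ k₂)} {μ : Memory k₁ k₂}
    {c : CycleRun k₁ k₂} (h : (c.step ⟨Ψ, some μ⟩).state ≠ 0) :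
    c.second.run (c.first.run Ψ) ≠ 0 := by
  rw [CycleRun.step_some] at h
  rcases hd : decodeCycle μ c with _ | ⟨P, μ'⟩ <;> rw [hd] at h
  · exact h
  · exact Pauli.apply_ne_zero h

/-- A history of nonzero probability has initial segments of nonzero probability, as needed to apply
the results on single cycles. -/
theorem foldl_step_state_ne_zero {runs : List (CycleRun k₁ k₂)} {cfg : Config k₁ k₂}
    (h : (runs.foldl CycleRun.step cfg).state ≠ 0) : cfg.state ≠ 0 := by
  induction runs generalizing cfg with
  | nil => exact h
  | cons c runs ih =>
    have h' : (c.step cfg).state ≠ 0 := ih h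
    obtain ⟨Ψ, _ | μ⟩ := cfg
    · exact h'
    · rintro rfl
      exact CycleRun.step_state_ne_zero h' (by rw [HalfRun.run_zero, HalfRun.run_zero])

/-- The invariant couples the state of the errors with the fault budget of the next cycle: one fault
is affordable after `Clean`, none after `AlmostClean`. -/
theorem foldl_step_eq (hk₁ : 0 < k₁) (hk₁' : Even k₁) (hk₂' : Even k₂)
    {runs : List (CycleRun k₁ k₂)} (hruns : runs.IsChain fun c d => c.faults + d.faults ≤ 1)
    {μ : Memory k₁ k₂} {E : Pauli (Data k₁ k₂)}
    (hE : (Clean μ E ∧ ∀ c ∈ runs.head?, c.faults ≤ 1) ∨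
      (AlmostClean μ E ∧ ∀ c ∈ runs.head?, c.faults = 0))
    {χ : QState (Anc k₁ k₂)}
    (hne : ∃ ψ ∈ codeSpace k₁ k₂,
      (runs.foldl CycleRun.step ⟨(E.apply ψ).prod χ, some μ⟩).state ≠ 0) :
    ∃ (μ' : Memory k₁ k₂) (E' : Pauli (Data k₁ k₂)) (χ' : QState (Anc k₁ k₂)),
      AlmostClean μ' E' ∧ ∀ ψ ∈ codeSpace k₁ k₂,
        runs.foldl CycleRun.step ⟨(E.apply ψ).prod χ, some μ⟩ = ⟨(E'.apply ψ).prod χ', some μ'⟩ := by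
  induction runs generalizing μ E χ with
  | nil => exact ⟨μ, E, χ, hE.elim (fun h => h.1.almostClean) fun h => h.1, fun ψ _ => rfl⟩
  | cons c runs ih =>
    obtain ⟨ψ₀, hψ₀, hne⟩ := hne
    have hE' : (Clean μ E ∧ c.faults ≤ 1) ∨ (AlmostClean μ E ∧ c.faults = 0) :=
      hE.imp (fun h => ⟨h.1, h.2 c rfl⟩) fun h => ⟨h.1, h.2 c rfl⟩
    have hne' := CycleRun.step_state_ne_zero (foldl_step_state_ne_zero (runs := runs) hne)
    obtain ⟨E₂, P, χ₂, μ', hrun, hdec, hd, hc⟩ := c.output hk₁ hk₁' hk₂' hE' χ hψ₀ hne'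
    have hstep : ∀ ψ ∈ codeSpace k₁ k₂, c.step ⟨(E.apply ψ).prod χ, some μ⟩ =
        -- The sign from multiplying Pauli operators is independent of `ψ` and is absorbed in the
        -- ancilla state.
        ⟨((P.mul E₂).apply ψ).prod (sgn (E₂.z ⬝ᵥ P.x) • χ₂), some μ'⟩ := fun ψ hψ => by
      rw [CycleRun.step_some, hdec, hrun ψ hψ]
      dsimp only
      rw [Pauli.onLeft_apply_prod, Pauli.apply_apply, QState.prod_smul]
      congr 1
      ext s
      exact mul_assoc _ _ _
    rw [List.isChain_cons] at hruns
    have hnext : (Clean μ' (P.mul E₂) ∧ ∀ d ∈ runs.head?, d.faults ≤ 1) ∨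
        (AlmostClean μ' (P.mul E₂) ∧ ∀ d ∈ runs.head?, d.faults = 0) := by
      by_cases h₀ : c.faults = 0
      · refine .inl ⟨hc h₀, fun d hd' => ?_⟩
        have := hruns.1 d hd'
        omega
      · refine .inr ⟨hd, fun d hd' => ?_⟩
        have := hruns.1 d hd'
        omega
    rw [List.foldl_cons, hstep ψ₀ hψ₀] at hne
    obtain ⟨μ'', E', χ', hE'', h⟩ := ih hruns.2 hnext ⟨ψ₀, hψ₀, hne⟩
    exact ⟨μ'', E', χ', hE'', fun ψ hψ => by rw [List.foldl_cons, hstep ψ hψ, h ψ hψ]⟩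

theorem Pauli.apply_stabilizer {ψ : QState (Data k₁ k₂)} (hψ : ψ ∈ codeSpace k₁ k₂)
    {x z : Data k₁ k₂ → ZMod 2} (hx : IsStabilizer x) (hz : IsStabilizer z) :
    (⟨x, z⟩ : Pauli _).apply ψ = ψ := by
  have h₁ := stab_of_mem_codeSpace hψ .X hx
  have h₂ := stab_of_mem_codeSpace hψ .Z hz
  rw [Stab, sgn_zero, one_smul] at h₁ h₂
  ext s
  have h₃ : ψ (s + x) = ψ s := by simpa [Pauli.apply, ofType] using congrFun h₁ s
  have h₄ : sgn (∑ q, z q * s q) * ψ s = ψ s := by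
    simpa [Pauli.apply, ofType] using congrFun h₂ s
  change sgn (∑ q, z q * s q) * ψ (s + x) = ψ s
  rw [h₃, h₄]

theorem AlmostClean.exists_genWeightLEOne {μ : Memory k₁ k₂} {E : Pauli (Data k₁ k₂)}
    (hE : AlmostClean μ E) :
    ∃ x z : Data k₁ k₂ → ZMod 2, IsStabilizer x ∧ IsStabilizer z ∧ GenWeightLEOne ∅ ∅ (E.x + x) ∧
      GenWeightLEOne μ.zHighFlags μ.zLowFlags (E.z + z) := by
  have hx : ∃ x : Data k₁ k₂ → ZMod 2, IsStabilizer x ∧ GenWeightLEOne ∅ ∅ (E.x + x) := by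
    rcases hE.1 with h | ⟨-, s, hs, hq⟩
    · exact ⟨E.x, h, .inl ⟨(0, 0), fun p _ => zmod_two_add_self _⟩⟩
    · exact ⟨s, hs, .inl hq⟩
  have hz : ∃ z : Data k₁ k₂ → ZMod 2, IsStabilizer z ∧
      GenWeightLEOne μ.zHighFlags μ.zLowFlags (E.z + z) := by
    rcases hE.2 with ⟨h, -⟩ | ⟨-, s, hs, hh⟩
    · exact ⟨E.z, h, .inl ⟨(0, 0), fun p _ => zmod_two_add_self _⟩⟩
    · exact ⟨s, hs, hh.genWeightLEOne⟩
  obtain ⟨x, hx, hx'⟩ := hx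
  obtain ⟨z, hz, hz'⟩ := hz
  exact ⟨x, z, hx, hz, hx', hz'⟩

theorem clean_init : Clean (Memory.init k₁ k₂) ⟨0, 0⟩ :=
  ⟨⟨isStabilizer_zero, rfl⟩, isStabilizer_zero, rfl, rfl, rfl⟩

end ConcatIceberg

theorem proposition2 (k₁ k₂ : ℕ) (hk₁ : 0 < k₁) (hk₂ : 0 < k₂) (hk₁' : Even k₁) (hk₂' : Even k₂)
    (m : ℕ) (runs : List (ConcatIceberg.CycleRun k₁ k₂)) (hm : runs.length = m)
    (hgood : ConcatIceberg.ExRecsGood runs)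
    (χ₀ : ConcatIceberg.QState (ConcatIceberg.Anc k₁ k₂))
    (hprob : ∃ ψ ∈ ConcatIceberg.codeSpace k₁ k₂,
      (ConcatIceberg.execute runs ψ χ₀).state ≠ 0) :
    ∃ (μ : ConcatIceberg.Memory k₁ k₂) (E : ConcatIceberg.Pauli (ConcatIceberg.Data k₁ k₂))
      (χ : ConcatIceberg.QState (ConcatIceberg.Anc k₁ k₂)),
      ConcatIceberg.GenWeightLEOne ∅ ∅ E.x ∧
      ConcatIceberg.GenWeightLEOne μ.zHighFlags μ.zLowFlags E.z ∧
      ∀ ψ ∈ ConcatIceberg.codeSpace k₁ k₂,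
        ConcatIceberg.execute runs ψ χ₀ = ⟨(E.apply ψ).prod χ, some μ⟩ := by
  open ConcatIceberg in
  -- The first cycle has at most one fault: by the separate clause if it is the only one, otherwise
  -- by the bound on the first pair.
  have hhead : ∀ c ∈ runs.head?, c.faults ≤ 1 := by
    intro c hc
    rcases runs with _ | ⟨d, _ | ⟨d', runs⟩⟩
    · simp at hc
    · exact hgood.2 rfl c (List.mem_of_mem_head? hc)
    · obtain rfl : d = c := by simpa using hc
      have := (List.isChain_cons_cons.1 hgood.1).1
      omega
  have hexec : ∀ ψ, execute runs ψ χ₀ = runs.foldl CycleRun.step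
      ⟨((⟨0, 0⟩ : Pauli (Data k₁ k₂)).apply ψ).prod χ₀, some (Memory.init k₁ k₂)⟩ := fun ψ => by
    rw [Pauli.apply_id]
    rfl
  simp only [hexec] at hprob ⊢
  obtain ⟨μ, E, χ, hE, h⟩ :=
    foldl_step_eq hk₁ hk₁' hk₂' hgood.1 (.inl ⟨clean_init, hhead⟩) hprob
  obtain ⟨x, z, hx, hz, hEx, hEz⟩ := hE.exists_genWeightLEOne
  -- Multiplication by the stabilizers `x` and `z` does not change the action on code states, apart
  -- from a sign which the ancillas absorb.
  refine ⟨μ, E.mul ⟨x, z⟩, sgn (z ⬝ᵥ E.x) • χ, hEx, hEz, fun ψ hψ => ?_⟩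
  have h' := Pauli.apply_apply E ⟨x, z⟩ ψ
  rw [Pauli.apply_stabilizer hψ hx hz] at h'
  rw [h ψ hψ, h', QState.prod_smul]
  congr 1
  ext s
  exact mul_assoc _ _ _
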